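/- Let $d\ge 1$, $\mu>1/2$, $\nu>1$, $\langle x\rangle=(1+|x|^2)^{1/2}$. Let $a(x)=(a_{mn}(x))_{m,n=1}^d$ be a positive definite real symmetric matrix for each $x\in\mathbb{R}^d$, and let $V=V^{(L)}+V^{(S)}$, where $a_{mn},V,V^{(L)},V^{(S)}\in C^\infty(\mathbb{R}^d;\mathbb{R})$ and, for every multi-index $\alpha$, there is $C_\alpha>0$ such that for all $x\in\mathbb{R}^d$ $$|\partial_x^\alpha(a_{mn}(x)-\delta_{mn})|\le C_\alpha\langle x\rangle^{-\mu-|\alpha|},\quad |\partial_x^\alpha V(x)|+|\partial_x^\alpha V^{(L)}(x)|\le C_\alpha\langle x\rangle^{2-\mu-|\alpha|},\quad |\partial_x^\alpha V^{(S)}(x)|\le C_\alpha\langle x\rangle^{2-\nu-|\alpha|}.$$ Put $k(x,\xi)=\frac12\sum_{m,n}a_{mn}(x)\xi_m\xi_n$, $p=k+V$, and $$\Phi(t,\xi)=\int_0^t\big(k(s\xi,\xi)+V^{(L)}(s\xi)\big)\,ds,\qquad \Psi(t,\xi)=\int_0^t k(s\xi,\xi)\,ds.$$ Let $(x(t;x_0,\xi_0),\xi(t;x_0,\xi_0))=\exp(tH_p)(x_0,\xi_0)$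 and $(y(t;x_0,\xi_0),\eta(t;x_0,\xi_0))=\exp(tH_k)(x_0,\xi_0)$ be the Hamilton flows of $p$ and $k$. Assume that $k$ is nontrapping: $|y(t;x_0,\xi_0)|\to\infty$ as $t\to\pm\infty$ for all $x_0$ and all $\xi_0\ne0$. Then both flows exist globally in time. For each sign and all $(x_0,\xi_0)$ with $\xi_0\neq0$ the limits $$x_\pm=\lim_{t\to\pm\infty}\big(y(t;x_0,\xi_0)-\partial_\xi\Psi(t,\eta(t;x_0,\xi_0))\big),\qquad \xi_\pm=\lim_{t\to\pm\infty}\eta(t;x_0,\xi_0)$$ exist, $\xi_\pm\ne0$, and $(x_\pm,\xi_\pm)$ determines $(x_0,\xi_0)$; write $(x_0,\xi_0)=W^{cl}_\pm(x_\pm,\xi_\pm)$. For every fixed $t$ with $\pm t>0$, as $\lambda\to\infty$, $$x(t;x_0,\lambda\xi_0)-\partial_\xi\Phi\big(t,\xi(t;x_0,\lambda\xi_0)\big)\to x_\pm,\qquad \lambda^{-1}\xi(t;x_0,\lambda\xi_0)\to\xi_\pm .$$ The limits are $C^\infty$ functions of $(x_0,\xi_0)\in\mathbb{R}^d\times(\mathbb{R}^d\setminus\{0\})$,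 and the convergence is locally uniform in $(x_0,\xi_0)$ on this set together with all derivatives in $(x_0,\xi_0)$. -/

import Mathlib

open Filter Topology Set
open scoped ContDiff Gradient

noncomputable section

/-- The Euclidean space `ℝ^d`. -/
abbrev Euc (d : ℕ) : Type := EuclideanSpace ℝ (Fin d)

/-- The Japanese bracket `⟨x⟩ = (1 + |x|²)^{1/2}`. -/
def japaneseBracket {d : ℕ} (x : Euc d) : ℝ := Real.sqrt (1 + ‖x‖ ^ 2)

/-- `f` is a smooth real function on `ℝ^d` and, for every order `n`, its derivatives of order `n`
are bounded by a constant times `⟨x⟩^{m - n}`. The full derivative of order `n` collects the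
finitely many partial derivatives `∂^α f` with `|α| = n`. -/
structure HasSymbolBounds {d : ℕ} (m : ℝ) (f : Euc d → ℝ) : Prop where
  smooth : ContDiff ℝ ∞ f
  bound : ∀ n : ℕ, ∃ C : ℝ, 0 < C ∧ ∀ x : Euc d,
    ‖iteratedFDeriv ℝ n f x‖ ≤ C * japaneseBracket x ^ (m - (n : ℝ))

/-- Long range perturbation of the flat Laplacian, with exponent `μ > 0`: the symmetric matrix
`a(x)` is positive definite, `a_{mn} - δ_{mn} = O(⟨x⟩^{-μ})` and `V = O(⟨x⟩^{2-μ})`, with the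
corresponding bounds on all derivatives. -/
structure IsLongRange {d : ℕ} (a : Euc d → Matrix (Fin d) (Fin d) ℝ) (V : Euc d → ℝ) (μ : ℝ) :
    Prop where
  exponent_pos : 0 < μ
  metric : ∀ m n : Fin d,
    HasSymbolBounds (-μ) (fun x => a x m n - (1 : Matrix (Fin d) (Fin d) ℝ) m n)
  potential : HasSymbolBounds (2 - μ) V
  posDef : ∀ x, (a x).PosDef

/-- The kinetic energy `k(x,ξ) = ½ ∑ a_{mn}(x) ξ_m ξ_n`. -/
def kineticEnergy {d : ℕ} (a : Euc d → Matrix (Fin d) (Fin d) ℝ) (x ξ : Euc d) : ℝ :=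
  (1 / 2 : ℝ) * ∑ m, ∑ n, a x m n * ξ m * ξ n

/-- The Hamiltonian `k(x,ξ) + U(x)` with potential `U`. -/
def hamiltonian {d : ℕ} (a : Euc d → Matrix (Fin d) (Fin d) ℝ) (U : Euc d → ℝ)
    (x ξ : Euc d) : ℝ :=
  kineticEnergy a x ξ + U x

/-- `γ(t) = (x(t), ξ(t))`, `t ∈ ℝ`, solves the Hamilton equations
`x' = ∂H/∂ξ`, `ξ' = -∂H/∂x` with initial value `z`. -/
def IsTrajectory {d : ℕ} (H : Euc d → Euc d → ℝ) (z : Euc d × Euc d)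
    (γ : ℝ → Euc d × Euc d) : Prop :=
  γ 0 = z ∧ ∀ t : ℝ, HasDerivAt γ
    (∇ (fun ξ => H (γ t).1 ξ) (γ t).2, -∇ (fun x => H x (γ t).2) (γ t).1) t

open Classical in
/-- The Hamilton flow `exp(t H_p)` of the Hamiltonian `H`: the value at time `t` of the
trajectory that starts at `z` (and `z` itself if there is no global trajectory). -/
def hamiltonFlow {d : ℕ} (H : Euc d → Euc d → ℝ) (t : ℝ) (z : Euc d × Euc d) : Euc d × Euc d :=
  if h : ∃ γ : ℝ → Euc d × Euc d, IsTrajectory H z γ then h.choose t else z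

/-- The global nontrapping condition for the flow of the kinetic energy. -/
def IsNontrapping {d : ℕ} (a : Euc d → Matrix (Fin d) (Fin d) ℝ) : Prop :=
  ∀ (z : Euc d × Euc d) (γ : ℝ → Euc d × Euc d), z.2 ≠ 0 →
    IsTrajectory (kineticEnergy a) z γ →
    Tendsto (fun t => ‖(γ t).1‖) atTop atTop ∧ Tendsto (fun t => ‖(γ t).1‖) atBot atTop

/-- The Dollard type modifier `∫₀ᵗ H(sξ, ξ) ds` of the Hamiltonian `H`. -/
def dollardModifier {d : ℕ} (H : Euc d → Euc d → ℝ) (t : ℝ) (ξ : Euc d) : ℝ :=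
  ∫ s in (0 : ℝ)..t, H (s • ξ) ξ

/-- The phase space `ℝ^d × (ℝ^d \ {0})`. -/
def phaseSpace (d : ℕ) : Set (Euc d × Euc d) := {z | z.2 ≠ 0}

/-- For `ε = ±1`, with `(y(t), η(t)) = exp(tH_k) z` and `Ψ(t,ξ) = ∫₀ᵗ k(sξ,ξ) ds`, the pair
`w = (x_±, ξ_±)` is the limit of `(y(t) - ∂_ξ Ψ(t, η(t)), η(t))` as `t → ±∞`. -/
def IsScatteringData {d : ℕ} (a : Euc d → Matrix (Fin d) (Fin d) ℝ) (ε : ℝ)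
    (z w : Euc d × Euc d) : Prop :=
  Tendsto (fun τ : ℝ => (hamiltonFlow (kineticEnergy a) (ε * τ) z).1 -
      ∇ (dollardModifier (kineticEnergy a) (ε * τ))
        (hamiltonFlow (kineticEnergy a) (ε * τ) z).2) atTop (𝓝 w.1) ∧
  Tendsto (fun τ : ℝ => (hamiltonFlow (kineticEnergy a) (ε * τ) z).2) atTop (𝓝 w.2)

open Classical in
/-- The classical wave map `W^{cl}_± : (x_±, ξ_±) ↦ (x₀, ξ₀)`, the inverse of the map that sends
`(x₀, ξ₀)`, `ξ₀ ≠ 0`, to its scattering data (and the identity where there is no preimage). -/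
def waveMap {d : ℕ} (a : Euc d → Matrix (Fin d) (Fin d) ℝ) (ε : ℝ) (w : Euc d × Euc d) :
    Euc d × Euc d :=
  if h : ∃ z ∈ phaseSpace d, IsScatteringData a ε z w then h.choose else w

/-- `F λ → f` as `λ → ∞`, locally uniformly on the open set `U` together with all derivatives
(order `0` is the convergence of the functions themselves). -/
def TendstoSmoothlyOn {d : ℕ} (F : ℝ → Euc d × Euc d → Euc d) (f : Euc d × Euc d → Euc d)
    (U : Set (Euc d × Euc d)) : Prop :=
  (∀ᶠ lam in atTop, ContDiffOn ℝ ∞ (F lam) U) ∧ ContDiffOn ℝ ∞ f U ∧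
  ∀ n : ℕ, TendstoLocallyUniformlyOn (fun lam : ℝ => iteratedFDeriv ℝ n (F lam))
    (iteratedFDeriv ℝ n f) atTop U

end

/-! Put h = 1/λ and s = λt. Then (x, ξ/λ), as a function of s, moves under the Hamiltonian k + h²V,
and ∂_ξΦ becomes the modifier built from k + h²V^(L). High energy at fixed t is therefore long time
s → ∞ for a vanishing potential, with h(1 + s) = 1/λ + t bounded by some T. The potential may grow
almost quadratically, but h² ≤ T²(1 + s)⁻² turns its force into one of the same order as the metric
perturbation.

In the coordinates q = x - ∂_ξΦ_h(s, ξ), ξ, the leading terms of the velocity cancel. What remains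
are differences of forces between x and sξ, the short range force, and products of two decaying
factors. Since x - sξ = O((1 + s)^{1-μ}), every derivative of the resulting field is O((1 +
s)^{-2μ}), uniformly for h(1 + s) ≤ T (`derivBound_modifiedField`). This is integrable because μ >
1/2.

Time is compactified by 1 + s = (1 - τ)^{-N} with N(2μ - 1) > 1. The new field is continuous in (h,
τ) on the closed unit square together with all its derivatives in (q, ξ), and vanishes at τ = 1
(`isSmoothFamily_compactField`); outside h(1 + s) ≤ T the parameter h is truncated. At h = 0
nontrapping and the monotonicity of y·η give linear escape of the kinetic trajectory, so that it
extends to a solution on all of [0, 1] whose value at τ = 1 is the scattering datum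
(`exists_scattering_limit`, `exists_compact_solution`).

The rest is smooth dependence on initial values with a parameter. It is proved once and for all by
solving the integral equation in the Banach space of continuous functions of (h, τ): superposition
operators are smooth there and the fixed point of a smooth contraction is smooth
(`exists_contDiff_local_solution`). Near a given initial point the flow in modified coordinates is
then a smooth map into C([0,1]²). The points (1/λ, τ(λt)) converge to (0, 1), and evaluating there
gives locally uniform convergence of all derivatives. The limit is attained at h = 0, hence does not
involve V.

The limit map is injective because the compactified equation can be solved backwards uniquely from τ
= 1. Negative times are reduced to positive ones by the reversal ξ ↦ -ξ. -/

noncomputable section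

set_option linter.unusedSectionVars false

/-! ### Smoothness of superposition operators on C(P, E). -/

section Nemytskii

variable {P : Type} [TopologicalSpace P]
variable {E : Type} [NormedAddCommGroup E] [NormedSpace ℝ E]
variable {G : Type} [NormedAddCommGroup G] [NormedSpace ℝ G]

/-- A family of smooth maps, indexed by a topological space, all of whose derivatives depend
continuously on the parameter and the point jointly. -/
structure IsSmoothFamily {P : Type} [TopologicalSpace P]
    {E : Type} [NormedAddCommGroup E] [NormedSpace ℝ E]
    {G : Type} [NormedAddCommGroup G] [NormedSpace ℝ G] (F : P → E → G) : Prop where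
  smooth : ∀ p, ContDiff ℝ ∞ (F p)
  continuous_iteratedFDeriv : ∀ k : ℕ, Continuous fun q : P × E => iteratedFDeriv ℝ k (F q.1) q.2

theorem IsSmoothFamily.continuous {F : P → E → G} (hF : IsSmoothFamily F) :
    Continuous fun q : P × E => F q.1 q.2 := by
  have h := (continuousMultilinearCurryFin0 ℝ E G).continuous.comp (hF.continuous_iteratedFDeriv 0)
  refine h.congr fun q => ?_
  simp [iteratedFDeriv_zero_eq_comp]

theorem IsSmoothFamily.fderiv {F : P → E → G} (hF : IsSmoothFamily F) :
    IsSmoothFamily fun p => fderiv ℝ (F p) where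
  smooth p := (hF.smooth p).fderiv_right (by simp)
  continuous_iteratedFDeriv k := by
    have h := (continuousMultilinearCurryRightEquiv' ℝ k E G).continuous.comp
      (hF.continuous_iteratedFDeriv (k + 1))
    refine h.congr fun q => ?_
    simp [iteratedFDeriv_succ_eq_comp_right]

/-- The superposition operator `u ↦ F(·, u(·))`. -/
def superposition (F : P → E → G) (hF : Continuous fun q : P × E => F q.1 q.2) (u : C(P, E)) :
    C(P, G) :=
  ⟨fun p => F p (u p), hF.comp (continuous_id.prodMk u.continuous)⟩

/-- The operator is postcomposition with the joint map (p, x) ↦ F p x after u ↦ (id, u). Both are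
continuous in the compact-open topology, which is the norm topology since P is compact. -/
theorem continuous_superposition [CompactSpace P] (F : P → E → G) (hF : Continuous fun q : P × E => F q.1 q.2) :
    Continuous (superposition F hF) := by
  have h : superposition F hF = fun u : C(P, E) =>
      (⟨_, hF⟩ : C(P × E, G)).comp ((ContinuousMap.id P).prodMk u) := rfl
  rw [h]
  exact (ContinuousMap.continuous_postcomp _).comp
    (ContinuousMap.continuous_of_continuous_uncurry _
      (continuous_snd.prodMk (continuous_fst.eval continuous_snd)))

variable [CompactSpace P]

/-- Pointwise application of a continuous family of linear maps. -/
def pointwiseApply (P E G : Type) [TopologicalSpace P] [CompactSpace P]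
    [NormedAddCommGroup E] [NormedSpace ℝ E] [NormedAddCommGroup G] [NormedSpace ℝ G] :
    C(P, E →L[ℝ] G) →L[ℝ] C(P, E) →L[ℝ] C(P, G) :=
  LinearMap.mkContinuous₂
    (LinearMap.mk₂ ℝ (fun (A : C(P, E →L[ℝ] G)) (v : C(P, E)) =>
      (⟨fun p => A p (v p), A.continuous.clm_apply v.continuous⟩ : C(P, G)))
      (fun _ _ _ => by ext; simp) (fun _ _ _ => by ext; simp)
      (fun _ _ _ => by ext; simp) (fun _ _ _ => by ext; simp)) 1
    (fun A v => by
      rw [one_mul, ContinuousMap.norm_le _ (by positivity)]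
      intro p
      refine ((A p).le_opNorm _).trans ?_
      gcongr
      exacts [A.norm_coe_le_norm p, v.norm_coe_le_norm p])

@[simp] theorem pointwiseApply_apply (A : C(P, E →L[ℝ] G)) (v : C(P, E)) (p : P) :
    pointwiseApply P E G A v p = A p (v p) := rfl

/-- The derivative acts pointwise. Uniformity in p of the remainder comes from norm continuity of
the superposition operator of `fderiv` together with the mean value inequality at each p. -/
theorem hasFDerivAt_superposition {F : P → E → G} (hF : IsSmoothFamily F) (u : C(P, E)) :
    HasFDerivAt (superposition F hF.continuous)
      (pointwiseApply P E G
        (superposition (fun p => fderiv ℝ (F p)) hF.fderiv.continuous u)) u := by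
  rw [hasFDerivAt_iff_isLittleO_nhds_zero, Asymptotics.isLittleO_iff]
  intro ε hε
  have hc : ContinuousAt (fun v : C(P, E) => superposition (fun p => fderiv ℝ (F p)) hF.fderiv.continuous (u + v)) 0 :=
    ((continuous_superposition (fun p => fderiv ℝ (F p)) hF.fderiv.continuous).comp
      (continuous_const.add continuous_id)).continuousAt
  obtain ⟨δ, hδ, hd⟩ := Metric.continuousAt_iff.1 hc ε hε
  filter_upwards [Metric.ball_mem_nhds (0 : C(P, E)) hδ] with v hv
  rw [ContinuousMap.norm_le _ (by positivity)]
  intro p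
  have hv' : ‖v‖ < δ := by simpa using hv
  -- Continuity is tested on the constant function c - u p, so that one δ serves all p.
  have hseg : ∀ c ∈ Metric.ball (u p) δ,
      ‖fderiv ℝ (F p) c - fderiv ℝ (F p) (u p)‖ ≤ ε := by
    intro c hcb
    have hk : dist (ContinuousMap.const P (c - u p)) (0 : C(P, E)) < δ := by
      rw [dist_zero_right]
      refine lt_of_le_of_lt ((ContinuousMap.norm_le _ (norm_nonneg (c - u p))).2 fun x => ?_)
        (by simpa [dist_eq_norm] using hcb)
      simp
    have h1 := (ContinuousMap.dist_lt_iff hε).1 (hd hk) p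
    simpa [superposition, dist_eq_norm] using h1.le
  have hvp : ‖v p‖ ≤ ‖v‖ := v.norm_coe_le_norm p
  have := (convex_ball (u p) δ).norm_image_sub_le_of_norm_fderiv_le' (𝕜 := ℝ) (f := F p)
    (φ := fderiv ℝ (F p) (u p)) (C := ε) (x := u p) (y := u p + v p)
    (fun x _ => ((hF.smooth p).differentiable (by simp)) x) hseg
    (Metric.mem_ball_self hδ) (by simp [dist_eq_norm]; linarith)
  simp only [add_sub_cancel_left] at this
  refine (le_of_eq ?_).trans (this.trans (mul_le_mul_of_nonneg_left hvp hε.le))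
  simp [superposition]

/-- The derivative is a fixed bounded linear map applied to the superposition operator of the family
of derivatives. The target space changes at each step of the induction, so it is quantified inside.
-/
theorem contDiff_nat_superposition (n : ℕ) : ∀ {G : Type} [NormedAddCommGroup G] [NormedSpace ℝ G]
    {F : P → E → G} (hF : IsSmoothFamily F),
    ContDiff ℝ n (superposition F hF.continuous) := by
  induction n with
  | zero =>
    intro G _ _ F hF
    exact contDiff_zero.2 (continuous_superposition F hF.continuous)
  | succ n ih =>
    intro G _ _ F hF
    push_cast
    refine (contDiff_succ_iff_hasFDerivAt (n := n)).2 ?_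
    refine ⟨_, ?_, hasFDerivAt_superposition hF⟩
    exact (pointwiseApply P E G).contDiff.comp (ih hF.fderiv)

theorem contDiff_superposition {F : P → E → G} (hF : IsSmoothFamily F) :
    ContDiff ℝ ∞ (superposition F hF.continuous) :=
  contDiff_infty.2 fun n => contDiff_nat_superposition n hF

end Nemytskii

/-! ### Derivatives of maps into C(P, G), evaluated at a point of P. -/

section Evaluation

variable {P : Type} [TopologicalSpace P] [CompactSpace P]
variable {E : Type} [NormedAddCommGroup E] [NormedSpace ℝ E] [FiniteDimensional ℝ E]
variable {G : Type} [NormedAddCommGroup G] [NormedSpace ℝ G]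

/-- A linear map into `C(P, G)` from a finite dimensional space, seen as a continuous family of
linear maps. -/
def clmFamily (P E G : Type) [TopologicalSpace P] [CompactSpace P]
    [NormedAddCommGroup E] [NormedSpace ℝ E] [FiniteDimensional ℝ E]
    [NormedAddCommGroup G] [NormedSpace ℝ G] :
    (E →L[ℝ] C(P, G)) →L[ℝ] C(P, E →L[ℝ] G) :=
  LinearMap.mkContinuous
    { toFun := fun A : E →L[ℝ] C(P, G) =>
        (⟨fun p => (ContinuousMap.evalCLM (M := G) (α := P) ℝ p).comp A,
          -- Strong continuity in p is operator norm continuity because E is finite dimensional.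
          continuous_clm_apply.2 fun v => (A v).continuous⟩ : C(P, E →L[ℝ] G))
      map_add' := fun A B => by ext; simp
      map_smul' := fun c A => by ext; simp } 1
    (fun A => by
      rw [one_mul, ContinuousMap.norm_le _ (by positivity)]
      intro p
      refine ContinuousLinearMap.opNorm_le_bound _ (norm_nonneg _) fun v => ?_
      exact ((A v).norm_coe_le_norm p).trans (A.le_opNorm v))

@[simp] theorem clmFamily_apply (A : E →L[ℝ] C(P, G)) (p : P) (v : E) :
    clmFamily P E G A p v = A v p := rfl

/-- Evaluation C(P, G) × P → G is jointly continuous, and differentiating in z turns U into the map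
z ↦ `clmFamily` of its derivative, which is of the same type. Induction on the order then applies.
-/
theorem continuous_iteratedFDeriv_eval (n : ℕ) : ∀ {G : Type} [NormedAddCommGroup G]
    [NormedSpace ℝ G] {U : E → C(P, G)}, ContDiff ℝ ∞ U →
    Continuous fun q : P × E => iteratedFDeriv ℝ n (fun z => U z q.1) q.2 := by
  induction n with
  | zero =>
    intro G _ _ U hU
    have : Continuous fun q : P × E => U q.2 q.1 :=
      (hU.continuous.comp continuous_snd).eval continuous_fst
    have h := (continuousMultilinearCurryFin0 ℝ E G).symm.continuous.comp this
    refine h.congr fun q => ?_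
    rw [iteratedFDeriv_zero_eq_comp]
    rfl
  | succ n ih =>
    intro G _ _ U hU
    have hfd : ∀ p : P, (fderiv ℝ fun z => U z p) = fun z => clmFamily P E G (fderiv ℝ U z) p := by
      intro p
      ext z : 1
      have h := (ContinuousMap.evalCLM (M := G) (α := P) ℝ p).hasFDerivAt (x := U z) |>.comp z
        ((hU.differentiable (by simp)) z).hasFDerivAt
      exact h.fderiv
    have hc : ContDiff ℝ ∞ fun A : E →L[ℝ] C(P, G) => clmFamily P E G A :=
      ContinuousLinearMap.contDiff _
    have h1 := ih (U := fun z => clmFamily P E G (fderiv ℝ U z))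
      (hc.comp (hU.fderiv_right (m := ∞) (by simp)))
    have h2 := (continuousMultilinearCurryRightEquiv' ℝ n E G).symm.continuous.comp h1
    refine h2.congr fun q => ?_
    rw [iteratedFDeriv_succ_eq_comp_right, Function.comp_apply, Function.comp_apply, hfd q.1]

end Evaluation

/-! ### Smooth dependence of fixed points. -/

section Contraction

variable {X : Type} [NormedAddCommGroup X] [NormedSpace ℝ X] [CompleteSpace X]

/-- The fixed point of the contraction `v ↦ b + T v` depends smoothly on `b` if `T` is smooth. -/
theorem exists_contDiff_fixedPoint {T : X → X} (hT : ContDiff ℝ ∞ T) {c : NNReal} (hc : c < 1)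
    (hL : LipschitzWith c T) :
    ∃ S : X → X, ContDiff ℝ ∞ S ∧ ∀ b, S b = b + T (S b) := by
  -- The map v ↦ v - T v differs from the identity by a map with Lipschitz constant below 1, hence
  -- is a global homeomorphism. Its inverse is the required S.
  have happ : ApproximatesLinearOn (fun v => v - T v)
      ((ContinuousLinearEquiv.refl ℝ X : X ≃L[ℝ] X) : X →L[ℝ] X) univ c := by
    intro x _ y _
    have := hL.dist_le_mul y x
    rw [dist_eq_norm, dist_eq_norm] at this
    rw [norm_sub_rev x y]
    have h2 : (x - T x) - (y - T y) - (x - y) = T y - T x := by abel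
    exact (congrArg norm h2).trans_le this
  have hN : Subsingleton X ∨
      c < ‖((ContinuousLinearEquiv.refl ℝ X).symm : X →L[ℝ] X)‖₊⁻¹ := by
    rcases subsingleton_or_nontrivial X with h | h
    · exact Or.inl h
    · right
      have : ‖((ContinuousLinearEquiv.refl ℝ X).symm : X →L[ℝ] X)‖₊ = 1 := by
        have : ((ContinuousLinearEquiv.refl ℝ X).symm : X →L[ℝ] X) = ContinuousLinearMap.id ℝ X := rfl
        rw [this]
        exact NNReal.eq ContinuousLinearMap.norm_id
      rw [this]; simpa using hc
  set e := happ.toHomeomorph _ hN with he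
  have hex : ∀ v, e v = v - T v := fun v => rfl
  -- Since T' has norm below 1, the derivative 1 - T' is invertible by the Neumann series. This is
  -- what makes the inverse homeomorphism smooth.
  have hder : ∀ v, ∃ f' : X ≃L[ℝ] X, HasFDerivAt (e : X → X) (f' : X →L[ℝ] X) v := by
    intro v
    have h1 : HasFDerivAt T (fderiv ℝ T v) v :=
      ((hT.differentiable (by simp)) v).hasFDerivAt
    have h2 : ‖fderiv ℝ T v‖ < 1 := lt_of_le_of_lt (h1.le_of_lipschitz hL) (by exact_mod_cast hc)
    refine ⟨ContinuousLinearEquiv.ofUnit (Units.oneSub _ h2), ?_⟩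
    have h3 := (hasFDerivAt_id (𝕜 := ℝ) v).sub h1
    exact h3
  choose f' hf' using hder
  refine ⟨e.symm, e.contDiff_symm hf' ?_, fun b => ?_⟩
  · exact contDiff_id.sub hT
  · have h := e.apply_symm_apply b
    rw [hex] at h
    rw [sub_eq_iff_eq_add] at h
    exact h

end Contraction

/-! ### The integral equation of an ordinary differential equation as a contraction. -/

section Volterra

open unitInterval

variable {Λ : Type} [TopologicalSpace Λ] [CompactSpace Λ]
variable {E : Type} [NormedAddCommGroup E] [NormedSpace ℝ E]

/-- Extension of a function on `Λ × [0, 1]` to all times by its boundary values. -/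
def extendTime (f : C(Λ × I, E)) (h : Λ) (θ : ℝ) : E := f (h, projIcc 0 1 zero_le_one θ)

theorem continuous_extendTime (f : C(Λ × I, E)) :
    Continuous (Function.uncurry (extendTime f)) :=
  f.continuous.comp (continuous_fst.prodMk (continuous_projIcc.comp continuous_snd))

theorem continuous_extendTime_right (f : C(Λ × I, E)) (h : Λ) : Continuous (extendTime f h) :=
  (continuous_extendTime f).comp (continuous_const.prodMk continuous_id)

/-- The Volterra operator `f ↦ ∫₀^τ f`. -/
def volterra (f : C(Λ × I, E)) : C(Λ × I, E) :=
  ⟨fun p => ∫ θ in (0 : ℝ)..p.2, extendTime f p.1 θ,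
    (intervalIntegral.continuous_parametric_primitive_of_continuous (continuous_extendTime f)).comp
      (continuous_fst.prodMk (continuous_subtype_val.comp continuous_snd))⟩

theorem norm_volterra_apply_le (f : C(Λ × I, E)) (p : Λ × I) : ‖volterra f p‖ ≤ ‖f‖ := by
  have h := intervalIntegral.norm_integral_le_of_norm_le_const (a := 0) (b := (p.2 : ℝ))
    (f := extendTime f p.1) (C := ‖f‖) fun θ _ => f.norm_coe_le_norm _
  refine h.trans ?_
  rw [sub_zero, abs_of_nonneg p.2.2.1]
  exact mul_le_of_le_one_right (norm_nonneg _) p.2.2.2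

theorem volterra_add (f g : C(Λ × I, E)) : volterra (f + g) = volterra f + volterra g := by
  ext p
  exact intervalIntegral.integral_add ((continuous_extendTime_right f p.1).intervalIntegrable _ _)
      ((continuous_extendTime_right g p.1).intervalIntegrable _ _)

theorem volterra_smul (c : ℝ) (f : C(Λ × I, E)) : volterra (c • f) = c • volterra f := by
  ext p
  exact intervalIntegral.integral_smul c _

/-- The Volterra operator as a continuous linear map. -/
def volterraCLM (Λ E : Type) [TopologicalSpace Λ] [CompactSpace Λ]
    [NormedAddCommGroup E] [NormedSpace ℝ E] : C(Λ × I, E) →L[ℝ] C(Λ × I, E) :=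
  LinearMap.mkContinuous
    { toFun := fun f : C(Λ × I, E) => volterra f
      map_add' := volterra_add
      map_smul' := volterra_smul } 1
    (fun f => by
      rw [one_mul, ContinuousMap.norm_le _ (by positivity)]
      exact norm_volterra_apply_le f)

@[simp] theorem volterraCLM_apply (f : C(Λ × I, E)) : volterraCLM Λ E f = volterra f := rfl

/-- Constant functions. -/
def constFamily (P E : Type) [TopologicalSpace P] [CompactSpace P]
    [NormedAddCommGroup E] [NormedSpace ℝ E] : E →L[ℝ] C(P, E) :=
  LinearMap.mkContinuous
    { toFun := fun z : E => ContinuousMap.const P z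
      map_add' := fun _ _ => rfl
      map_smul' := fun _ _ => rfl } 1
    (fun f => by
      rw [one_mul, ContinuousMap.norm_le _ (by positivity)]
      exact fun _ => le_rfl)

@[simp] theorem constFamily_apply {P : Type} [TopologicalSpace P] [CompactSpace P] (z : E) (p : P) :
    constFamily P E z p = z := rfl

/-- Multiplication by the exponential weight `e^{M τ}`. -/
def expWeight (Λ E : Type) [TopologicalSpace Λ] [CompactSpace Λ]
    [NormedAddCommGroup E] [NormedSpace ℝ E] (M : ℝ) : C(Λ × I, E) →L[ℝ] C(Λ × I, E) :=
  pointwiseApply (Λ × I) E E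
    ⟨fun p => Real.exp (M * p.2) • ContinuousLinearMap.id ℝ E, by fun_prop⟩

@[simp] theorem expWeight_apply (M : ℝ) (f : C(Λ × I, E)) (p : Λ × I) :
    expWeight Λ E M f p = Real.exp (M * p.2) • f p := rfl

variable [CompleteSpace E]

/-- Smooth dependence on the initial value, uniformly in a parameter, for the solutions of a
globally Lipschitz ordinary differential equation. -/
theorem exists_contDiff_solution {F : Λ × I → E → E} (hF : IsSmoothFamily F)
    {L : NNReal} (hL : ∀ p, LipschitzWith L (F p)) :
    ∃ U : E → C(Λ × I, E), ContDiff ℝ ∞ U ∧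
      ∀ z, U z = constFamily (Λ × I) E z + volterra (superposition F hF.continuous (U z)) := by
  -- In the norm weighted by e^{-Mτ} the Volterra operator has Lipschitz constant at most L/M ≤ 1/2.
  -- The added 1 keeps M positive when L = 0.
  set M : ℝ := 2 * L + 1 with hM
  have hM0 : 0 < M := by positivity
  set T : C(Λ × I, E) → C(Λ × I, E) := fun v =>
    expWeight Λ E (-M) (volterra (superposition F hF.continuous (expWeight Λ E M v))) with hTdef
  have hT : ContDiff ℝ ∞ T := by
    have h1 : ContDiff ℝ ∞ fun v : C(Λ × I, E) => expWeight Λ E (-M) v :=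
      ContinuousLinearMap.contDiff _
    have h2 : ContDiff ℝ ∞ fun v : C(Λ × I, E) => volterraCLM Λ E v :=
      ContinuousLinearMap.contDiff _
    have h3 : ContDiff ℝ ∞ fun v : C(Λ × I, E) => expWeight Λ E M v :=
      ContinuousLinearMap.contDiff _
    exact h1.comp (h2.comp ((contDiff_superposition hF).comp h3))
  have hLip : LipschitzWith (1 / 2) T := by
    refine LipschitzWith.of_dist_le_mul fun v w => ?_
    rw [ContinuousMap.dist_le (by positivity)]
    intro p
    have hi : ∀ u : C(Λ × I, E), T u p = Real.exp (-M * p.2) • ∫ θ in (0 : ℝ)..p.2,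
        extendTime (superposition F hF.continuous (expWeight Λ E M u)) p.1 θ := fun u => rfl
    rw [hi, hi, dist_eq_norm, ← smul_sub, ← intervalIntegral.integral_sub
      ((continuous_extendTime_right _ p.1).intervalIntegrable _ _)
      ((continuous_extendTime_right _ p.1).intervalIntegrable _ _), norm_smul,
      Real.norm_of_nonneg (Real.exp_pos _).le]
    have hb : ∀ θ ∈ Ioc (0 : ℝ) p.2,
        ‖extendTime (superposition F hF.continuous (expWeight Λ E M v)) p.1 θ -
          extendTime (superposition F hF.continuous (expWeight Λ E M w)) p.1 θ‖ ≤
          L * dist v w * Real.exp (M * θ) := by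
      intro θ hθ
      have hθ1 : θ ∈ Icc (0 : ℝ) 1 := ⟨hθ.1.le, hθ.2.trans p.2.2.2⟩
      have h := (hL (p.1, projIcc 0 1 zero_le_one θ)).dist_le_mul
        (expWeight Λ E M v (p.1, projIcc 0 1 zero_le_one θ))
        (expWeight Λ E M w (p.1, projIcc 0 1 zero_le_one θ))
      rw [dist_eq_norm] at h
      refine h.trans ?_
      rw [mul_assoc]
      refine mul_le_mul_of_nonneg_left ?_ L.2
      rw [expWeight_apply, expWeight_apply, dist_eq_norm, ← smul_sub, norm_smul,
        Real.norm_of_nonneg (Real.exp_pos _).le, mul_comm, projIcc_of_mem _ hθ1, ← dist_eq_norm]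
      exact mul_le_mul_of_nonneg_right (ContinuousMap.dist_apply_le_dist _) (Real.exp_pos _).le
    have h2 := intervalIntegral.norm_integral_le_of_norm_le p.2.2.1
      (Filter.Eventually.of_forall hb)
      (Continuous.intervalIntegrable (μ := MeasureTheory.volume)
        (by fun_prop : Continuous fun θ : ℝ => L * dist v w * Real.exp (M * θ)) 0 p.2)
    have h3 : ∫ θ in (0 : ℝ)..p.2, L * dist v w * Real.exp (M * θ) =
        L * dist v w * ((Real.exp (M * p.2) - 1) / M) := by
      rw [intervalIntegral.integral_const_mul, intervalIntegral.integral_comp_mul_left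
        (fun x => Real.exp x) hM0.ne', integral_exp]
      simp [div_eq_inv_mul]
    rw [h3] at h2
    refine (mul_le_mul_of_nonneg_left h2 (Real.exp_pos _).le).trans ?_
    have h4 : Real.exp (-M * p.2) * (L * dist v w * ((Real.exp (M * p.2) - 1) / M)) =
        (L / M) * dist v w * (1 - Real.exp (-M * p.2)) := by
      have : Real.exp (-M * p.2) * Real.exp (M * p.2) = 1 := by rw [← Real.exp_add]; simp
      calc _ = (L / M) * dist v w *
            (Real.exp (-M * p.2) * Real.exp (M * p.2) - Real.exp (-M * p.2)) := by ring
        _ = _ := by rw [this]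
    rw [h4]
    have h5 : (L : ℝ) / M ≤ 1 / 2 := by
      rw [div_le_div_iff₀ hM0 (by norm_num), hM]; linarith
    have h6 : 1 - Real.exp (-M * p.2) ≤ 1 := by linarith [Real.exp_pos (-M * p.2)]
    calc (L : ℝ) / M * dist v w * (1 - Real.exp (-M * p.2)) ≤ L / M * dist v w * 1 :=
          mul_le_mul_of_nonneg_left h6 (by positivity)
      _ ≤ ((1 / 2 : NNReal) : ℝ) * dist v w := by
          rw [mul_one]; push_cast; gcongr
  obtain ⟨S, hS, hfix⟩ := exists_contDiff_fixedPoint hT (c := 1 / 2) (by norm_num) hLip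
  have hinv : ∀ (a b : ℝ) (f : C(Λ × I, E)), a + b = 0 → expWeight Λ E a (expWeight Λ E b f) = f := by
    intro a b f hab
    ext p
    rw [expWeight_apply, expWeight_apply, smul_smul, ← Real.exp_add, ← add_mul, hab]
    simp
  refine ⟨fun z => expWeight Λ E M (S (expWeight Λ E (-M) (constFamily (Λ × I) E z))), ?_, fun z => ?_⟩
  · have h1 : ContDiff ℝ ∞ fun v : C(Λ × I, E) => expWeight Λ E (-M) v :=
      ContinuousLinearMap.contDiff _
    have h3 : ContDiff ℝ ∞ fun v : C(Λ × I, E) => expWeight Λ E M v :=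
      ContinuousLinearMap.contDiff _
    have h4 : ContDiff ℝ ∞ fun z : E => constFamily (Λ × I) E z := ContinuousLinearMap.contDiff _
    exact h3.comp (hS.comp (h1.comp h4))
  · have h := congrArg (expWeight Λ E M) (hfix (expWeight Λ E (-M) (constFamily (Λ × I) E z)))
    rw [map_add, hinv _ _ _ (by ring)] at h
    refine h.trans ?_
    congr 1
    exact hinv _ _ _ (by ring)

end Volterra

/-! ### Smooth dependence near a given solution in an open set. -/

section LocalSolution

open unitInterval

variable {Λ : Type} [TopologicalSpace Λ] [CompactSpace Λ]
variable {E : Type} [NormedAddCommGroup E] [NormedSpace ℝ E] [FiniteDimensional ℝ E]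

theorem exists_contDiff_cutoff {K Ω : Set E} (hK : IsCompact K) (hΩ : IsOpen Ω) (hKΩ : K ⊆ Ω) :
    ∃ χ : E → ℝ, ContDiff ℝ ∞ χ ∧ HasCompactSupport χ ∧ tsupport χ ⊆ Ω ∧
      (∀ᶠ x in 𝓝ˢ K, χ x = 1) ∧ ∀ x, χ x ∈ Icc (0 : ℝ) 1 := by
  obtain ⟨t, ht, hKt, htΩ⟩ := exists_compact_between hK hΩ hKΩ
  obtain ⟨f, h1, h0, hf⟩ := exists_contMDiffMap_one_nhds_of_subset_interior (n := (⊤ : ℕ∞))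
    (modelWithCornersSelf ℝ E) hK.isClosed hKt
  have hsub : tsupport f ⊆ t :=
    closure_minimal (fun x hx => by by_contra hxt; exact hx (h0 x hxt)) ht.isClosed
  exact ⟨f, f.contMDiff.contDiff, ht.of_isClosed_subset (isClosed_tsupport _) hsub,
    hsub.trans htΩ, h1, hf⟩

/-- A smooth family with compact parameter space and uniformly compact support is uniformly
Lipschitz. -/
theorem IsSmoothFamily.exists_lipschitzWith {P : Type} [TopologicalSpace P] [CompactSpace P]
    {F : P → E → E} (hF : IsSmoothFamily F) {K : Set E} (hK : IsCompact K)
    (hs : ∀ p, ∀ x ∉ K, F p x = 0) : ∃ L : NNReal, ∀ p, LipschitzWith L (F p) := by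
  have hc := hF.fderiv.continuous
  obtain ⟨C, hC⟩ := ((isCompact_univ (X := P)).prod hK).exists_bound_of_continuousOn hc.continuousOn
  refine ⟨C.toNNReal, fun p => lipschitzWith_of_nnnorm_fderiv_le
    ((hF.smooth p).differentiable (by simp)) fun x => ?_⟩
  by_cases hx : x ∈ K
  · have := hC (p, x) ⟨mem_univ _, hx⟩
    rw [← NNReal.coe_le_coe]
    exact this.trans (Real.le_coe_toNNReal C)
  · have h0 : F p =ᶠ[𝓝 x] fun _ => 0 := by
      filter_upwards [hK.isClosed.isOpen_compl.mem_nhds hx] with y hy using hs p y hy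
    rw [h0.fderiv_eq]
    simp

/-- The fundamental theorem of calculus turns the integral equation into the differential equation.
The derivative is taken within [0, 1] because the extension in time is constant outside. -/
theorem hasDerivWithinAt_extendTime {F : Λ × I → E → E} (hF : Continuous fun q : (Λ × I) × E => F q.1 q.2)
    {u : C(Λ × I, E)} {z : E} (hu : u = constFamily (Λ × I) E z + volterra (superposition F hF u))
    (h : Λ) : extendTime u h 0 = z ∧ ∀ τ ∈ Icc (0 : ℝ) 1,
      HasDerivWithinAt (extendTime u h) (F (h, projIcc 0 1 zero_le_one τ) (extendTime u h τ))
        (Icc 0 1) τ := by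
  have hcont := continuous_extendTime_right (superposition F hF u) h
  have heq : ∀ τ ∈ Icc (0 : ℝ) 1,
      extendTime u h τ = z + ∫ θ in (0 : ℝ)..τ, extendTime (superposition F hF u) h θ := by
    intro τ hτ
    have h1 := DFunLike.congr_fun hu (h, projIcc 0 1 zero_le_one τ)
    refine h1.trans ?_
    change z + ∫ θ in (0 : ℝ)..(projIcc (0 : ℝ) 1 zero_le_one τ : ℝ), _ = _
    rw [projIcc_of_mem _ hτ]
  refine ⟨by rw [heq 0 (by simp)]; simp, fun τ hτ => ?_⟩
  have hd : HasDerivAt (fun τ => z + ∫ θ in (0 : ℝ)..τ, extendTime (superposition F hF u) h θ)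
      (extendTime (superposition F hF u) h τ) τ :=
    (intervalIntegral.integral_hasDerivAt_right (hcont.intervalIntegrable _ _)
      (hcont.stronglyMeasurableAtFilter _ _) hcont.continuousAt).const_add z
  exact (hd.hasDerivWithinAt).congr heq (heq τ hτ)

/-- Smooth dependence on initial values near a given solution that stays in an open set, with
continuous dependence of all derivatives on a parameter. -/
theorem exists_contDiff_local_solution {Ω : Set E} (hΩ : IsOpen Ω) {F : Λ × I → E → E}
    (hF : ∀ χ : E → ℝ, ContDiff ℝ ∞ χ → HasCompactSupport χ → tsupport χ ⊆ Ω →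
      IsSmoothFamily fun p w => χ w • F p w)
    (h₀ : Λ) (u₀ : ℝ → E) (hmem : ∀ τ ∈ Icc (0 : ℝ) 1, u₀ τ ∈ Ω)
    (hu₀ : ∀ τ ∈ Icc (0 : ℝ) 1,
      HasDerivWithinAt u₀ (F (h₀, projIcc 0 1 zero_le_one τ) (u₀ τ)) (Icc 0 1) τ) :
    ∃ U : E → C(Λ × I, E), ContDiff ℝ ∞ U ∧ ∀ᶠ q : Λ × E in 𝓝 (h₀, u₀ 0),
      extendTime (U q.2) q.1 0 = q.2 ∧ ∀ τ ∈ Icc (0 : ℝ) 1, extendTime (U q.2) q.1 τ ∈ Ω ∧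
        HasDerivWithinAt (extendTime (U q.2) q.1)
          (F (q.1, projIcc 0 1 zero_le_one τ) (extendTime (U q.2) q.1 τ)) (Icc 0 1) τ := by
  have hc₀ : ContinuousOn u₀ (Icc 0 1) := fun τ hτ => (hu₀ τ hτ).continuousWithinAt
  -- The cutoff equals 1 near the reference trajectory and makes the field globally Lipschitz.
  obtain ⟨χ, hχ, hχc, hχΩ, hχ1, -⟩ := exists_contDiff_cutoff (isCompact_Icc.image_of_continuousOn hc₀) hΩ
    (by rintro _ ⟨τ, hτ, rfl⟩; exact hmem τ hτ)
  have hFχ := hF χ hχ hχc hχΩ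
  obtain ⟨L, hL⟩ := hFχ.exists_lipschitzWith hχc (fun p x hx => by
    rw [image_eq_zero_of_notMem_tsupport hx, zero_smul])
  obtain ⟨U, hU, hsol⟩ := exists_contDiff_solution hFχ hL
  have hode := fun z h => hasDerivWithinAt_extendTime hFχ.continuous (hsol z) h
  -- Along u₀ the cutoff is 1, so u₀ solves the truncated equation and uniqueness identifies it with
  -- the constructed solution.
  have hstart : EqOn (extendTime (U (u₀ 0)) h₀) u₀ (Icc 0 1) := by
    refine ODE_solution_unique (v := fun τ w => χ w • F (h₀, projIcc 0 1 zero_le_one τ) w) (K := L)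
      (fun τ => hL _) (continuous_extendTime_right _ _).continuousOn ?_ hc₀ ?_ (hode _ _).1
    · intro τ hτ
      exact ((hode (u₀ 0) h₀).2 τ ⟨hτ.1, hτ.2.le⟩).mono_of_mem_nhdsWithin
        (Icc_mem_nhdsGE_of_mem hτ)
    · intro τ hτ
      have hτ' : τ ∈ Icc (0 : ℝ) 1 := ⟨hτ.1, hτ.2.le⟩
      have h1 : χ (u₀ τ) = 1 := hχ1.self_of_nhdsSet _ ⟨τ, hτ', rfl⟩
      simp only [h1, one_smul]
      exact (hu₀ τ hτ').mono_of_mem_nhdsWithin (Icc_mem_nhdsGE_of_mem hτ)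
  refine ⟨U, hU, ?_⟩
  have hjoint : Continuous fun q : (Λ × E) × I => U q.1.2 (q.1.1, q.2) :=
    (hU.continuous.comp (continuous_snd.comp continuous_fst)).eval
      ((continuous_fst.comp continuous_fst).prodMk continuous_snd)
  -- By compactness of the time interval, nearby solutions stay for all times where the cutoff is 1,
  -- and there they solve the original equation.
  have hev : ∀ᶠ q : Λ × E in 𝓝 (h₀, u₀ 0), ∀ τ ∈ (univ : Set I),
      χ (U q.2 (q.1, τ)) = 1 ∧ U q.2 (q.1, τ) ∈ Ω := by
    refine isCompact_univ.eventually_forall_of_forall_eventually fun τ _ => ?_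
    have hval : U (u₀ 0) (h₀, τ) = u₀ τ := by
      have := hstart τ.2
      rwa [extendTime, projIcc_of_mem _ τ.2] at this
    have h1 : ∀ᶠ x in 𝓝 (U (u₀ 0) (h₀, τ)), χ x = 1 ∧ x ∈ Ω := by
      rw [hval]
      exact (eventually_nhdsSet_iff_forall.1 hχ1 _ ⟨τ, τ.2, rfl⟩).and (hΩ.mem_nhds (hmem _ τ.2))
    exact (hjoint.tendsto ((h₀, u₀ 0), τ)).eventually h1
  filter_upwards [hev] with q hq
  refine ⟨(hode q.2 q.1).1, fun τ hτ => ?_⟩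
  have h1 := hq (projIcc 0 1 zero_le_one τ) (mem_univ _)
  refine ⟨h1.2, ?_⟩
  have h2 := (hode q.2 q.1).2 τ hτ
  have h3 : χ (extendTime (U q.2) q.1 τ) = 1 := h1.1
  rwa [h3, one_smul] at h2

end LocalSolution

/-! ### From joint continuity of derivatives to smooth convergence. -/

section Convergence

variable {P : Type} [TopologicalSpace P]

theorem IsSmoothFamily.of_contDiff [CompactSpace P] {Z : Type} [NormedAddCommGroup Z]
    [NormedSpace ℝ Z] [FiniteDimensional ℝ Z] {G : Type} [NormedAddCommGroup G] [NormedSpace ℝ G]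
    {U : Z → C(P, G)} (hU : ContDiff ℝ ∞ U) : IsSmoothFamily fun p z => U z p where
  smooth p := by
    have h : ContDiff ℝ ∞ fun f : C(P, G) => ContinuousMap.evalCLM (M := G) (α := P) ℝ p f :=
      ContinuousLinearMap.contDiff _
    exact h.comp hU
  continuous_iteratedFDeriv n := continuous_iteratedFDeriv_eval n hU

/-- If F λ is locally g (k λ) with k λ → k₀, joint continuity of the derivatives of g in parameter
and point gives convergence at k₀, uniformly near each point. -/
theorem tendstoSmoothlyOn_of_isSmoothFamily {d : ℕ} {F : ℝ → Euc d × Euc d → Euc d}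
    {f : Euc d × Euc d → Euc d} {U : Set (Euc d × Euc d)} {k : ℝ → P} {k₀ : P}
    (hF : ∀ᶠ lam in atTop, ContDiffOn ℝ ∞ (F lam) U)
    (hk : Tendsto k atTop (𝓝 k₀))
    (hloc : ∀ z₀ ∈ U, ∃ g : P → Euc d × Euc d → Euc d, IsSmoothFamily g ∧
      (∀ᶠ z in 𝓝 z₀, f z = g k₀ z) ∧
      ∀ᶠ q : ℝ × (Euc d × Euc d) in atTop ×ˢ 𝓝 z₀, F q.1 q.2 = g (k q.1) q.2) :
    TendstoSmoothlyOn F f U := by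
  refine ⟨hF, fun z hz => ?_, fun n => ?_⟩
  · obtain ⟨g, hg, hf, -⟩ := hloc z hz
    exact ((hg.smooth k₀).contDiffAt.congr_of_eventuallyEq hf).contDiffWithinAt
  · rw [Metric.tendstoLocallyUniformlyOn_iff]
    intro ε hε z₀ hz₀
    obtain ⟨g, hg, hf, hFg⟩ := hloc z₀ hz₀
    have hcont := hg.continuous_iteratedFDeriv n
    have h1 : ∀ᶠ q : P × (Euc d × Euc d) in 𝓝 k₀ ×ˢ 𝓝 z₀,
        dist (iteratedFDeriv ℝ n (g q.1) q.2) (iteratedFDeriv ℝ n (g k₀) z₀) < ε / 2 := by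
      rw [← nhds_prod_eq]
      exact hcont.continuousAt (Metric.ball_mem_nhds _ (half_pos hε))
    obtain ⟨pa, hpa, pb, hpb, hab⟩ := eventually_prod_iff.1 h1
    obtain ⟨qa, hqa, qb, hqb, hqab⟩ := eventually_prod_iff.1 hFg
    -- Open neighbourhoods are needed: equality of the functions near each point y, and not only at
    -- y, gives equality of the derivatives.
    obtain ⟨N₁, hN₁, hN₁o, hz₁⟩ := eventually_nhds_iff.1 hf
    obtain ⟨N₂, hN₂, hN₂o, hz₂⟩ := eventually_nhds_iff.1 hqb
    refine ⟨_, mem_nhdsWithin_of_mem_nhds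
      (inter_mem (inter_mem (hN₁o.mem_nhds hz₁) (hN₂o.mem_nhds hz₂)) hpb), ?_⟩
    filter_upwards [hqa, hk hpa] with lam h2 h3
    rintro y ⟨⟨hy1, hy2⟩, hy3⟩
    have e1 : f =ᶠ[𝓝 y] g k₀ := by
      filter_upwards [hN₁o.mem_nhds hy1] with x hx using hN₁ x hx
    have e2 : F lam =ᶠ[𝓝 y] g (k lam) := by
      filter_upwards [hN₂o.mem_nhds hy2] with x hx using hqab h2 (hN₂ x hx)
    rw [(e1.iteratedFDeriv ℝ n).eq_of_nhds, (e2.iteratedFDeriv ℝ n).eq_of_nhds]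
    have a1 := hab hpa.self_of_nhds hy3
    have a2 := hab h3 hy3
    calc _ ≤ _ := dist_triangle_right _ _ _
      _ < ε / 2 + ε / 2 := add_lt_add a1 a2
      _ = ε := by ring

end Convergence

/-! ### Integrals depending on parameters. -/

section ParametricIntegral

variable {A : Type} [NormedAddCommGroup A] [NormedSpace ℝ A] [FiniteDimensional ℝ A]

theorem contDiff_uncurry_fderiv {B : Type} [NormedAddCommGroup B] [NormedSpace ℝ B]
    {G : Type} [NormedAddCommGroup G] [NormedSpace ℝ G]
    {f : B → A → G} (hf : ContDiff ℝ ∞ (Function.uncurry f)) :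
    ContDiff ℝ ∞ (Function.uncurry fun θ x => fderiv ℝ (f θ) x) :=
  ContDiff.fderiv (n := ∞) (m := ∞) (f := fun q : B × A => f q.1)
    (hf.comp ((contDiff_fst.comp contDiff_fst).prodMk contDiff_snd)) contDiff_snd (by simp)

theorem hasFDerivAt_parametric_intervalIntegral {G : Type} [NormedAddCommGroup G] [NormedSpace ℝ G]
    [CompleteSpace G]
    {f : ℝ → A → G} (hf : ContDiff ℝ ∞ (Function.uncurry f)) (a b : ℝ) (x₀ : A) :
    HasFDerivAt (fun x => ∫ θ in a..b, f θ x) (∫ θ in a..b, fderiv ℝ (f θ) x₀) x₀ := by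
  have hfd : Continuous (Function.uncurry fun θ x => fderiv ℝ (f θ) x) :=
    (contDiff_uncurry_fderiv hf).continuous
  obtain ⟨C, hC⟩ := ((isCompact_uIcc (a := a) (b := b)).prod
    (isCompact_closedBall x₀ (1 : ℝ))).exists_bound_of_continuousOn hfd.continuousOn
  have hpt : ∀ x, Continuous fun θ => f θ x := fun x =>
    hf.continuous.comp (continuous_id.prodMk continuous_const)
  refine intervalIntegral.hasFDerivAt_integral_of_dominated_of_fderiv_le
    (s := Metric.closedBall x₀ 1) (bound := fun _ => C) (F := fun x θ => f θ x)
    (F' := fun x θ => fderiv ℝ (f θ) x) (Metric.closedBall_mem_nhds x₀ one_pos) ?_ ?_ ?_ ?_ ?_ ?_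
  · exact .of_forall fun x => (hpt x).aestronglyMeasurable
  · exact (hpt x₀).intervalIntegrable _ _
  · exact (hfd.comp (continuous_id.prodMk continuous_const)).aestronglyMeasurable
  · exact .of_forall fun θ hθ x hx => hC (θ, x) ⟨uIoc_subset_uIcc hθ, hx⟩
  · exact intervalIntegrable_const
  · refine .of_forall fun θ _ x _ => DifferentiableAt.hasFDerivAt ?_
    exact ((hf.comp (contDiff_const.prodMk contDiff_id)).differentiable (by simp)) x

theorem contDiff_parametric_intervalIntegral (a b : ℝ) (n : ℕ) : ∀ {G : Type}
    [NormedAddCommGroup G] [NormedSpace ℝ G] [CompleteSpace G]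
    {f : ℝ → A → G}, ContDiff ℝ ∞ (Function.uncurry f) →
    ContDiff ℝ n fun x => ∫ θ in a..b, f θ x := by
  induction n with
  | zero =>
    intro G _ _ _ f hf
    exact contDiff_zero.2 (intervalIntegral.continuous_parametric_intervalIntegral_of_continuous'
      (f := fun x θ => f θ x) (hf.continuous.comp continuous_swap) a b)
  | succ n ih =>
    intro G _ _ _ f hf
    push_cast
    exact contDiff_succ_iff_hasFDerivAt.2 ⟨_, ih (contDiff_uncurry_fderiv hf),
      hasFDerivAt_parametric_intervalIntegral hf a b⟩

/-- The primitive in time of a smooth function is smooth in time and in the parameters. -/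
theorem contDiff_parametric_primitive {G : Type} [NormedAddCommGroup G] [NormedSpace ℝ G]
    [CompleteSpace G] {f : ℝ → A → G} (hf : ContDiff ℝ ∞ (Function.uncurry f)) :
    ContDiff ℝ ∞ fun q : ℝ × A => ∫ θ in (0 : ℝ)..q.1, f θ q.2 := by
  -- Rescaling to the interval [0, 1] turns the variable endpoint into one more parameter of the
  -- integrand.
  have h : (fun q : ℝ × A => ∫ θ in (0 : ℝ)..q.1, f θ q.2) =
      fun q : ℝ × A => q.1 • ∫ θ in (0 : ℝ)..1, f (q.1 * θ) q.2 := by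
    funext q
    rw [intervalIntegral.smul_integral_comp_mul_left (fun θ => f θ q.2)]
    simp
  rw [h]
  refine contDiff_fst.smul (contDiff_infty.2 fun n => contDiff_parametric_intervalIntegral 0 1 n
    (f := fun θ (q : ℝ × A) => f (q.1 * θ) q.2) ?_)
  exact hf.comp (((contDiff_fst.comp contDiff_snd).mul contDiff_fst).prodMk
    (contDiff_snd.comp contDiff_snd))

theorem norm_iteratedFDeriv_intervalIntegral_le {a b : ℝ} (hab : a ≤ b) {B : ℝ → ℝ}
    (hB : Continuous B) (w : A) (n : ℕ) : ∀ {G : Type} [NormedAddCommGroup G] [NormedSpace ℝ G]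
    [CompleteSpace G] {f : ℝ → A → G}, ContDiff ℝ ∞ (Function.uncurry f) →
    (∀ θ ∈ Ioc a b, ‖iteratedFDeriv ℝ n (f θ) w‖ ≤ B θ) →
    ‖iteratedFDeriv ℝ n (fun x => ∫ θ in a..b, f θ x) w‖ ≤ ∫ θ in a..b, B θ := by
  induction n with
  | zero =>
    intro G _ _ _ f hf h
    simp only [norm_iteratedFDeriv_zero] at h ⊢
    exact intervalIntegral.norm_integral_le_of_norm_le hab (.of_forall h) (hB.intervalIntegrable _ _)
  | succ n ih =>
    intro G _ _ _ f hf h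
    have h1 : fderiv ℝ (fun x => ∫ θ in a..b, f θ x) = fun x => ∫ θ in a..b, fderiv ℝ (f θ) x :=
      funext fun x => (hasFDerivAt_parametric_intervalIntegral hf a b x).fderiv
    rw [← norm_iteratedFDeriv_fderiv, h1]
    refine ih (contDiff_uncurry_fderiv hf) fun θ hθ => ?_
    have := h θ hθ
    rwa [← norm_iteratedFDeriv_fderiv] at this

theorem continuous_uncurry_iteratedFDeriv {B : Type} [NormedAddCommGroup B] [NormedSpace ℝ B]
    (n : ℕ) : ∀ {G : Type} [NormedAddCommGroup G] [NormedSpace ℝ G]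
    {f : B → A → G}, ContDiff ℝ ∞ (Function.uncurry f) →
    Continuous fun q : B × A => iteratedFDeriv ℝ n (f q.1) q.2 := by
  induction n with
  | zero =>
    intro G _ _ f hf
    have h := (continuousMultilinearCurryFin0 ℝ A G).symm.continuous.comp hf.continuous
    refine h.congr fun q => ?_
    rw [iteratedFDeriv_zero_eq_comp]
    rfl
  | succ n ih =>
    intro G _ _ f hf
    have h2 := (continuousMultilinearCurryRightEquiv' ℝ n A G).symm.continuous.comp
      (ih (contDiff_uncurry_fderiv hf))
    refine h2.congr fun q => ?_
    rw [iteratedFDeriv_succ_eq_comp_right, Function.comp_apply, Function.comp_apply]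

end ParametricIntegral

/-! ### Elementary bounds for the Japanese bracket. -/

section JapaneseBracket

variable {d : ℕ}

theorem one_le_japaneseBracket (x : Euc d) : 1 ≤ japaneseBracket x :=
  Real.one_le_sqrt.2 (by nlinarith [norm_nonneg x])

theorem japaneseBracket_pos (x : Euc d) : 0 < japaneseBracket x :=
  zero_lt_one.trans_le (one_le_japaneseBracket x)

theorem norm_le_japaneseBracket (x : Euc d) : ‖x‖ ≤ japaneseBracket x :=
  Real.le_sqrt_of_sq_le (by linarith)

theorem japaneseBracket_le (x : Euc d) : japaneseBracket x ≤ 1 + ‖x‖ :=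
  Real.sqrt_le_iff.2 ⟨by positivity, by nlinarith [norm_nonneg x]⟩

end JapaneseBracket

/-! ### Symbol classes and their calculus. -/

section Symbols

variable {d : ℕ} {G' : Type} [NormedAddCommGroup G'] [NormedSpace ℝ G']
  {G : Type} [NormedAddCommGroup G] [NormedSpace ℝ G]

/-- Vector valued symbols of order `m` on `ℝ^d`. -/
structure IsSymbol (m : ℝ) (f : Euc d → G) : Prop where
  smooth : ContDiff ℝ ∞ f
  bound : ∀ n : ℕ, ∃ C : ℝ, 0 ≤ C ∧ ∀ x : Euc d,
    ‖iteratedFDeriv ℝ n f x‖ ≤ C * japaneseBracket x ^ (m - (n : ℝ))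

theorem HasSymbolBounds.isSymbol {m : ℝ} {f : Euc d → ℝ} (h : HasSymbolBounds m f) :
    IsSymbol m f :=
  ⟨h.smooth, fun n => let ⟨C, hC, hb⟩ := h.bound n; ⟨C, hC.le, hb⟩⟩

theorem IsSymbol.mono {m m' : ℝ} {f : Euc d → G} (h : IsSymbol m f) (hm : m ≤ m') :
    IsSymbol m' f :=
  ⟨h.smooth, fun n => by
    obtain ⟨C, hC, hb⟩ := h.bound n
    refine ⟨C, hC, fun x => (hb x).trans ?_⟩
    gcongr
    exact one_le_japaneseBracket x⟩

theorem IsSymbol.derivative {m : ℝ} {f : Euc d → G} (h : IsSymbol m f) :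
    IsSymbol (m - 1) (fderiv ℝ f) :=
  ⟨h.smooth.fderiv_right (by simp), fun n => by
    obtain ⟨C, hC, hb⟩ := h.bound (n + 1)
    refine ⟨C, hC, fun x => ?_⟩
    rw [norm_iteratedFDeriv_fderiv]
    refine (hb x).trans_eq ?_
    push_cast
    congr 2
    ring⟩

theorem IsSymbol.clm_comp {m : ℝ} {f : Euc d → G} (h : IsSymbol m f) (L : G →L[ℝ] G') :
    IsSymbol m fun x => L (f x) :=
  ⟨L.contDiff.comp h.smooth, fun n => by
    obtain ⟨C, hC, hb⟩ := h.bound n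
    refine ⟨‖L‖ * C, by positivity, fun x => ?_⟩
    refine (L.norm_iteratedFDeriv_comp_left h.smooth.contDiffAt (mod_cast le_top)).trans ?_
    rw [mul_assoc]
    gcongr
    exact hb x⟩

theorem IsSymbol.add {m : ℝ} {f g : Euc d → G} (hf : IsSymbol m f) (hg : IsSymbol m g) :
    IsSymbol m fun x => f x + g x :=
  ⟨hf.smooth.add hg.smooth, fun n => by
    obtain ⟨C, hC, hb⟩ := hf.bound n
    obtain ⟨C', hC', hb'⟩ := hg.bound n
    refine ⟨C + C', by positivity, fun x => ?_⟩
    have := iteratedFDeriv_add_apply (hf.smooth.contDiffAt (x := x) |>.of_le (m := n) (mod_cast le_top))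
      (hg.smooth.contDiffAt (x := x) |>.of_le (mod_cast le_top))
    change ‖iteratedFDeriv ℝ n (f + g) x‖ ≤ _
    rw [this, add_mul]
    exact (norm_add_le _ _).trans (add_le_add (hb x) (hb' x))⟩

theorem IsSymbol.zero (m : ℝ) : IsSymbol m fun _ : Euc d => (0 : G) :=
  ⟨contDiff_const, fun n => ⟨0, le_rfl, fun x => by
    have : iteratedFDeriv ℝ n (fun _ : Euc d => (0 : G)) x = 0 := by
      have := congrFun (iteratedFDeriv_fun_zero (𝕜 := ℝ) (E := Euc d) (F := G) (n := n)) x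
      exact this
    rw [this]; simp⟩⟩

theorem IsSymbol.sum {m : ℝ} {ι : Type} (s : Finset ι) {f : ι → Euc d → G}
    (h : ∀ i ∈ s, IsSymbol m (f i)) : IsSymbol m fun x => ∑ i ∈ s, f i x := by
  classical
  induction s using Finset.induction_on with
  | empty => simpa using IsSymbol.zero m
  | insert a s ha ih =>
    simp only [Finset.sum_insert ha]
    exact (h a (Finset.mem_insert_self a s)).add (ih fun i hi => h i (Finset.mem_insert_of_mem hi))

end Symbols

/-! ### Derivative bounds uniform in an index. -/

section UniformBounds

variable {ι : Type} {W : Type} [NormedAddCommGroup W] [NormedSpace ℝ W]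
  {G'' : Type} [NormedAddCommGroup G''] [NormedSpace ℝ G'']
  {G' : Type} [NormedAddCommGroup G'] [NormedSpace ℝ G']
  {G : Type} [NormedAddCommGroup G] [NormedSpace ℝ G]

/-- The derivatives up to order `N` of the smooth maps `f i` are bounded on `U i` by constants
times the weight `g i`. -/
structure DerivBound (N : ℕ∞) (g : ι → ℝ) (U : ι → Set W) (f : ι → W → G) : Prop where
  smooth : ∀ i, ContDiff ℝ ∞ (f i)
  bound : ∀ n : ℕ, n ≤ N → ∃ C : ℝ, 0 ≤ C ∧ ∀ i, ∀ w ∈ U i, ‖iteratedFDeriv ℝ n (f i) w‖ ≤ C * g i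

variable {N : ℕ∞} {g g' : ι → ℝ} {U : ι → Set W}

theorem DerivBound.top_of_nat {f : ι → W → G} (h : ∀ n : ℕ, DerivBound n g U f) :
    DerivBound ⊤ g U f :=
  ⟨(h 0).smooth, fun n _ => (h n).bound n le_rfl⟩

theorem DerivBound.of_le {N' : ℕ∞} {f : ι → W → G} (h : DerivBound N g U f) (hN : N' ≤ N) :
    DerivBound N' g U f :=
  ⟨h.smooth, fun n hn => h.bound n (hn.trans hN)⟩

theorem DerivBound.mono {f : ι → W → G} (h : DerivBound N g U f) {c : ℝ} (hc : 0 ≤ c)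
    (hg : ∀ i, (U i).Nonempty → g i ≤ c * g' i) : DerivBound N g' U f :=
  ⟨h.smooth, fun n hn => by
    obtain ⟨C, hC, hb⟩ := h.bound n hn
    refine ⟨C * c, by positivity, fun i w hw => (hb i w hw).trans ?_⟩
    rw [mul_assoc]
    exact mul_le_mul_of_nonneg_left (hg i ⟨w, hw⟩) hC⟩

theorem DerivBound.reindex {κ : Type} {f : ι → W → G} (h : DerivBound N g U f) (e : κ → ι) :
    DerivBound N (fun k => g (e k)) (fun k => U (e k)) fun k => f (e k) :=
  ⟨fun k => h.smooth (e k), fun n hn => by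
    obtain ⟨C, hC, hb⟩ := h.bound n hn
    exact ⟨C, hC, fun k => hb (e k)⟩⟩

theorem DerivBound.subset {U' : ι → Set W} {f : ι → W → G} (h : DerivBound N g U f)
    (hU : ∀ i, U' i ⊆ U i) : DerivBound N g U' f :=
  ⟨h.smooth, fun n hn => by
    obtain ⟨C, hC, hb⟩ := h.bound n hn
    exact ⟨C, hC, fun i w hw => hb i w (hU i hw)⟩⟩

theorem DerivBound.congr {f f' : ι → W → G} (h : DerivBound N g U f) (hf : ∀ i w, f i w = f' i w) :
    DerivBound N g U f' := by
  have : f = f' := funext fun i => funext (hf i)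
  rwa [← this]

theorem DerivBound.add {f f' : ι → W → G} (hf : DerivBound N g U f) (hg : DerivBound N g U f') :
    DerivBound N g U fun i w => f i w + f' i w :=
  ⟨fun i => (hf.smooth i).add (hg.smooth i), fun n hn => by
    obtain ⟨C, hC, hb⟩ := hf.bound n hn
    obtain ⟨C', hC', hb'⟩ := hg.bound n hn
    refine ⟨C + C', by positivity, fun i x hx => ?_⟩
    have := iteratedFDeriv_add_apply
      ((hf.smooth i).contDiffAt (x := x) |>.of_le (m := n) (mod_cast le_top))
      ((hg.smooth i).contDiffAt (x := x) |>.of_le (mod_cast le_top))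
    change ‖iteratedFDeriv ℝ n (f i + f' i) x‖ ≤ _
    rw [this, add_mul]
    exact (norm_add_le _ _).trans (add_le_add (hb i x hx) (hb' i x hx))⟩

theorem DerivBound.clm_comp {f : ι → W → G} (h : DerivBound N g U f) (L : G →L[ℝ] G') :
    DerivBound N g U fun i w => L (f i w) :=
  ⟨fun i => L.contDiff.comp (h.smooth i), fun n hn => by
    obtain ⟨C, hC, hb⟩ := h.bound n hn
    refine ⟨‖L‖ * C, by positivity, fun i x hx => ?_⟩
    refine (L.norm_iteratedFDeriv_comp_left (h.smooth i).contDiffAt (mod_cast le_top)).trans ?_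
    rw [mul_assoc]
    gcongr
    exact hb i x hx⟩

theorem DerivBound.bilinear {f : ι → W → G} {f' : ι → W → G'} (hf : DerivBound N g U f)
    (hf' : DerivBound N g' U f') (hg : ∀ i, 0 ≤ g i) (B : G →L[ℝ] G' →L[ℝ] G'') :
    DerivBound N (fun i => g i * g' i) U fun i w => B (f i w) (f' i w) :=
  ⟨fun i => B.isBoundedBilinearMap.contDiff.comp ((hf.smooth i).prodMk (hf'.smooth i)),
   fun n hn => by
    have h1 : ∀ k : ℕ, ∃ C : ℝ, 0 ≤ C ∧ (k ≤ n → ∀ i, ∀ w ∈ U i,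
        ‖iteratedFDeriv ℝ k (f i) w‖ ≤ C * g i) := fun k => by
      by_cases hk : k ≤ n
      · obtain ⟨C, hC, hb⟩ := hf.bound k ((Nat.cast_le.2 hk).trans hn)
        exact ⟨C, hC, fun _ => hb⟩
      · exact ⟨0, le_rfl, fun h => absurd h hk⟩
    have h2 : ∀ k : ℕ, ∃ C : ℝ, 0 ≤ C ∧ (k ≤ n → ∀ i, ∀ w ∈ U i,
        ‖iteratedFDeriv ℝ k (f' i) w‖ ≤ C * g' i) := fun k => by
      by_cases hk : k ≤ n
      · obtain ⟨C, hC, hb⟩ := hf'.bound k ((Nat.cast_le.2 hk).trans hn)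
        exact ⟨C, hC, fun _ => hb⟩
      · exact ⟨0, le_rfl, fun h => absurd h hk⟩
    choose C hC hCb using h1
    choose C' hC' hCb' using h2
    refine ⟨‖B‖ * ∑ k ∈ Finset.range (n + 1), (n.choose k : ℝ) * C k * C' (n - k),
      mul_nonneg (norm_nonneg B) (Finset.sum_nonneg fun k _ =>
        mul_nonneg (mul_nonneg (Nat.cast_nonneg _) (hC k)) (hC' _)), fun i w hw => ?_⟩
    refine (B.norm_iteratedFDeriv_le_of_bilinear (hf.smooth i) (hf'.smooth i) w
      (mod_cast le_top)).trans ?_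
    rw [mul_assoc, Finset.sum_mul]
    refine mul_le_mul_of_nonneg_left (Finset.sum_le_sum fun k hk => ?_) (norm_nonneg B)
    have hk' : k ≤ n := Nat.lt_succ_iff.1 (Finset.mem_range.1 hk)
    calc (n.choose k : ℝ) * ‖iteratedFDeriv ℝ k (f i) w‖ * ‖iteratedFDeriv ℝ (n - k) (f' i) w‖
        ≤ (n.choose k : ℝ) * (C k * g i) * (C' (n - k) * g' i) := by
          refine mul_le_mul (mul_le_mul_of_nonneg_left (hCb k hk' i w hw) (Nat.cast_nonneg _))
            (hCb' _ (Nat.sub_le _ _) i w hw) (norm_nonneg _) ?_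
          exact mul_nonneg (Nat.cast_nonneg _) (mul_nonneg (hC k) (hg i))
      _ = _ := by ring⟩

theorem DerivBound.const_smul {f : ι → W → G} (h : DerivBound N g U f) (c : ι → ℝ) :
    DerivBound N (fun i => |c i| * g i) U fun i w => c i • f i w :=
  ⟨fun i => (h.smooth i).const_smul (c i), fun n hn => by
    obtain ⟨C, hC, hb⟩ := h.bound n hn
    refine ⟨C, hC, fun i x hx => ?_⟩
    have h1 := iteratedFDeriv_const_smul_apply (a := c i) (i := n) (x := x)
      ((h.smooth i).contDiffAt.of_le (mod_cast le_top))
    change ‖iteratedFDeriv ℝ n (c i • f i) x‖ ≤ _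
    rw [h1, norm_smul, Real.norm_eq_abs]
    calc _ ≤ |c i| * (C * g i) := mul_le_mul_of_nonneg_left (hb i x hx) (abs_nonneg _)
      _ = _ := by ring⟩

theorem DerivBound.derivative {f : ι → W → G} (h : DerivBound ⊤ g U f) :
    DerivBound ⊤ g U fun i => fderiv ℝ (f i) :=
  ⟨fun i => (h.smooth i).fderiv_right (by simp), fun n _ => by
    obtain ⟨C, hC, hb⟩ := h.bound (n + 1) le_top
    refine ⟨C, hC, fun i w hw => ?_⟩
    rw [norm_iteratedFDeriv_fderiv]
    exact hb i w hw⟩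

theorem DerivBound.succ {n : ℕ} {f : ι → W → G} (hf : ∀ i, ContDiff ℝ ∞ (f i))
    (h0 : ∃ C : ℝ, 0 ≤ C ∧ ∀ i, ∀ w ∈ U i, ‖f i w‖ ≤ C * g i)
    (h1 : DerivBound n g U fun i => fderiv ℝ (f i)) : DerivBound (n + 1 : ℕ) g U f :=
  ⟨hf, fun k hk => by
    rcases k with _ | k
    · simpa only [norm_iteratedFDeriv_zero] using h0
    · obtain ⟨C, hC, hb⟩ := h1.bound k (by
        have : k + 1 ≤ n + 1 := by exact_mod_cast hk
        exact Nat.cast_le.2 (by omega : k ≤ n))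
      refine ⟨C, hC, fun i w hw => ?_⟩
      rw [← norm_iteratedFDeriv_fderiv]
      exact hb i w hw⟩

/-- The first derivative is the constant L, which the weight controls because it is at least 1;
higher derivatives vanish. -/
theorem DerivBound.of_clm (L : W →L[ℝ] G) {C : ℝ} (hC : 0 ≤ C)
    (hL : ∀ i, ∀ w ∈ U i, ‖L w‖ ≤ C * g i) (hg : ∀ i, 1 ≤ g i) :
    DerivBound ⊤ g U fun _ w => L w := by
  refine .top_of_nat fun n => ?_
  rcases n with _ | n
  · refine ⟨fun _ => L.contDiff, fun k hk => ?_⟩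
    have hk0 : k = 0 := by
      have : k ≤ 0 := by exact_mod_cast hk
      omega
    subst hk0
    simp only [norm_iteratedFDeriv_zero]
    exact ⟨C, hC, hL⟩
  · refine .succ (fun _ => L.contDiff) ⟨C, hC, hL⟩ ⟨fun i => ?_, fun k _ => ?_⟩
    · have : (fderiv ℝ fun w => L w) = fun _ => L := funext fun w => L.fderiv
      rw [this]; exact contDiff_const
    · have : (fderiv ℝ fun w => L w) = fun _ => L := funext fun w => L.fderiv
      rw [this]
      refine ⟨‖L‖, norm_nonneg _, fun i w _ => ?_⟩
      rcases k with _ | k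
      · rw [norm_iteratedFDeriv_zero]
        exact le_mul_of_one_le_right (norm_nonneg _) (hg i)
      · rw [iteratedFDeriv_succ_const]
        simpa using mul_nonneg (norm_nonneg L) (zero_le_one.trans (hg i))

/-- Integration in an additional parameter preserves uniform bounds of the derivatives. -/
theorem DerivBound.integral [FiniteDimensional ℝ W] [CompleteSpace G] {f : ι → ℝ → W → G} {b : ι → ℝ}
    (hb : ∀ i, 0 ≤ b i) (hf : ∀ i, ContDiff ℝ ∞ (Function.uncurry (f i)))
    {γ : ι → ℝ → ℝ} (hγ : ∀ i, Continuous (γ i))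
    -- The integration variable is part of the index, so one constant serves all θ and only the
    -- weight has to be integrated.
    (h : DerivBound N (fun q : {q : ι × ℝ // q.2 ∈ Ioc 0 (b q.1)} => γ q.1.1 q.1.2)
      (fun q => U q.1.1) fun q => f q.1.1 q.1.2)
    (hg : ∀ i, ∫ θ in (0 : ℝ)..b i, γ i θ ≤ g i) :
    DerivBound N g U fun i w => ∫ θ in (0 : ℝ)..b i, f i θ w :=
  ⟨fun i => contDiff_infty.2 fun n => contDiff_parametric_intervalIntegral _ _ n (hf i),
   fun n hn => by
    obtain ⟨C, hC, hbd⟩ := h.bound n hn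
    refine ⟨C, hC, fun i w hw => ?_⟩
    refine (norm_iteratedFDeriv_intervalIntegral_le (hb i) (B := fun θ => C * γ i θ)
      (continuous_const.mul (hγ i)) w n (hf i) fun θ hθ => hbd ⟨(i, θ), hθ⟩ w hw).trans ?_
    rw [intervalIntegral.integral_const_mul]
    exact mul_le_mul_of_nonneg_left (hg i) hC⟩

variable {d : ℕ}

/-- By the chain rule the derivative of f ∘ X is f'(X) composed with X', of weight S^{m-1} · S =
S^m. The induction runs over all orders m and all targets at once because f' has order m - 1 and
other values. -/
theorem derivBound_symbol_comp_nat {S : ι → ℝ} (hS : ∀ i, 1 ≤ S i) {X : ι → W → Euc d}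
    (hX : DerivBound ⊤ S U X) {c : ℝ} (hc : 0 < c)
    (hlow : ∀ i, ∀ w ∈ U i, c * S i ≤ japaneseBracket (X i w)) (n : ℕ) :
    ∀ {G : Type} [NormedAddCommGroup G] [NormedSpace ℝ G] {m : ℝ} {f : Euc d → G},
      IsSymbol m f → DerivBound n (fun i => S i ^ m) U fun i w => f (X i w) := by
  have hzero : ∀ {G : Type} [NormedAddCommGroup G] [NormedSpace ℝ G] {m : ℝ} {f : Euc d → G},
      IsSymbol m f → ∃ C : ℝ, 0 ≤ C ∧ ∀ i, ∀ w ∈ U i, ‖f (X i w)‖ ≤ C * S i ^ m := by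
    intro G _ _ m f hf
    obtain ⟨C, hC, hb⟩ := hf.bound 0
    obtain ⟨D, hD, hXb⟩ := hX.bound 0 le_top
    simp only [norm_iteratedFDeriv_zero, Nat.cast_zero, sub_zero] at hb hXb
    refine ⟨C * (max (c ^ m) ((1 + D) ^ m)), by positivity, fun i w hw => (hb _).trans ?_⟩
    rw [mul_assoc]
    refine mul_le_mul_of_nonneg_left ?_ hC
    have hSi : 0 < S i := zero_lt_one.trans_le (hS i)
    -- For m ≥ 0 the upper bound on X is used, for m ≤ 0 the lower bound on its bracket.
    rcases le_total 0 m with hm | hm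
    · have h1 : japaneseBracket (X i w) ≤ (1 + D) * S i := by
        refine (japaneseBracket_le _).trans ?_
        rw [add_mul, one_mul]
        exact add_le_add (hS i) (hXb i w hw)
      calc japaneseBracket (X i w) ^ m ≤ ((1 + D) * S i) ^ m :=
            Real.rpow_le_rpow (japaneseBracket_pos _).le h1 hm
        _ = (1 + D) ^ m * S i ^ m := Real.mul_rpow (by positivity) hSi.le
        _ ≤ _ := mul_le_mul_of_nonneg_right (le_max_right _ _) (by positivity)
    · calc japaneseBracket (X i w) ^ m ≤ (c * S i) ^ m :=
            Real.rpow_le_rpow_of_nonpos (by positivity) (hlow i w hw) hm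
        _ = c ^ m * S i ^ m := Real.mul_rpow hc.le hSi.le
        _ ≤ _ := mul_le_mul_of_nonneg_right (le_max_left _ _) (by positivity)
  induction n with
  | zero =>
    intro G _ _ m f hf
    refine ⟨fun i => hf.smooth.comp (hX.smooth i), fun k hk => ?_⟩
    have hk0 : k = 0 := by
      have : k ≤ 0 := by exact_mod_cast hk
      omega
    subst hk0
    simpa only [norm_iteratedFDeriv_zero] using hzero hf
  | succ n ih =>
    intro G _ _ m f hf
    refine .succ (fun i => hf.smooth.comp (hX.smooth i)) (hzero hf) ?_
    have h1 := (ih hf.derivative).bilinear (hX.derivative.of_le le_top)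
      (fun i => Real.rpow_nonneg (zero_le_one.trans (hS i)) _)
      (ContinuousLinearMap.compL ℝ W (Euc d) G)
    refine (h1.mono zero_le_one fun i _ => ?_).congr fun i w => ?_
    · rw [one_mul, ← Real.rpow_add_one (zero_lt_one.trans_le (hS i)).ne']
      simp
    · have h2 := ((hf.smooth.differentiable (by simp)) (X i w)).hasFDerivAt.comp w
        (((hX.smooth i).differentiable (by simp)) w).hasFDerivAt
      exact h2.fderiv.symm

/-- A symbol of order `m` composed with maps of size comparable to `S i`. -/
theorem IsSymbol.derivBound_comp {m : ℝ} {f : Euc d → G} (hf : IsSymbol m f) {S : ι → ℝ}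
    (hS : ∀ i, 1 ≤ S i) {X : ι → W → Euc d} (hX : DerivBound ⊤ S U X) {c : ℝ} (hc : 0 < c)
    (hlow : ∀ i, ∀ w ∈ U i, c * S i ≤ japaneseBracket (X i w)) :
    DerivBound ⊤ (fun i => S i ^ m) U fun i w => f (X i w) :=
  .top_of_nat fun n => derivBound_symbol_comp_nat hS hX hc hlow n hf

end UniformBounds

/-! ### Gradients as vectors, and the kinetic force. -/

section Forces

variable {d : ℕ}

/-- The vector representing a linear form. -/
def dualVec (d : ℕ) : (Euc d →L[ℝ] ℝ) →L[ℝ] Euc d :=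
  ∑ i : Fin d, (ContinuousLinearMap.apply ℝ ℝ (EuclideanSpace.single i (1 : ℝ))).smulRight
    (EuclideanSpace.single i (1 : ℝ))

theorem dualVec_toDual (v : Euc d) : dualVec d (InnerProductSpace.toDual ℝ (Euc d) v) = v := by
  ext j
  simp [dualVec, EuclideanSpace.inner_single_right, Pi.single_apply]

theorem inner_dualVec (l : Euc d →L[ℝ] ℝ) (v : Euc d) : inner ℝ (dualVec d l) v = l v := by
  obtain ⟨u, rfl⟩ := (InnerProductSpace.toDual ℝ (Euc d)).surjective l
  rw [dualVec_toDual]; rfl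

theorem gradient_eq_dualVec (f : Euc d → ℝ) (x : Euc d) : ∇ f x = dualVec d (fderiv ℝ f x) := by
  rw [← dualVec_toDual (∇ f x), gradient, LinearIsometryEquiv.apply_symm_apply]

/-- The bilinear map `(N, η) ↦ ½ Nᵀ η`. -/
def halfTranspose (d : ℕ) : (Euc d →L[ℝ] Euc d) →L[ℝ] Euc d →L[ℝ] Euc d :=
  (ContinuousLinearMap.compL ℝ (Euc d) (Euc d →L[ℝ] ℝ) (Euc d) ((1 / 2 : ℝ) • dualVec d)).comp
    ((ContinuousLinearMap.compL ℝ (Euc d) (Euc d) ℝ).comp (innerSL ℝ)).flip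

theorem halfTranspose_apply (N : Euc d →L[ℝ] Euc d) (η : Euc d) :
    halfTranspose d N η = (1 / 2 : ℝ) • dualVec d ((innerSL ℝ η).comp N) := rfl

/-- The gradient in `x` of `½ ⟨ξ, r(x) ξ⟩`. -/
def kineticForce (r : Euc d → Euc d →L[ℝ] Euc d) (x ξ : Euc d) : Euc d :=
  halfTranspose d ((fderiv ℝ r x).flip ξ) ξ

theorem inner_kineticForce (r : Euc d → Euc d →L[ℝ] Euc d) (x ξ v : Euc d) :
    inner ℝ (kineticForce r x ξ) v = (1 / 2 : ℝ) * inner ℝ ξ (fderiv ℝ r x v ξ) := by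
  rw [kineticForce, halfTranspose_apply, inner_smul_left, inner_dualVec]
  simp

theorem ContDiff.clm_apply₂ {W G₁ G₂ G₃ : Type} [NormedAddCommGroup W] [NormedSpace ℝ W]
    [NormedAddCommGroup G₁] [NormedSpace ℝ G₁] [NormedAddCommGroup G₂] [NormedSpace ℝ G₂]
    [NormedAddCommGroup G₃] [NormedSpace ℝ G₃] (B : G₁ →L[ℝ] G₂ →L[ℝ] G₃) {f : W → G₁} {g : W → G₂}
    (hf : ContDiff ℝ ∞ f) (hg : ContDiff ℝ ∞ g) : ContDiff ℝ ∞ fun w => B (f w) (g w) :=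
  (B.contDiff.comp hf).clm_apply hg

theorem ContDiff.clm_flip_apply {W G₁ G₂ G₃ : Type} [NormedAddCommGroup W] [NormedSpace ℝ W]
    [NormedAddCommGroup G₁] [NormedSpace ℝ G₁] [NormedAddCommGroup G₂] [NormedSpace ℝ G₂]
    [NormedAddCommGroup G₃] [NormedSpace ℝ G₃] {f : W → G₁ →L[ℝ] G₂ →L[ℝ] G₃} {g : W → G₂}
    (hf : ContDiff ℝ ∞ f) (hg : ContDiff ℝ ∞ g) : ContDiff ℝ ∞ fun w => (f w).flip (g w) :=
  ContDiff.clm_apply₂ ((ContinuousLinearMap.flipₗᵢ ℝ G₁ G₂ G₃).toContinuousLinearEquiv :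
    (G₁ →L[ℝ] G₂ →L[ℝ] G₃) →L[ℝ] G₂ →L[ℝ] G₁ →L[ℝ] G₃) hf hg

theorem contDiff_fderiv_apply {W A B G : Type} [NormedAddCommGroup W] [NormedSpace ℝ W]
    [NormedAddCommGroup A] [NormedSpace ℝ A] [FiniteDimensional ℝ A] [NormedAddCommGroup B]
    [NormedSpace ℝ B] [NormedAddCommGroup G] [NormedSpace ℝ G] {f : B → A → G}
    (hf : ContDiff ℝ ∞ (Function.uncurry f)) {b : W → B} {a : W → A} {v : W → A}
    (hb : ContDiff ℝ ∞ b) (ha : ContDiff ℝ ∞ a) (hv : ContDiff ℝ ∞ v) :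
    ContDiff ℝ ∞ fun w => fderiv ℝ (f (b w)) (a w) (v w) :=
  ((contDiff_uncurry_fderiv hf).comp (hb.prodMk ha)).clm_apply hv

theorem DerivBound.flip_apply {ι W G₁ G₂ G₃ : Type} [NormedAddCommGroup W] [NormedSpace ℝ W]
    [NormedAddCommGroup G₁] [NormedSpace ℝ G₁] [NormedAddCommGroup G₂] [NormedSpace ℝ G₂]
    [NormedAddCommGroup G₃] [NormedSpace ℝ G₃] {g g' : ι → ℝ} {U : ι → Set W}
    {f : ι → W → G₁ →L[ℝ] G₂ →L[ℝ] G₃} {f' : ι → W → G₂} (hf : DerivBound ⊤ g U f)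
    (hf' : DerivBound ⊤ g' U f') (hg : ∀ i, 0 ≤ g i) :
    DerivBound ⊤ (fun i => g i * g' i) U fun i w => (f i w).flip (f' i w) :=
  hf.bilinear hf' hg ((ContinuousLinearMap.flipₗᵢ ℝ G₁ G₂ G₃).toContinuousLinearEquiv :
    (G₁ →L[ℝ] G₂ →L[ℝ] G₃) →L[ℝ] G₂ →L[ℝ] G₁ →L[ℝ] G₃)

theorem DerivBound.apply {ι W G₁ G₂ : Type} [NormedAddCommGroup W] [NormedSpace ℝ W]
    [NormedAddCommGroup G₁] [NormedSpace ℝ G₁] [NormedAddCommGroup G₂] [NormedSpace ℝ G₂]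
    {g g' : ι → ℝ} {U : ι → Set W}
    {f : ι → W → G₁ →L[ℝ] G₂} {f' : ι → W → G₁} (hf : DerivBound ⊤ g U f)
    (hf' : DerivBound ⊤ g' U f') (hg : ∀ i, 0 ≤ g i) :
    DerivBound ⊤ (fun i => g i * g' i) U fun i w => f i w (f' i w) :=
  hf.bilinear hf' hg (ContinuousLinearMap.id ℝ (G₁ →L[ℝ] G₂))

theorem contDiff_kineticForce {r : Euc d → Euc d →L[ℝ] Euc d} (hr : ContDiff ℝ ∞ r)
    {W : Type} [NormedAddCommGroup W] [NormedSpace ℝ W] {x ξ : W → Euc d}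
    (hx : ContDiff ℝ ∞ x) (hξ : ContDiff ℝ ∞ ξ) :
    ContDiff ℝ ∞ fun w => kineticForce r (x w) (ξ w) := by
  have h1 : ContDiff ℝ ∞ fun w => fderiv ℝ r (x w) :=
    ContDiff.comp (g := fderiv ℝ r) (hr.fderiv_right (by simp)) hx
  have h2 : ContDiff ℝ ∞ fun w => (fderiv ℝ r (x w)).flip (ξ w) :=
    h1.clm_flip_apply hξ
  exact ContDiff.clm_apply₂ (halfTranspose d) h2 hξ

theorem norm_kineticForce_le (r : Euc d → Euc d →L[ℝ] Euc d) (x ξ : Euc d) :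
    ‖kineticForce r x ξ‖ ≤ ‖halfTranspose d‖ * ‖fderiv ℝ r x‖ * ‖ξ‖ ^ 2 := by
  have h1 : ‖(fderiv ℝ r x).flip ξ‖ ≤ ‖fderiv ℝ r x‖ * ‖ξ‖ := by
    refine ContinuousLinearMap.opNorm_le_bound _ (by positivity) fun v => ?_
    rw [ContinuousLinearMap.flip_apply]
    refine (ContinuousLinearMap.le_opNorm _ _).trans ?_
    calc ‖fderiv ℝ r x v‖ * ‖ξ‖ ≤ ‖fderiv ℝ r x‖ * ‖v‖ * ‖ξ‖ := by
          gcongr; exact ContinuousLinearMap.le_opNorm _ _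
      _ = _ := by ring
  refine ((halfTranspose d).le_opNorm₂ _ _).trans ?_
  calc ‖halfTranspose d‖ * ‖(fderiv ℝ r x).flip ξ‖ * ‖ξ‖
      ≤ ‖halfTranspose d‖ * (‖fderiv ℝ r x‖ * ‖ξ‖) * ‖ξ‖ := by gcongr
    _ = _ := by ring

end Forces

/-! ### The modifier and the vector field in modified coordinates. -/

section Modifier

variable {d : ℕ} (r : Euc d → Euc d →L[ℝ] Euc d) (gL gS : Euc d → Euc d)

/-- The density of the correction to free motion in the modified position. -/
def modifierDensity (h σ : ℝ) (ξ : Euc d) : Euc d :=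
  r (σ • ξ) ξ + σ • (kineticForce r (σ • ξ) ξ + h ^ 2 • gL (σ • ξ))

/-- The correction `∂_ξ Φ_h(s, ξ) - s ξ` to free motion. -/
def modifierCorrection (h s : ℝ) (ξ : Euc d) : Euc d :=
  ∫ σ in (0 : ℝ)..s, modifierDensity r gL h σ ξ

/-- The position `x = q + ∂_ξ Φ_h(s, ξ)`. -/
def modifiedPosition (h s : ℝ) (w : Euc d × Euc d) : Euc d :=
  w.1 + s • w.2 + modifierCorrection r gL h s w.2

/-- The gradient in `x` of the Hamiltonian `k + h² V`. -/
def totalForce (h : ℝ) (x ξ : Euc d) : Euc d :=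
  kineticForce r x ξ + h ^ 2 • gL x + h ^ 2 • gS x

/-- The vector field of the Hamiltonian motion in the coordinates `(q, ξ)`. -/
def modifiedField (h s : ℝ) (w : Euc d × Euc d) : Euc d × Euc d :=
  ((r (modifiedPosition r gL h s w) - r (s • w.2)) w.2
    + s • (kineticForce r (modifiedPosition r gL h s w) w.2 - kineticForce r (s • w.2) w.2)
    + (s * h ^ 2) • (gL (modifiedPosition r gL h s w) - gL (s • w.2))
    + (s * h ^ 2) • gS (modifiedPosition r gL h s w)
    + fderiv ℝ (modifierCorrection r gL h s) w.2
        (totalForce r gL gS h (modifiedPosition r gL h s w) w.2),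
   -totalForce r gL gS h (modifiedPosition r gL h s w) w.2)

variable {r gL gS} {W : Type} [NormedAddCommGroup W] [NormedSpace ℝ W]

theorem contDiff_modifierDensity (hr : ContDiff ℝ ∞ r) (hgL : ContDiff ℝ ∞ gL) {h σ : W → ℝ}
    {ξ : W → Euc d} (hh : ContDiff ℝ ∞ h) (hσ : ContDiff ℝ ∞ σ) (hξ : ContDiff ℝ ∞ ξ) :
    ContDiff ℝ ∞ fun w => modifierDensity r gL (h w) (σ w) (ξ w) := by
  have hx : ContDiff ℝ ∞ fun w => σ w • ξ w := hσ.smul hξ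
  have h1 : ContDiff ℝ ∞ fun w => r (σ w • ξ w) (ξ w) := (hr.comp hx).clm_apply hξ
  have h2 := contDiff_kineticForce hr hx hξ
  have h3 : ContDiff ℝ ∞ fun w => h w ^ 2 • gL (σ w • ξ w) := (hh.pow 2).smul (hgL.comp hx)
  unfold modifierDensity
  exact h1.add (hσ.smul (h2.add h3))

theorem contDiff_modifierCorrection (hr : ContDiff ℝ ∞ r) (hgL : ContDiff ℝ ∞ gL) {h s : W → ℝ}
    {ξ : W → Euc d} (hh : ContDiff ℝ ∞ h) (hs : ContDiff ℝ ∞ s) (hξ : ContDiff ℝ ∞ ξ) :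
    ContDiff ℝ ∞ fun w => modifierCorrection r gL (h w) (s w) (ξ w) := by
  have h1 : ContDiff ℝ ∞ fun p : ℝ × ℝ × Euc d => modifierCorrection r gL p.2.1 p.1 p.2.2 :=
    contDiff_parametric_primitive (f := fun θ (a : ℝ × Euc d) => modifierDensity r gL a.1 θ a.2)
      (contDiff_modifierDensity hr hgL (contDiff_fst.comp contDiff_snd) contDiff_fst
        (contDiff_snd.comp contDiff_snd))
  exact h1.comp (hs.prodMk (hh.prodMk hξ))

theorem contDiff_modifiedPosition (hr : ContDiff ℝ ∞ r) (hgL : ContDiff ℝ ∞ gL) {h s : W → ℝ}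
    {v : W → Euc d × Euc d} (hh : ContDiff ℝ ∞ h) (hs : ContDiff ℝ ∞ s) (hv : ContDiff ℝ ∞ v) :
    ContDiff ℝ ∞ fun w => modifiedPosition r gL (h w) (s w) (v w) := by
  have hq : ContDiff ℝ ∞ fun w => (v w).1 := contDiff_fst.comp hv
  have hξ : ContDiff ℝ ∞ fun w => (v w).2 := contDiff_snd.comp hv
  have h1 := contDiff_modifierCorrection hr hgL hh hs hξ
  unfold modifiedPosition
  exact (hq.add (hs.smul hξ)).add h1

theorem contDiff_totalForce (hr : ContDiff ℝ ∞ r) (hgL : ContDiff ℝ ∞ gL) (hgS : ContDiff ℝ ∞ gS)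
    {h : W → ℝ} {x ξ : W → Euc d} (hh : ContDiff ℝ ∞ h) (hx : ContDiff ℝ ∞ x)
    (hξ : ContDiff ℝ ∞ ξ) : ContDiff ℝ ∞ fun w => totalForce r gL gS (h w) (x w) (ξ w) := by
  have h1 := contDiff_kineticForce hr hx hξ
  have h2 : ContDiff ℝ ∞ fun w => h w ^ 2 • gL (x w) := (hh.pow 2).smul (hgL.comp hx)
  have h3 : ContDiff ℝ ∞ fun w => h w ^ 2 • gS (x w) := (hh.pow 2).smul (hgS.comp hx)
  unfold totalForce
  exact (h1.add h2).add h3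

theorem contDiff_modifiedField (hr : ContDiff ℝ ∞ r) (hgL : ContDiff ℝ ∞ gL)
    (hgS : ContDiff ℝ ∞ gS) :
    ContDiff ℝ ∞ fun p : (ℝ × ℝ) × (Euc d × Euc d) => modifiedField r gL gS p.1.1 p.1.2 p.2 := by
  have hh : ContDiff ℝ ∞ fun p : (ℝ × ℝ) × (Euc d × Euc d) => p.1.1 := contDiff_fst.comp contDiff_fst
  have hs : ContDiff ℝ ∞ fun p : (ℝ × ℝ) × (Euc d × Euc d) => p.1.2 := contDiff_snd.comp contDiff_fst
  have hξ : ContDiff ℝ ∞ fun p : (ℝ × ℝ) × (Euc d × Euc d) => p.2.2 := contDiff_snd.comp contDiff_snd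
  have hx : ContDiff ℝ ∞ fun p : (ℝ × ℝ) × (Euc d × Euc d) =>
      modifiedPosition r gL p.1.1 p.1.2 p.2 :=
    contDiff_modifiedPosition hr hgL hh hs contDiff_snd
  have hy : ContDiff ℝ ∞ fun p : (ℝ × ℝ) × (Euc d × Euc d) => p.1.2 • p.2.2 := hs.smul hξ
  have hf := contDiff_totalForce hr hgL hgS hh hx hξ
  have h5 : ContDiff ℝ ∞ fun p : (ℝ × ℝ) × (Euc d × Euc d) =>
      fderiv ℝ (modifierCorrection r gL p.1.1 p.1.2) p.2.2
        (totalForce r gL gS p.1.1 (modifiedPosition r gL p.1.1 p.1.2 p.2) p.2.2) :=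
    contDiff_fderiv_apply (B := ℝ × ℝ) (A := Euc d)
      (f := fun b ξ => modifierCorrection r gL b.1 b.2 ξ)
      (contDiff_modifierCorrection hr hgL (contDiff_fst.comp contDiff_fst)
        (contDiff_snd.comp contDiff_fst) contDiff_snd) contDiff_fst hξ hf
  have hsh : ContDiff ℝ ∞ fun p : (ℝ × ℝ) × (Euc d × Euc d) => p.1.2 * p.1.1 ^ 2 :=
    hs.mul (hh.pow 2)
  have h1 : ContDiff ℝ ∞ fun p : (ℝ × ℝ) × (Euc d × Euc d) =>
      (r (modifiedPosition r gL p.1.1 p.1.2 p.2) - r (p.1.2 • p.2.2)) p.2.2 :=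
    ((hr.comp hx).sub (hr.comp hy)).clm_apply hξ
  have h2 := hs.smul ((contDiff_kineticForce hr hx hξ).sub (contDiff_kineticForce hr hy hξ))
  have h3 : ContDiff ℝ ∞ fun p : (ℝ × ℝ) × (Euc d × Euc d) => (p.1.2 * p.1.1 ^ 2) •
      (gL (modifiedPosition r gL p.1.1 p.1.2 p.2) - gL (p.1.2 • p.2.2)) :=
    hsh.smul ((hgL.comp hx).sub (hgL.comp hy))
  have h4 : ContDiff ℝ ∞ fun p : (ℝ × ℝ) × (Euc d × Euc d) => (p.1.2 * p.1.1 ^ 2) •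
      gS (modifiedPosition r gL p.1.1 p.1.2 p.2) := hsh.smul (hgS.comp hx)
  unfold modifiedField
  exact ((((h1.add h2).add h3).add h4).add h5).prodMk hf.neg

end Modifier

theorem DerivBound.comp_clm {ι W W' G : Type} [NormedAddCommGroup W] [NormedSpace ℝ W]
    [NormedAddCommGroup W'] [NormedSpace ℝ W'] [NormedAddCommGroup G] [NormedSpace ℝ G]
    {N : ℕ∞} {g : ι → ℝ} {U : ι → Set W} {f : ι → W → G} (h : DerivBound N g U f) (L : W' →L[ℝ] W) :
    DerivBound N g (fun i => L ⁻¹' U i) fun i w => f i (L w) :=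
  ⟨fun i => (h.smooth i).comp L.contDiff, fun n hn => by
    obtain ⟨C, hC, hb⟩ := h.bound n hn
    refine ⟨C * ‖L‖ ^ n, by positivity, fun i w hw => ?_⟩
    have h1 : iteratedFDeriv ℝ n (fun w => f i (L w)) w =
        (iteratedFDeriv ℝ n (f i) (L w)).compContinuousLinearMap fun _ => L :=
      L.iteratedFDeriv_comp_right (h.smooth i) w (mod_cast le_top)
    rw [h1]
    refine (ContinuousMultilinearMap.norm_compContinuousLinearMap_le _ _).trans ?_
    rw [Finset.prod_const, Finset.card_univ, Fintype.card_fin]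
    calc _ ≤ C * g i * ‖L‖ ^ n := by gcongr; exact hb i _ hw
      _ = _ := by ring⟩

/-! ### Powers of the time scale in the range h(1 + s) ≤ T. -/

/-- Pairs `(h, s)` of a semiclassical parameter and a time with `h (1 + s) ≤ T`. -/
abbrev TimeRange (T : ℝ) : Type := {p : ℝ × ℝ // 0 ≤ p.1 ∧ 0 ≤ p.2 ∧ p.1 * (1 + p.2) ≤ T}

/-- The size `1 + s` of the position at time `s`. -/
def timeScale {T : ℝ} (i : TimeRange T) : ℝ := 1 + i.1.2

theorem one_le_timeScale {T : ℝ} (i : TimeRange T) : 1 ≤ timeScale i :=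
  le_add_of_nonneg_right i.2.2.1

theorem timeScale_pos {T : ℝ} (i : TimeRange T) : 0 < timeScale i :=
  zero_lt_one.trans_le (one_le_timeScale i)

/-- From h(1 + s) ≤ T, a factor h² is worth two powers of decay in 1 + s. This compensates the
growth of the potential. -/
theorem sq_mul_rpow_timeScale_le {T : ℝ} (i : TimeRange T) (a b : ℝ) (hab : a ≤ b + 2) :
    i.1.1 ^ 2 * timeScale i ^ a ≤ T ^ 2 * timeScale i ^ b := by
  have hS := timeScale_pos i
  have h1 : timeScale i ^ a ≤ timeScale i ^ b * timeScale i ^ 2 := by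
    rw [← Real.rpow_natCast, ← Real.rpow_add hS]
    exact Real.rpow_le_rpow_of_exponent_le (one_le_timeScale i) (by push_cast; exact hab)
  have h2 : (i.1.1 * timeScale i) ^ 2 ≤ T ^ 2 :=
    pow_le_pow_left₀ (mul_nonneg i.2.1 hS.le) i.2.2.2 2
  calc i.1.1 ^ 2 * timeScale i ^ a ≤ i.1.1 ^ 2 * (timeScale i ^ b * timeScale i ^ 2) := by gcongr
    _ = (i.1.1 * timeScale i) ^ 2 * timeScale i ^ b := by ring
    _ ≤ _ := by gcongr

theorem time_mul_rpow_timeScale_le {T : ℝ} (i : TimeRange T) (a b : ℝ) (hab : a + 1 ≤ b) :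
    |i.1.2| * timeScale i ^ a ≤ timeScale i ^ b := by
  have hS := timeScale_pos i
  rw [abs_of_nonneg i.2.2.1]
  calc i.1.2 * timeScale i ^ a ≤ timeScale i * timeScale i ^ a := by
        gcongr; exact le_add_of_nonneg_left zero_le_one
    _ = timeScale i ^ (a + 1) := by rw [Real.rpow_add_one hS.ne', mul_comm]
    _ ≤ _ := Real.rpow_le_rpow_of_exponent_le (one_le_timeScale i) hab

theorem rpow_timeScale_le {T : ℝ} (i : TimeRange T) {a b : ℝ} (hab : a ≤ b) :
    timeScale i ^ a ≤ timeScale i ^ b :=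
  Real.rpow_le_rpow_of_exponent_le (one_le_timeScale i) hab

/-! ### Uniform decay of the modified field. -/

section Bounds

variable {d : ℕ} {r : Euc d → Euc d →L[ℝ] Euc d} {gL gS : Euc d → Euc d} {μ T c R : ℝ}

/-- Momenta of size between `c` and `R`. -/
def momentumShell (d : ℕ) (c R : ℝ) : Set (Euc d) := {ξ | c ≤ ‖ξ‖ ∧ ‖ξ‖ ≤ R}

theorem derivBound_kineticForce {ι W : Type} [NormedAddCommGroup W] [NormedSpace ℝ W]
    {U : ι → Set W} {a : ι → ℝ} (ha : ∀ i, 0 ≤ a i) {f : ι → W → Euc d →L[ℝ] Euc d →L[ℝ] Euc d}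
    {Ξ : ι → W → Euc d} (hf : DerivBound ⊤ a U f) (hΞ : DerivBound ⊤ (fun _ => 1) U Ξ) :
    DerivBound ⊤ a U fun i w => halfTranspose d ((f i w).flip (Ξ i w)) (Ξ i w) := by
  have h1 := (hf.flip_apply hΞ ha).bilinear hΞ (fun i => by simpa using ha i) (halfTranspose d)
  exact h1.mono zero_le_one fun i _ => by simp

/-- Linear growth beats the power 1 - μ for large s; for bounded s the bracket is at least 1 anyway.
-/
theorem exists_japaneseBracket_lower (hc : 0 < c) (hμ : 0 < μ) (K : ℝ) :
    ∃ c₁ : ℝ, 0 < c₁ ∧ ∀ s : ℝ, 0 ≤ s → ∀ y : Euc d, s * c - K * (1 + s) ^ (1 - μ) ≤ ‖y‖ →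
      c₁ * (1 + s) ≤ japaneseBracket y := by
  have hlim : Tendsto (fun s : ℝ => K * (1 + s) ^ (-μ)) atTop (𝓝 (K * 0)) :=
    ((tendsto_rpow_neg_atTop hμ).comp (tendsto_atTop_add_const_left _ 1 tendsto_id)).const_mul K
  rw [mul_zero] at hlim
  obtain ⟨s₀, hs₀⟩ := ((hlim.eventually (gt_mem_nhds (by positivity : 0 < c / 4))).and
    (eventually_ge_atTop 1)).exists_forall_of_atTop
  have hs₀1 : 1 ≤ s₀ := (hs₀ s₀ le_rfl).2
  refine ⟨min (c / 4) (1 / (1 + s₀)), lt_min (by positivity) (by positivity), fun s hs y hy => ?_⟩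
  rcases le_total s₀ s with h | h
  · have h1 := (hs₀ s h).1
    have h2 : 1 ≤ s := (hs₀ s h).2
    have h3 : K * (1 + s) ^ (1 - μ) ≤ c / 4 * (1 + s) := by
      have : (1 + s) ^ (1 - μ) = (1 + s) ^ (-μ) * (1 + s) := by
        rw [← Real.rpow_add_one (by positivity)]; congr 1; ring
      rw [this, ← mul_assoc]
      gcongr
    calc min (c / 4) (1 / (1 + s₀)) * (1 + s) ≤ c / 4 * (1 + s) := by
          gcongr; exact min_le_left _ _
      _ ≤ s * c - K * (1 + s) ^ (1 - μ) := by nlinarith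
      _ ≤ _ := hy.trans (norm_le_japaneseBracket y)
  · calc min (c / 4) (1 / (1 + s₀)) * (1 + s) ≤ 1 / (1 + s₀) * (1 + s₀) := by
          gcongr; exact min_le_right _ _
      _ = 1 := by field_simp
      _ ≤ _ := one_le_japaneseBracket y

theorem derivBound_momentum (hR : 0 ≤ R) {ι : Type} :
    DerivBound ⊤ (fun _ : ι => (1 : ℝ)) (fun _ => momentumShell d c R) fun _ ξ => ξ :=
  DerivBound.of_clm (ContinuousLinearMap.id ℝ (Euc d)) hR
    (fun _ w hw => by rw [mul_one]; exact hw.2) fun _ => le_rfl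

theorem derivBound_freePosition (hR : 0 ≤ R) :
    DerivBound ⊤ (fun i : TimeRange T => timeScale i) (fun _ => momentumShell d c R)
      fun i ξ => i.1.2 • ξ :=
  ((derivBound_momentum hR).const_smul fun i : TimeRange T => i.1.2).mono zero_le_one fun i _ => by
    rw [mul_one, one_mul, abs_of_nonneg i.2.2.1]
    exact le_add_of_nonneg_left zero_le_one

/-- Power counting at x = sξ, which has size 1 + s: the metric term has exponent -μ, the kinetic
force 1 + (-μ - 1), and the long range force 1 + (1 - μ) - 2, where the -2 comes from h². -/
theorem derivBound_modifierDensity (hr : IsSymbol (-μ) r) (hgL : IsSymbol (1 - μ) gL)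
    (hc : 0 < c) (hR : 0 ≤ R) (hμ : 0 < μ) :
    DerivBound ⊤ (fun i : TimeRange T => timeScale i ^ (-μ)) (fun _ => momentumShell d c R)
      fun i ξ => modifierDensity r gL i.1.1 i.1.2 ξ := by
  obtain ⟨c₀, hc₀, hlow⟩ := exists_japaneseBracket_lower (d := d) hc hμ 0
  have hlow' : ∀ i : TimeRange T, ∀ ξ ∈ momentumShell d c R,
      c₀ * timeScale i ≤ japaneseBracket (i.1.2 • ξ) := fun i ξ hξ => by
    refine hlow _ i.2.2.1 _ ?_
    rw [zero_mul, sub_zero, norm_smul, Real.norm_of_nonneg i.2.2.1]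
    exact mul_le_mul_of_nonneg_left hξ.1 i.2.2.1
  have hX := derivBound_freePosition (d := d) (T := T) (c := c) hR
  have hξ := derivBound_momentum (d := d) (c := c) hR (ι := TimeRange T)
  have hpos : ∀ (a : ℝ) (i : TimeRange T), 0 ≤ timeScale i ^ a :=
    fun a i => Real.rpow_nonneg (timeScale_pos i).le a
  have h1 := (hr.derivBound_comp one_le_timeScale hX hc₀ hlow').apply hξ (hpos _)
  have h2 := derivBound_kineticForce (hpos _)
    (hr.derivative.derivBound_comp one_le_timeScale hX hc₀ hlow') hξ
  have h3 := ((hgL.derivBound_comp one_le_timeScale hX hc₀ hlow').const_smul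
    fun i => i.1.1 ^ 2).mono (g' := fun i => timeScale i ^ (-μ - 1)) (sq_nonneg T) fun i _ => by
      rw [abs_of_nonneg (sq_nonneg _)]
      exact sq_mul_rpow_timeScale_le i _ _ (by linarith)
  have h4 := ((h2.add h3).const_smul fun i => i.1.2).mono
    (g' := fun i => timeScale i ^ (-μ)) zero_le_one fun i _ => by
      rw [one_mul]; exact time_mul_rpow_timeScale_le i _ _ (by linarith)
  exact (h1.mono zero_le_one fun i _ => by simp).add h4

theorem integral_one_add_abs_rpow_le {s : ℝ} (hs : 0 ≤ s) (hμ1 : μ < 1) :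
    ∫ θ in (0 : ℝ)..s, (1 + |θ|) ^ (-μ) ≤ (1 - μ)⁻¹ * (1 + s) ^ (1 - μ) := by
  have h1 : ∫ θ in (0 : ℝ)..s, (1 + |θ|) ^ (-μ) = ∫ θ in (0 : ℝ)..s, (1 + θ) ^ (-μ) := by
    refine intervalIntegral.integral_congr fun θ hθ => ?_
    rw [uIcc_of_le hs] at hθ
    simp only [abs_of_nonneg hθ.1]
  rw [h1, intervalIntegral.integral_comp_add_left (fun θ => θ ^ (-μ)) 1,
    integral_rpow (Or.inl (by linarith))]
  have : 0 < 1 - μ := by linarith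
  rw [neg_add_eq_sub, div_eq_inv_mul, add_zero, Real.one_rpow]
  gcongr
  linarith

/-- The density is O((1 + σ)^{-μ}); as μ < 1 its integral grows like (1 + s)^{1-μ}. -/
theorem derivBound_modifierCorrection (hr : IsSymbol (-μ) r) (hgL : IsSymbol (1 - μ) gL)
    (hc : 0 < c) (hR : 0 ≤ R) (hμ : 0 < μ) (hμ1 : μ < 1) :
    DerivBound ⊤ (fun i : TimeRange T => timeScale i ^ (1 - μ)) (fun _ => momentumShell d c R)
      fun i ξ => modifierCorrection r gL i.1.1 i.1.2 ξ := by
  have h := derivBound_modifierDensity (T := T) hr hgL hc hR hμ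
  -- For σ ≤ s the pair (h, σ) is again admissible, since h(1 + σ) ≤ h(1 + s) ≤ T.
  have h1 := h.reindex (κ := {q : TimeRange T × ℝ // q.2 ∈ Ioc 0 q.1.1.2})
    fun q => ⟨(q.1.1.1.1, q.1.2), q.1.1.2.1, q.2.1.le, (mul_le_mul_of_nonneg_left
      (add_le_add_right q.2.2 1) q.1.1.2.1).trans q.1.1.2.2.2⟩
  -- The absolute value in the weight only makes it continuous on the whole line.
  refine (DerivBound.integral (g := fun i : TimeRange T => (1 - μ)⁻¹ * timeScale i ^ (1 - μ))
    (b := fun i : TimeRange T => i.1.2) (γ := fun _ θ => (1 + |θ|) ^ (-μ))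
    (f := fun i θ ξ => modifierDensity r gL i.1.1 θ ξ) (U := fun _ => momentumShell d c R)
    (fun i => i.2.2.1)
    (fun i => contDiff_modifierDensity hr.smooth hgL.smooth contDiff_const contDiff_fst contDiff_snd)
    (fun i => (continuous_const.add continuous_abs).rpow_const fun θ => Or.inl
      (add_pos_of_pos_of_nonneg one_pos (abs_nonneg θ)).ne')
    (h1.mono zero_le_one fun q _ => ?_) fun i => integral_one_add_abs_rpow_le i.2.2.1 hμ1).mono
    (inv_nonneg.2 (by linarith)) fun i _ => le_rfl
  rw [one_mul, abs_of_nonneg q.2.1.le]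
  rfl

/-- The region of phase space that is visited by the modified motion up to time `s`. -/
def modifiedRegion (d : ℕ) (μ c R : ℝ) {T : ℝ} (i : TimeRange T) : Set (Euc d × Euc d) :=
  {w | w.2 ∈ momentumShell d c R ∧ ‖w.1‖ ≤ R * timeScale i ^ (1 - μ)}

theorem DerivBound.comp_snd {G : Type} [NormedAddCommGroup G] [NormedSpace ℝ G]
    {g : TimeRange T → ℝ} {f : TimeRange T → Euc d → G}
    (h : DerivBound ⊤ g (fun _ => momentumShell d c R) f) :
    DerivBound ⊤ g (fun i => modifiedRegion d μ c R i) fun i w => f i w.2 :=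
  (h.comp_clm (ContinuousLinearMap.snd ℝ (Euc d) (Euc d))).subset fun _ _ hw => hw.1

/-- This is x - sξ, the deviation from free motion. It is of lower order than the position, by the
factor (1 + s)^{-μ}. -/
theorem derivBound_displacement (hr : IsSymbol (-μ) r) (hgL : IsSymbol (1 - μ) gL)
    (hc : 0 < c) (hR : 0 ≤ R) (hμ : 0 < μ) (hμ1 : μ < 1) :
    DerivBound ⊤ (fun i : TimeRange T => timeScale i ^ (1 - μ)) (fun i => modifiedRegion d μ c R i)
      fun i w => w.1 + modifierCorrection r gL i.1.1 i.1.2 w.2 :=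
  (DerivBound.of_clm (ContinuousLinearMap.fst ℝ (Euc d) (Euc d)) hR (fun _ _ hw => hw.2)
    fun i => Real.one_le_rpow (one_le_timeScale i) (by linarith)).add
    (derivBound_modifierCorrection hr hgL hc hR hμ hμ1).comp_snd

/-- The points on the segment between the free and the modified position. -/
def segmentPosition (r : Euc d → Euc d →L[ℝ] Euc d) (gL : Euc d → Euc d) (h s θ : ℝ)
    (w : Euc d × Euc d) : Euc d :=
  s • w.2 + θ • (w.1 + modifierCorrection r gL h s w.2)

theorem segmentPosition_one (h s : ℝ) (w : Euc d × Euc d) :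
    segmentPosition r gL h s 1 w = modifiedPosition r gL h s w := by
  simp only [segmentPosition, modifiedPosition, one_smul]; abel

theorem derivBound_segmentPosition (hr : IsSymbol (-μ) r) (hgL : IsSymbol (1 - μ) gL)
    (hc : 0 < c) (hR : 0 ≤ R) (hμ : 0 < μ) (hμ1 : μ < 1) :
    DerivBound ⊤ (fun q : TimeRange T × Icc (0 : ℝ) 1 => timeScale q.1)
      (fun q => modifiedRegion d μ c R q.1) fun q w => segmentPosition r gL q.1.1.1 q.1.1.2 q.2 w := by
  have h1 := (derivBound_freePosition (d := d) (T := T) (c := c) hR).comp_snd (μ := μ) |>.reindex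
    (fun q : TimeRange T × Icc (0 : ℝ) 1 => q.1)
  have h2 := ((derivBound_displacement (T := T) hr hgL hc hR hμ hμ1).reindex
    (fun q : TimeRange T × Icc (0 : ℝ) 1 => q.1)).const_smul fun q => (q.2 : ℝ)
  refine h1.add (h2.mono zero_le_one fun q _ => ?_)
  rw [one_mul, abs_of_nonneg q.2.2.1]
  calc (q.2 : ℝ) * timeScale q.1 ^ (1 - μ) ≤ 1 * timeScale q.1 ^ (1 : ℝ) := by
        refine mul_le_mul q.2.2.2 (rpow_timeScale_le _ (by linarith))
          (Real.rpow_nonneg (timeScale_pos _).le _) zero_le_one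
    _ = _ := by simp

/-- The displacement is sublinear and |sξ| ≥ cs, so the whole segment from sξ to x keeps a bracket
comparable to 1 + s. Decay of symbols can therefore be used along it. -/
theorem exists_segmentPosition_lower (hr : IsSymbol (-μ) r) (hgL : IsSymbol (1 - μ) gL)
    (hc : 0 < c) (hR : 0 ≤ R) (hμ : 0 < μ) (hμ1 : μ < 1) :
    ∃ c₁ : ℝ, 0 < c₁ ∧ ∀ q : TimeRange T × Icc (0 : ℝ) 1, ∀ w ∈ modifiedRegion d μ c R q.1,
      c₁ * timeScale q.1 ≤ japaneseBracket (segmentPosition r gL q.1.1.1 q.1.1.2 q.2 w) := by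
  obtain ⟨K, hK, hb⟩ := (derivBound_displacement (T := T) hr hgL hc hR hμ hμ1).bound 0 le_top
  obtain ⟨c₁, hc₁, hlow⟩ := exists_japaneseBracket_lower (d := d) hc hμ K
  refine ⟨c₁, hc₁, fun q w hw => hlow _ q.1.2.2.1 _ ?_⟩
  have h1 := hb q.1 w hw
  rw [norm_iteratedFDeriv_zero] at h1
  have h2 : ‖(q.2 : ℝ) • (w.1 + modifierCorrection r gL q.1.1.1 q.1.1.2 w.2)‖ ≤
      K * timeScale q.1 ^ (1 - μ) := by
    rw [norm_smul, Real.norm_of_nonneg q.2.2.1]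
    exact (mul_le_of_le_one_left (norm_nonneg _) q.2.2.2).trans h1
  have h3 : q.1.1.2 * c ≤ ‖q.1.1.2 • w.2‖ := by
    rw [norm_smul, Real.norm_of_nonneg q.1.2.2.1]
    exact mul_le_mul_of_nonneg_left hw.1.1 q.1.2.2.1
  have h4 := norm_sub_le_norm_add (q.1.1.2 • w.2)
    ((q.2 : ℝ) • (w.1 + modifierCorrection r gL q.1.1.1 q.1.1.2 w.2))
  change _ ≤ ‖segmentPosition r gL _ _ _ w‖ at h4
  unfold timeScale at h2
  linarith

/-- Integrate f' along the segment from sξ to x: the weight is (m - 1) + (1 - μ) = m - μ. This extra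
gain of μ turns the decay -μ into the integrable -2μ. -/
theorem IsSymbol.derivBound_difference {m : ℝ} {G : Type} [NormedAddCommGroup G] [NormedSpace ℝ G]
    [CompleteSpace G] {f : Euc d → G} (hf : IsSymbol m f)
    (hr : IsSymbol (-μ) r) (hgL : IsSymbol (1 - μ) gL)
    (hc : 0 < c) (hR : 0 ≤ R) (hμ : 0 < μ) (hμ1 : μ < 1) :
    DerivBound ⊤ (fun i : TimeRange T => timeScale i ^ (m - μ)) (fun i => modifiedRegion d μ c R i)
      fun i w => f (modifiedPosition r gL i.1.1 i.1.2 w) - f (i.1.2 • w.2) := by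
  obtain ⟨c₁, hc₁, hlow⟩ := exists_segmentPosition_lower (T := T) hr hgL hc hR hμ hμ1
  have hY := derivBound_segmentPosition (T := T) hr hgL hc hR hμ hμ1
  have hD := hf.derivative.derivBound_comp (S := fun q : TimeRange T × Icc (0 : ℝ) 1 => timeScale q.1)
    (fun q => one_le_timeScale q.1) hY hc₁ hlow
  have hP := (derivBound_displacement (T := T) hr hgL hc hR hμ hμ1).reindex
    (fun q : TimeRange T × Icc (0 : ℝ) 1 => q.1)
  have h1 := (hD.apply hP fun q => Real.rpow_nonneg (timeScale_pos q.1).le _).mono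
    (g' := fun q => timeScale q.1 ^ (m - μ)) zero_le_one fun q _ => by
      rw [one_mul, ← Real.rpow_add (timeScale_pos q.1)]
      exact rpow_timeScale_le _ (by linarith)
  have h2 := h1.reindex (κ := {q : TimeRange T × ℝ // q.2 ∈ Ioc 0 1})
    fun q => (q.1.1, ⟨q.1.2, q.2.1.le, q.2.2⟩)
  have hseg : ∀ i : TimeRange T, ContDiff ℝ ∞ fun p : ℝ × (Euc d × Euc d) =>
      segmentPosition r gL i.1.1 i.1.2 p.1 p.2 := fun i => by
    have hξ : ContDiff ℝ ∞ fun p : ℝ × (Euc d × Euc d) => p.2.2 := contDiff_snd.comp contDiff_snd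
    have hq : ContDiff ℝ ∞ fun p : ℝ × (Euc d × Euc d) => p.2.1 := contDiff_fst.comp contDiff_snd
    exact (hξ.const_smul i.1.2).add (contDiff_fst.smul (hq.add
      (contDiff_modifierCorrection hr.smooth hgL.smooth contDiff_const contDiff_const hξ)))
  have hdisp : ∀ i : TimeRange T, ContDiff ℝ ∞ fun w : Euc d × Euc d =>
      w.1 + modifierCorrection r gL i.1.1 i.1.2 w.2 := fun i =>
    contDiff_fst.add (contDiff_modifierCorrection hr.smooth hgL.smooth contDiff_const contDiff_const
      contDiff_snd)
  have hfd : ContDiff ℝ ∞ (fderiv ℝ f) := hf.smooth.fderiv_right (by simp)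
  have h3 := DerivBound.integral (g := fun i : TimeRange T => timeScale i ^ (m - μ))
    (b := fun _ : TimeRange T => 1) (γ := fun i _ => timeScale i ^ (m - μ))
    (f := fun i θ w => fderiv ℝ f (segmentPosition r gL i.1.1 i.1.2 θ w)
      (w.1 + modifierCorrection r gL i.1.1 i.1.2 w.2)) (U := fun i => modifiedRegion d μ c R i)
    (fun i => zero_le_one) (fun i => (hfd.comp (hseg i)).clm_apply ((hdisp i).comp contDiff_snd))
    (fun i => continuous_const) h2 fun i => by simp
  refine h3.congr fun i w => ?_
  have hder : ∀ θ ∈ uIcc (0 : ℝ) 1, HasDerivAt (fun θ => f (segmentPosition r gL i.1.1 i.1.2 θ w))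
      (fderiv ℝ f (segmentPosition r gL i.1.1 i.1.2 θ w)
        (w.1 + modifierCorrection r gL i.1.1 i.1.2 w.2)) θ := fun θ _ => by
    have h5 : HasDerivAt (fun θ : ℝ => segmentPosition r gL i.1.1 i.1.2 θ w)
        (w.1 + modifierCorrection r gL i.1.1 i.1.2 w.2) θ := by
      have := ((hasDerivAt_id θ).smul_const (w.1 + modifierCorrection r gL i.1.1 i.1.2 w.2)).const_add
        (i.1.2 • w.2)
      simpa [segmentPosition] using this
    exact ((hf.smooth.differentiable (by simp)) _).hasFDerivAt.comp_hasDerivAt θ h5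
  have hcont : Continuous fun θ => fderiv ℝ f (segmentPosition r gL i.1.1 i.1.2 θ w)
      (w.1 + modifierCorrection r gL i.1.1 i.1.2 w.2) :=
    (hfd.continuous.comp ((hseg i).continuous.comp (continuous_id.prodMk continuous_const))).clm_apply
      continuous_const
  rw [intervalIntegral.integral_eq_sub_of_hasDerivAt hder (hcont.intervalIntegrable _ _),
    segmentPosition_one]
  simp [segmentPosition]

/-- The modified field and all its derivatives are integrable in time, uniformly. -/
theorem derivBound_modifiedField (hr : IsSymbol (-μ) r) (hgL : IsSymbol (1 - μ) gL)
    (hgS : IsSymbol (1 - 2 * μ) gS)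
    (hc : 0 < c) (hR : 0 ≤ R) (hμ : 0 < μ) (hμ1 : μ < 1) :
    DerivBound ⊤ (fun i : TimeRange T => timeScale i ^ (-2 * μ)) (fun i => modifiedRegion d μ c R i)
      fun i w => modifiedField r gL gS i.1.1 i.1.2 w := by
  obtain ⟨c₁, hc₁, hlow⟩ := exists_segmentPosition_lower (T := T) hr hgL hc hR hμ hμ1
  have hX : DerivBound ⊤ (fun i : TimeRange T => timeScale i) (fun i => modifiedRegion d μ c R i)
      fun i w => modifiedPosition r gL i.1.1 i.1.2 w :=
    ((derivBound_segmentPosition (T := T) hr hgL hc hR hμ hμ1).reindex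
      fun i => (i, ⟨1, zero_le_one, le_rfl⟩)).congr fun i w => segmentPosition_one _ _ _
  have hlowX : ∀ i : TimeRange T, ∀ w ∈ modifiedRegion d μ c R i,
      c₁ * timeScale i ≤ japaneseBracket (modifiedPosition r gL i.1.1 i.1.2 w) := fun i w hw => by
    rw [← segmentPosition_one]
    exact hlow (i, ⟨1, zero_le_one, le_rfl⟩) w hw
  have hξ := (derivBound_momentum (d := d) (c := c) hR (ι := TimeRange T)).comp_snd (μ := μ)
  have hpos : ∀ (a : ℝ) (i : TimeRange T), 0 ≤ timeScale i ^ a :=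
    fun a i => Real.rpow_nonneg (timeScale_pos i).le a
  -- With h² worth two powers, the long range force has exponent (1 - μ) - 2 and the short range
  -- force (1 - 2μ) - 2, both at most -1 - μ.
  have hf : DerivBound ⊤ (fun i : TimeRange T => timeScale i ^ (-1 - μ))
      (fun i => modifiedRegion d μ c R i) fun i w =>
        totalForce r gL gS i.1.1 (modifiedPosition r gL i.1.1 i.1.2 w) w.2 := by
    have h1 := (derivBound_kineticForce (hpos _)
      (hr.derivative.derivBound_comp one_le_timeScale hX hc₁ hlowX) hξ).mono
      (g' := fun i => timeScale i ^ (-1 - μ)) zero_le_one fun i _ => by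
        rw [one_mul]; exact rpow_timeScale_le _ (by linarith)
    have h2 := ((hgL.derivBound_comp one_le_timeScale hX hc₁ hlowX).const_smul
      fun i => i.1.1 ^ 2).mono (g' := fun i => timeScale i ^ (-1 - μ)) (sq_nonneg T) fun i _ => by
        rw [abs_of_nonneg (sq_nonneg _)]
        exact sq_mul_rpow_timeScale_le i _ _ (by linarith)
    have h3 := ((hgS.derivBound_comp one_le_timeScale hX hc₁ hlowX).const_smul
      fun i => i.1.1 ^ 2).mono (g' := fun i => timeScale i ^ (-1 - μ)) (sq_nonneg T) fun i _ => by
        rw [abs_of_nonneg (sq_nonneg _)]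
        exact sq_mul_rpow_timeScale_le i _ _ (by linarith)
    exact (h1.add h2).add h3
  -- Exponents: 1 from s, -2 from h², and 1 - 2μ.
  have hweight : ∀ i : TimeRange T, |i.1.2 * i.1.1 ^ 2| * timeScale i ^ (1 - 2 * μ) ≤
      T ^ 2 * timeScale i ^ (-2 * μ) := fun i => by
    rw [abs_mul, abs_of_nonneg (sq_nonneg i.1.1), mul_comm |i.1.2|, mul_assoc]
    exact (mul_le_mul_of_nonneg_left (time_mul_rpow_timeScale_le i _ (2 - 2 * μ) (by linarith))
      (sq_nonneg _)).trans (sq_mul_rpow_timeScale_le i _ _ (by linarith))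
  have t1 := ((hr.derivBound_difference (T := T) hr hgL hc hR hμ hμ1).apply hξ (hpos _)).mono
    (g' := fun i => timeScale i ^ (-2 * μ)) zero_le_one fun i _ => by
      rw [one_mul, mul_one]; exact rpow_timeScale_le _ (by linarith)
  have t2 : DerivBound ⊤ (fun i : TimeRange T => timeScale i ^ (-2 * μ))
      (fun i => modifiedRegion d μ c R i) fun i w => i.1.2 •
        (kineticForce r (modifiedPosition r gL i.1.1 i.1.2 w) w.2 -
          kineticForce r (i.1.2 • w.2) w.2) := by
    have h1 := derivBound_kineticForce (hpos _)
      (hr.derivative.derivBound_difference (T := T) hr hgL hc hR hμ hμ1) hξ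
    refine ((h1.const_smul fun i => i.1.2).mono zero_le_one fun i _ => ?_).congr fun i w => ?_
    · rw [one_mul]; exact time_mul_rpow_timeScale_le i _ _ (by linarith)
    · congr 1
      simp only [kineticForce, ← sub_apply, ← map_sub]
      rfl
  have t3 := ((hgL.derivBound_difference (T := T) hr hgL hc hR hμ hμ1).const_smul
    fun i => i.1.2 * i.1.1 ^ 2).mono (g' := fun i => timeScale i ^ (-2 * μ)) (sq_nonneg T)
      fun i _ => by
        have : 1 - μ - μ = 1 - 2 * μ := by ring
        rw [this]; exact hweight i
  have t4 := ((hgS.derivBound_comp one_le_timeScale hX hc₁ hlowX).const_smul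
    fun i => i.1.2 * i.1.1 ^ 2).mono (g' := fun i => timeScale i ^ (-2 * μ)) (sq_nonneg T)
      fun i _ => hweight i
  -- The correction grows with exponent 1 - μ and the force decays with -1 - μ, which add up to -2μ.
  have t5 := (((derivBound_modifierCorrection (T := T) hr hgL hc hR hμ hμ1).derivative.comp_snd
    (μ := μ)).apply hf (hpos _)).mono (g' := fun i => timeScale i ^ (-2 * μ)) zero_le_one
      fun i _ => by
        rw [one_mul, ← Real.rpow_add (timeScale_pos i)]
        exact rpow_timeScale_le _ (by linarith)
  have hq := (((t1.add t2).add t3).add t4).add t5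
  -- Here μ < 1 gives -1 - μ ≤ -2μ.
  have hp := (hf.clm_comp (-ContinuousLinearMap.id ℝ (Euc d))).mono
    (g' := fun i => timeScale i ^ (-2 * μ)) zero_le_one fun i _ => by
      rw [one_mul]; exact rpow_timeScale_le _ (by linarith)
  refine ((hq.clm_comp (ContinuousLinearMap.inl ℝ (Euc d) (Euc d))).add
    (hp.clm_comp (ContinuousLinearMap.inr ℝ (Euc d) (Euc d)))).congr fun i w => ?_
  simp [modifiedField]

end Bounds

/-! ### The metric as an operator, and ellipticity. -/

section MatrixUnits

variable {d : ℕ}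

/-- The matrix units, acting on `ℝ^d`. -/
def matrixUnit (m n : Fin d) : Euc d →L[ℝ] Euc d :=
  (EuclideanSpace.proj n : Euc d →L[ℝ] ℝ).smulRight (EuclideanSpace.single m (1 : ℝ))

/-- The deviation `a(x) - 1` of the metric from the flat one, as an operator. -/
def metricDeviation (a : Euc d → Matrix (Fin d) (Fin d) ℝ) (x : Euc d) : Euc d →L[ℝ] Euc d :=
  ∑ m, ∑ n, (a x m n - (1 : Matrix (Fin d) (Fin d) ℝ) m n) • matrixUnit m n

theorem inner_metricDeviation (a : Euc d → Matrix (Fin d) (Fin d) ℝ) (x ξ η : Euc d) :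
    inner ℝ ξ (metricDeviation a x η) =
      ∑ m, ∑ n, (a x m n - (1 : Matrix (Fin d) (Fin d) ℝ) m n) * ξ m * η n := by
  have h : metricDeviation a x η = ∑ m, ∑ n, (a x m n - (1 : Matrix (Fin d) (Fin d) ℝ) m n) •
      (η n • EuclideanSpace.single m (1 : ℝ)) := by
    simp [metricDeviation, matrixUnit]
  rw [h]
  simp only [inner_sum, inner_smul_right, EuclideanSpace.inner_single_right]
  refine Finset.sum_congr rfl fun m _ => Finset.sum_congr rfl fun n _ => ?_
  simp
  ring

theorem kineticEnergy_eq (a : Euc d → Matrix (Fin d) (Fin d) ℝ) (x ξ : Euc d) :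
    kineticEnergy a x ξ = (1 / 2 : ℝ) * (‖ξ‖ ^ 2 + inner ℝ ξ (metricDeviation a x ξ)) := by
  rw [inner_metricDeviation, kineticEnergy, EuclideanSpace.real_norm_sq_eq]
  congr 1
  have : ∀ m, ∑ n, (a x m n - (1 : Matrix (Fin d) (Fin d) ℝ) m n) * ξ m * ξ n =
      ∑ n, a x m n * ξ m * ξ n - ξ m ^ 2 := fun m => by
    simp only [sub_mul, Finset.sum_sub_distrib, Matrix.one_apply]
    simp
    ring
  simp only [this, Finset.sum_sub_distrib]
  ring

theorem metricDeviation_symm {a : Euc d → Matrix (Fin d) (Fin d) ℝ} (ha : ∀ x, (a x).PosDef)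
    (x ξ η : Euc d) : inner ℝ ξ (metricDeviation a x η) = inner ℝ η (metricDeviation a x ξ) := by
  rw [inner_metricDeviation, inner_metricDeviation, Finset.sum_comm]
  refine Finset.sum_congr rfl fun m _ => Finset.sum_congr rfl fun n _ => ?_
  have h1 : a x n m = a x m n := by simpa using (ha x).1.apply m n
  have h2 : (1 : Matrix (Fin d) (Fin d) ℝ) n m = (1 : Matrix (Fin d) (Fin d) ℝ) m n := by
    simp only [Matrix.one_apply, eq_comm]
  rw [h1, h2]; ring

theorem isSymbol_metricDeviation {a : Euc d → Matrix (Fin d) (Fin d) ℝ} {μ : ℝ}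
    (h : ∀ m n : Fin d, HasSymbolBounds (-μ)
      (fun x => a x m n - (1 : Matrix (Fin d) (Fin d) ℝ) m n)) :
    IsSymbol (-μ) (metricDeviation a) :=
  IsSymbol.sum _ fun m _ => IsSymbol.sum _ fun n _ => (h m n).isSymbol.clm_comp
    ((ContinuousLinearMap.id ℝ ℝ).smulRight (matrixUnit m n))

theorem exists_pos_lower_bound {X : Type} [TopologicalSpace X] {K : Set X} (hK : IsCompact K)
    {f : X → ℝ} (hf : ContinuousOn f K) (hpos : ∀ x ∈ K, 0 < f x) :
    ∃ c : ℝ, 0 < c ∧ ∀ x ∈ K, c ≤ f x := by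
  rcases K.eq_empty_or_nonempty with rfl | hne
  · exact ⟨1, one_pos, fun x hx => hx.elim⟩
  · obtain ⟨p, hp, hmin⟩ := hK.exists_isMinOn hne hf
    exact ⟨f p, hpos p hp, fun x hx => hmin hx⟩

theorem energy_pos {a : Euc d → Matrix (Fin d) (Fin d) ℝ} (ha : ∀ x, (a x).PosDef) (x : Euc d)
    {ξ : Euc d} (hξ : ξ ≠ 0) : 0 < ‖ξ‖ ^ 2 + inner ℝ ξ (metricDeviation a x ξ) := by
  have h1 := (ha x).dotProduct_mulVec_pos (x := fun i => ξ i) (by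
    intro h0; apply hξ; ext i; exact congrFun h0 i)
  have h2 : star (fun i => ξ i) ⬝ᵥ (a x).mulVec (fun i => ξ i) = 2 * kineticEnergy a x ξ := by
    simp only [dotProduct, Matrix.mulVec, kineticEnergy, Finset.mul_sum]
    refine Finset.sum_congr rfl fun m _ => Finset.sum_congr rfl fun n _ => ?_
    simp
    ring
  rw [h2, kineticEnergy_eq] at h1
  linarith

theorem IsSymbol.exists_norm_le_half {G : Type} [NormedAddCommGroup G] [NormedSpace ℝ G] {μ : ℝ}
    (hμ : 0 < μ) {f : Euc d → G} (h : IsSymbol (-μ) f) :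
    ∃ R : ℝ, ∀ x : Euc d, R ≤ ‖x‖ → ‖f x‖ ≤ 1 / 2 := by
  obtain ⟨C, hC, hb⟩ := h.bound 0
  simp only [norm_iteratedFDeriv_zero, Nat.cast_zero, sub_zero] at hb
  have hlim : Tendsto (fun s : ℝ => C * s ^ (-μ)) atTop (𝓝 (C * 0)) :=
    (tendsto_rpow_neg_atTop hμ).const_mul C
  rw [mul_zero] at hlim
  obtain ⟨R, hR⟩ :=
    (hlim.eventually (gt_mem_nhds (by norm_num : (0 : ℝ) < 1 / 2))).exists_forall_of_atTop
  exact ⟨R, fun x hx => (hb x).trans (hR _ (hx.trans (norm_le_japaneseBracket x))).le⟩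

/-- Far out the deviation from the identity is at most 1/2 in norm. On the remaining ball,
compactness of ball times unit sphere and homogeneity in ξ give a positive constant. -/
theorem exists_ellipticity {a : Euc d → Matrix (Fin d) (Fin d) ℝ} {μ : ℝ} (hμ : 0 < μ)
    (h : IsSymbol (-μ) (metricDeviation a)) (ha : ∀ x, (a x).PosDef) :
    ∃ c : ℝ, 0 < c ∧ ∀ x ξ : Euc d, c * ‖ξ‖ ^ 2 ≤ ‖ξ‖ ^ 2 + inner ℝ ξ (metricDeviation a x ξ) := by
  obtain ⟨R, hR⟩ := h.exists_norm_le_half hμ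
  have hcont : Continuous fun p : Euc d × Euc d =>
      ‖p.2‖ ^ 2 + inner ℝ p.2 (metricDeviation a p.1 p.2) :=
    (continuous_snd.norm.pow 2).add (continuous_snd.inner
      ((h.smooth.continuous.comp continuous_fst).clm_apply continuous_snd))
  obtain ⟨c, hc, hcb⟩ := exists_pos_lower_bound ((isCompact_closedBall (0 : Euc d) R).prod
    (isCompact_sphere (0 : Euc d) 1)) hcont.continuousOn fun p hp => energy_pos ha p.1 fun h0 => by
      have := hp.2
      rw [h0] at this
      simp at this
  refine ⟨min c (1 / 2), lt_min hc (by norm_num), fun x ξ => ?_⟩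
  rcases eq_or_ne ξ 0 with rfl | hξ
  · simp
  have hn : 0 < ‖ξ‖ := norm_pos_iff.2 hξ
  rcases le_total R ‖x‖ with hx | hx
  · have h1 : |inner ℝ ξ (metricDeviation a x ξ)| ≤ 1 / 2 * ‖ξ‖ ^ 2 := by
      refine (abs_real_inner_le_norm _ _).trans ?_
      calc ‖ξ‖ * ‖metricDeviation a x ξ‖ ≤ ‖ξ‖ * (1 / 2 * ‖ξ‖) := by
            gcongr; exact (ContinuousLinearMap.le_of_opNorm_le _ (hR x hx) ξ)
        _ = _ := by ring
    have h2 := (abs_le.1 h1).1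
    calc min c (1 / 2) * ‖ξ‖ ^ 2 ≤ 1 / 2 * ‖ξ‖ ^ 2 := by gcongr; exact min_le_right _ _
      _ ≤ _ := by linarith
  · have h1 := hcb (x, ‖ξ‖⁻¹ • ξ) ⟨by simpa using hx, by simp [norm_smul, hn.ne']⟩
    dsimp only at h1
    have h2 : ‖‖ξ‖⁻¹ • ξ‖ ^ 2 + inner ℝ (‖ξ‖⁻¹ • ξ) (metricDeviation a x (‖ξ‖⁻¹ • ξ)) =
        (‖ξ‖ ^ 2)⁻¹ * (‖ξ‖ ^ 2 + inner ℝ ξ (metricDeviation a x ξ)) := by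
      rw [norm_smul, map_smul, inner_smul_left, inner_smul_right]
      simp
      field_simp
    rw [h2, ← div_eq_inv_mul, le_div_iff₀ (by positivity)] at h1
    exact (mul_le_mul_of_nonneg_right (min_le_left _ _) (by positivity)).trans h1

end MatrixUnits

/-! ### Hamilton's equations in vector form. -/

section HamiltonField

variable {d : ℕ}

/-- The Hamilton vector field of `½ |ξ|² + ½ ⟨ξ, r(x) ξ⟩ + V(x)`, where `g = ∇ V`. -/
def hamiltonField (r : Euc d → Euc d →L[ℝ] Euc d) (g : Euc d → Euc d) (z : Euc d × Euc d) :
    Euc d × Euc d :=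
  (z.2 + r z.1 z.2, -(kineticForce r z.1 z.2 + g z.1))

theorem contDiff_hamiltonField {r : Euc d → Euc d →L[ℝ] Euc d} {g : Euc d → Euc d}
    (hr : ContDiff ℝ ∞ r) (hg : ContDiff ℝ ∞ g) : ContDiff ℝ ∞ (hamiltonField r g) := by
  have h1 : ContDiff ℝ ∞ fun z : Euc d × Euc d => r z.1 z.2 :=
    (hr.comp contDiff_fst).clm_apply contDiff_snd
  have h2 := contDiff_kineticForce hr (contDiff_fst (E := Euc d) (F := Euc d))
    (contDiff_snd (E := Euc d) (F := Euc d))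
  have h3 : ContDiff ℝ ∞ fun z : Euc d × Euc d => g z.1 := hg.comp contDiff_fst
  unfold hamiltonField
  exact (contDiff_snd.add h1).prodMk (h2.add h3).neg

/-- The quadratic form `½ (|ξ|² + ⟨ξ, r(x) ξ⟩)`. -/
def energyForm (r : Euc d → Euc d →L[ℝ] Euc d) (x ξ : Euc d) : ℝ :=
  (1 / 2 : ℝ) * (‖ξ‖ ^ 2 + inner ℝ ξ (r x ξ))

/-- Symmetry of r(x) merges the two halves of the ξ-derivative of the quadratic form into r(x)ξ. -/
theorem hasFDerivAt_energyForm {r : Euc d → Euc d →L[ℝ] Euc d} (hr : ContDiff ℝ ∞ r)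
    (hsymm : ∀ x ξ η, inner ℝ ξ (r x η) = inner ℝ η (r x ξ)) (x ξ : Euc d) :
    HasFDerivAt (fun p : Euc d × Euc d => energyForm r p.1 p.2)
      ((innerSL ℝ (kineticForce r x ξ)).comp (ContinuousLinearMap.fst ℝ _ _) +
        (innerSL ℝ (ξ + r x ξ)).comp (ContinuousLinearMap.snd ℝ _ _)) (x, ξ) := by
  have hfst : HasFDerivAt (fun p : Euc d × Euc d => p.1) (ContinuousLinearMap.fst ℝ (Euc d) (Euc d))
    (x, ξ) := hasFDerivAt_fst
  have hsnd : HasFDerivAt (fun p : Euc d × Euc d => p.2) (ContinuousLinearMap.snd ℝ (Euc d) (Euc d))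
    (x, ξ) := hasFDerivAt_snd
  have h1 := ((hr.differentiable (by simp)) x).hasFDerivAt.comp (x, ξ) hfst
  have h2 := h1.clm_apply hsnd
  have h3 := hsnd.inner ℝ h2
  have h4 := hsnd.norm_sq
  have h5 := (h4.add h3).const_mul (1 / 2 : ℝ)
  refine h5.congr_fderiv ?_
  ext v
  · simp [inner_kineticForce]
  · have := hsymm x ξ v
    simp [this, real_inner_comm v (r x ξ)]
    ring

theorem hasGradientAt_of_hasFDerivAt {f : Euc d → ℝ} {v x : Euc d}
    (h : HasFDerivAt f (innerSL ℝ v) x) : ∇ f x = v := by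
  rw [gradient_eq_dualVec, h.fderiv]
  exact dualVec_toDual v

theorem hasFDerivAt_of_contDiff {V : Euc d → ℝ} (hV : ContDiff ℝ ∞ V) (x : Euc d) :
    HasFDerivAt V (innerSL ℝ (∇ V x)) x := by
  have h := ((hV.differentiable (by simp)) x).hasFDerivAt
  refine h.congr_fderiv ?_
  ext v
  rw [gradient_eq_dualVec, innerSL_apply_apply, inner_dualVec]

theorem contDiff_gradient {V : Euc d → ℝ} (hV : ContDiff ℝ ∞ V) : ContDiff ℝ ∞ (∇ V) := by
  have h : ∇ V = fun x => dualVec d (fderiv ℝ V x) := funext (gradient_eq_dualVec V)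
  rw [h]
  exact (dualVec d).contDiff.comp (hV.fderiv_right (by simp))

theorem IsSymbol.gradient {m : ℝ} {V : Euc d → ℝ} (hV : IsSymbol m V) : IsSymbol (m - 1) (∇ V) := by
  have h : ∇ V = fun x => dualVec d (fderiv ℝ V x) := funext (gradient_eq_dualVec V)
  rw [h]
  exact hV.derivative.clm_comp (dualVec d)

variable {a : Euc d → Matrix (Fin d) (Fin d) ℝ}

theorem hamiltonian_eq (V : Euc d → ℝ) (x ξ : Euc d) :
    hamiltonian a V x ξ = energyForm (metricDeviation a) x ξ + V x := by
  rw [hamiltonian, kineticEnergy_eq]; rfl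

theorem isTrajectory_hamiltonian_iff (ha : ∀ x, (a x).PosDef)
    (hr : ContDiff ℝ ∞ (metricDeviation a)) {V : Euc d → ℝ} (hV : ContDiff ℝ ∞ V)
    {z : Euc d × Euc d} {γ : ℝ → Euc d × Euc d} :
    IsTrajectory (hamiltonian a V) z γ ↔
      γ 0 = z ∧ ∀ t, HasDerivAt γ (hamiltonField (metricDeviation a) (∇ V) (γ t)) t := by
  have key : ∀ x ξ : Euc d, ∇ (fun ξ => hamiltonian a V x ξ) ξ = ξ + metricDeviation a x ξ ∧
      ∇ (fun x => hamiltonian a V x ξ) x = kineticForce (metricDeviation a) x ξ + ∇ V x := by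
    intro x ξ
    have h := hasFDerivAt_energyForm hr (metricDeviation_symm ha) x ξ
    have e : hamiltonian a V = fun x ξ => energyForm (metricDeviation a) x ξ + V x :=
      funext fun x => funext fun ξ => hamiltonian_eq V x ξ
    constructor
    · refine hasGradientAt_of_hasFDerivAt ?_
      rw [e]
      have h1 := (h.comp ξ (hasFDerivAt_prodMk_right x ξ)).add_const (V x)
      refine h1.congr_fderiv ?_
      ext v; simp
    · refine hasGradientAt_of_hasFDerivAt ?_
      rw [e]
      have h1 := (h.comp x (hasFDerivAt_prodMk_left x ξ)).add (hasFDerivAt_of_contDiff hV x)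
      refine h1.congr_fderiv ?_
      ext v; simp
  unfold IsTrajectory
  refine and_congr_right fun _ => forall_congr' fun t => ?_
  rw [(key _ _).1, (key _ _).2]
  rfl

theorem kineticEnergy_eq_hamiltonian : kineticEnergy a = hamiltonian a fun _ => 0 := by
  funext x ξ; simp [hamiltonian]

end HamiltonField

/-! ### The gradient of the Dollard modifier and its scaling. -/

section Dollard

variable {d : ℕ}

/-- Substitute σ ↦ ρσ: the kinetic terms are quadratic in ξ and the potential term collects ρ⁻² =
h². Only squares occur in the hypothesis, so negative ρ is allowed; this gives time reversal. -/
theorem modifierCorrection_smul (r : Euc d → Euc d →L[ℝ] Euc d) (gL : Euc d → Euc d) {ρ h : ℝ}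
    (hρ : ρ ^ 2 * h ^ 2 = 1) (t : ℝ) (ξ : Euc d) :
    modifierCorrection r gL 1 t (ρ • ξ) = modifierCorrection r gL h (ρ * t) ξ := by
  have h1 : ∀ σ, modifierDensity r gL 1 σ (ρ • ξ) = ρ • modifierDensity r gL h (σ * ρ) ξ := by
    intro σ
    have h2 : kineticForce r (σ • ρ • ξ) (ρ • ξ) = ρ ^ 2 • kineticForce r (σ • ρ • ξ) ξ := by
      simp [kineticForce, smul_smul, pow_two]
    unfold modifierDensity
    rw [h2, smul_smul, map_smul, smul_add, smul_add, smul_add, smul_add, smul_smul, smul_smul,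
      smul_smul, smul_smul, smul_smul]
    congr 2
    · congr 1; ring
    · congr 1
      calc σ * 1 ^ 2 = σ * (ρ ^ 2 * h ^ 2) := by rw [hρ]; ring
        _ = _ := by ring
  unfold modifierCorrection
  simp_rw [h1]
  rw [intervalIntegral.integral_smul,
    intervalIntegral.smul_integral_comp_mul_right (fun σ => modifierDensity r gL h σ ξ)]
  rw [zero_mul, mul_comm t]

variable {a : Euc d → Matrix (Fin d) (Fin d) ℝ}

theorem contDiff_hamiltonian_ray (hr : ContDiff ℝ ∞ (metricDeviation a)) {V : Euc d → ℝ}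
    (hV : ContDiff ℝ ∞ V) :
    ContDiff ℝ ∞ (Function.uncurry fun (s : ℝ) (ξ : Euc d) => hamiltonian a V (s • ξ) ξ) := by
  have e : (Function.uncurry fun (s : ℝ) (ξ : Euc d) => hamiltonian a V (s • ξ) ξ) =
      fun p : ℝ × Euc d =>
        (1 / 2 : ℝ) * (‖p.2‖ ^ 2 + inner ℝ p.2 (metricDeviation a (p.1 • p.2) p.2)) +
        V (p.1 • p.2) := funext fun p => hamiltonian_eq V _ _
  rw [e]
  have hx : ContDiff ℝ ∞ fun p : ℝ × Euc d => p.1 • p.2 := contDiff_fst.smul contDiff_snd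
  have h1 : ContDiff ℝ ∞ fun p : ℝ × Euc d => metricDeviation a (p.1 • p.2) p.2 :=
    (hr.comp hx).clm_apply contDiff_snd
  exact (contDiff_const.mul ((contDiff_snd.norm_sq ℝ).add (contDiff_snd.inner ℝ h1))).add
    (hV.comp hx)

theorem gradient_hamiltonian_ray (ha : ∀ x, (a x).PosDef)
    (hr : ContDiff ℝ ∞ (metricDeviation a)) {V : Euc d → ℝ} (hV : ContDiff ℝ ∞ V) (s : ℝ)
    (ξ : Euc d) : ∇ (fun ξ => hamiltonian a V (s • ξ) ξ) ξ =
      ξ + modifierDensity (metricDeviation a) (∇ V) 1 s ξ := by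
  refine hasGradientAt_of_hasFDerivAt ?_
  have hsm : HasFDerivAt (fun ξ : Euc d => s • ξ) (s • ContinuousLinearMap.id ℝ (Euc d)) ξ :=
    (hasFDerivAt_id ξ).const_smul s
  have hp : HasFDerivAt (fun ξ : Euc d => (s • ξ, ξ)) _ ξ := hsm.prodMk (hasFDerivAt_id ξ)
  have h2 := HasFDerivAt.comp (f := fun ξ : Euc d => (s • ξ, ξ)) ξ
    (g := fun p : Euc d × Euc d => energyForm (metricDeviation a) p.1 p.2)
    (hasFDerivAt_energyForm hr (metricDeviation_symm ha) (s • ξ) ξ) hp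
  have h3 := (hasFDerivAt_of_contDiff hV (s • ξ)).comp ξ hsm
  have e : (fun ξ => hamiltonian a V (s • ξ) ξ) =
      fun ξ => energyForm (metricDeviation a) (s • ξ) ξ + V (s • ξ) :=
    funext fun ξ => hamiltonian_eq V _ _
  rw [e]
  refine (h2.add h3).congr_fderiv ?_
  ext v
  simp only [modifierDensity, add_apply, ContinuousLinearMap.comp_apply,
    ContinuousLinearMap.prod_apply, ContinuousLinearMap.coe_fst', ContinuousLinearMap.coe_snd',
    innerSL_apply_apply, inner_add_left, inner_smul_left, inner_smul_right, smul_apply,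
    ContinuousLinearMap.id_apply, one_pow, one_smul]
  simp
  ring

theorem fderiv_dollardModifier {H : Euc d → Euc d → ℝ}
    (hH : ContDiff ℝ ∞ (Function.uncurry fun (s : ℝ) (ξ : Euc d) => H (s • ξ) ξ)) (t : ℝ)
    (ξ : Euc d) : fderiv ℝ (dollardModifier H t) ξ =
      ∫ s in (0 : ℝ)..t, fderiv ℝ (fun ξ => H (s • ξ) ξ) ξ :=
  HasFDerivAt.fderiv
    (hasFDerivAt_parametric_intervalIntegral (f := fun (s : ℝ) (ξ : Euc d) => H (s • ξ) ξ) hH 0 t ξ)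

theorem gradient_dollardModifier_eq_integral {H : Euc d → Euc d → ℝ}
    (hH : ContDiff ℝ ∞ (Function.uncurry fun (s : ℝ) (ξ : Euc d) => H (s • ξ) ξ)) (t : ℝ)
    (ξ : Euc d) : ∇ (dollardModifier H t) ξ =
      ∫ s in (0 : ℝ)..t, ∇ (fun ξ => H (s • ξ) ξ) ξ := by
  have hc : Continuous fun s : ℝ => fderiv ℝ (fun ξ => H (s • ξ) ξ) ξ :=
    (contDiff_uncurry_fderiv (f := fun (s : ℝ) (ξ : Euc d) => H (s • ξ) ξ) hH).continuous.comp
      (Continuous.prodMk continuous_id continuous_const)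
  simp_rw [gradient_eq_dualVec]
  rw [fderiv_dollardModifier hH, ← ContinuousLinearMap.intervalIntegral_comp_comm _
    (hc.intervalIntegrable _ _)]

theorem gradient_dollardModifier (ha : ∀ x, (a x).PosDef)
    (hr : ContDiff ℝ ∞ (metricDeviation a)) {V : Euc d → ℝ} (hV : ContDiff ℝ ∞ V) (t : ℝ)
    (ξ : Euc d) : ∇ (dollardModifier (hamiltonian a V) t) ξ =
      t • ξ + modifierCorrection (metricDeviation a) (∇ V) 1 t ξ := by
  have hc : Continuous fun s : ℝ => modifierDensity (metricDeviation a) (∇ V) 1 s ξ :=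
    (contDiff_modifierDensity hr (contDiff_gradient hV) contDiff_const contDiff_id
      contDiff_const).continuous
  rw [gradient_dollardModifier_eq_integral (contDiff_hamiltonian_ray hr hV), modifierCorrection]
  simp_rw [gradient_hamiltonian_ray ha hr hV]
  rw [intervalIntegral.integral_add (continuous_const.intervalIntegrable _ _)
    (hc.intervalIntegrable _ _), intervalIntegral.integral_const, sub_zero]

theorem gradient_dollardModifier_smul (ha : ∀ x, (a x).PosDef)
    (hr : ContDiff ℝ ∞ (metricDeviation a)) {V : Euc d → ℝ} (hV : ContDiff ℝ ∞ V) {ρ h : ℝ}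
    (hρ : ρ ^ 2 * h ^ 2 = 1) (t : ℝ) (ξ : Euc d) :
    ∇ (dollardModifier (hamiltonian a V) t) (ρ • ξ) =
      (ρ * t) • ξ + modifierCorrection (metricDeviation a) (∇ V) h (ρ * t) ξ := by
  rw [gradient_dollardModifier ha hr hV, modifierCorrection_smul _ _ hρ, smul_smul, mul_comm t]

end Dollard

/-! ### Change between original and modified coordinates. -/

section Transform

variable {d : ℕ} {r : Euc d → Euc d →L[ℝ] Euc d} {gL gS : Euc d → Euc d}

theorem hasDerivWithinAt_modifierCorrection (hr : ContDiff ℝ ∞ r) (hgL : ContDiff ℝ ∞ gL) (h : ℝ)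
    {ξ : ℝ → Euc d} {ξ' : Euc d} {S : Set ℝ} {s : ℝ} (hξ : HasDerivWithinAt ξ ξ' S s) :
    HasDerivWithinAt (fun s => modifierCorrection r gL h s (ξ s))
      (modifierDensity r gL h s (ξ s) + fderiv ℝ (modifierCorrection r gL h s) (ξ s) ξ') S s := by
  have hsm : ContDiff ℝ ∞ fun p : ℝ × Euc d => modifierCorrection r gL h p.1 p.2 :=
    contDiff_modifierCorrection hr hgL contDiff_const contDiff_fst contDiff_snd
  have hD := ((hsm.differentiable (by simp)) (s, ξ s)).hasFDerivAt
  have h1 : HasDerivAt (fun s' => modifierCorrection r gL h s' (ξ s))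
      (modifierDensity r gL h s (ξ s)) s := by
    have hc : Continuous fun σ => modifierDensity r gL h σ (ξ s) :=
      (contDiff_modifierDensity hr hgL contDiff_const contDiff_id contDiff_const).continuous
    exact hc.integral_hasStrictDerivAt 0 s |>.hasDerivAt
  have h2 := (hD.comp (ξ s) (hasFDerivAt_prodMk_right s (ξ s))).fderiv
  have h3 := hD.comp_hasDerivAt s
    ((hasDerivAt_id s).prodMk (hasDerivAt_const s (ξ s)))
  -- The time part of the joint derivative is the density, by uniqueness of derivatives; the total
  -- derivative can then be split.
  have h4 := h1.unique h3
  have h5 := hD.comp_hasDerivWithinAt s ((hasDerivWithinAt_id s S).prodMk hξ)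
  refine h5.congr_deriv ?_
  have h6 : fderiv ℝ (modifierCorrection r gL h s) (ξ s) ξ' =
      fderiv ℝ (fun p : ℝ × Euc d => modifierCorrection r gL h p.1 p.2) (s, ξ s) (0, ξ') := by
    have h7 : fderiv ℝ (modifierCorrection r gL h s) (ξ s) = _ := h2
    rw [h7]; simp
  rw [h6, h4, ← map_add]
  simp

/-- The Hamiltonian vector field with the potential scaled by `h²`. -/
def scaledField (r : Euc d → Euc d →L[ℝ] Euc d) (gL gS : Euc d → Euc d) (h : ℝ) :
    Euc d × Euc d → Euc d × Euc d := hamiltonField r fun x => h ^ 2 • (gL x + gS x)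

theorem scaledField_eq (h : ℝ) (z : Euc d × Euc d) :
    scaledField r gL gS h z = (z.2 + r z.1 z.2, -totalForce r gL gS h z.1 z.2) := by
  simp [scaledField, hamiltonField, totalForce, add_assoc]

/-- The coordinates `(x - ∂_ξ Φ_h(s, ξ), ξ)`. -/
def modifiedCoordinates (r : Euc d → Euc d →L[ℝ] Euc d) (gL : Euc d → Euc d) (h s : ℝ)
    (z : Euc d × Euc d) : Euc d × Euc d :=
  (z.1 - s • z.2 - modifierCorrection r gL h s z.2, z.2)

theorem modifiedPosition_modifiedCoordinates (h s : ℝ) (z : Euc d × Euc d) :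
    modifiedPosition r gL h s (modifiedCoordinates r gL h s z) = z.1 := by
  simp only [modifiedPosition, modifiedCoordinates]; abel

theorem modifiedCoordinates_modifiedPosition (h s : ℝ) (w : Euc d × Euc d) :
    modifiedCoordinates r gL h s (modifiedPosition r gL h s w, w.2) = w := by
  ext1
  · simp only [modifiedPosition, modifiedCoordinates]; abel
  · rfl

theorem modifierCorrection_zero (h : ℝ) (ξ : Euc d) : modifierCorrection r gL h 0 ξ = 0 := by
  simp [modifierCorrection]

/-- In q' the free velocity cancels, and the time derivative of the correction subtracts from r(x)ξ
and s times the force their values at sξ, except for the short range part. The momentum derivative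
of the correction contributes the last term of `modifiedField`. -/
theorem hasDerivWithinAt_modifiedCoordinates (hr : ContDiff ℝ ∞ r) (hgL : ContDiff ℝ ∞ gL) (h : ℝ)
    {z : ℝ → Euc d × Euc d} {S : Set ℝ} {s : ℝ}
    (hz : HasDerivWithinAt z (scaledField r gL gS h (z s)) S s) :
    HasDerivWithinAt (fun s => modifiedCoordinates r gL h s (z s))
      (modifiedField r gL gS h s (modifiedCoordinates r gL h s (z s))) S s := by
  rw [scaledField_eq] at hz
  have hx : HasDerivWithinAt (fun s => (z s).1) _ S s := hz.fst
  have hξ : HasDerivWithinAt (fun s => (z s).2) _ S s := hz.snd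
  have h1 := ((hx.sub ((hasDerivWithinAt_id s S).smul hξ)).sub
    (hasDerivWithinAt_modifierCorrection hr hgL h hξ)).prodMk hξ
  refine h1.congr_deriv ?_
  rw [modifiedField, modifiedPosition_modifiedCoordinates]
  ext1
  · simp [modifiedCoordinates, modifierDensity, totalForce, smul_sub, smul_add, smul_smul]
    abel
  · rfl

theorem hasDerivWithinAt_modifiedPosition (hr : ContDiff ℝ ∞ r) (hgL : ContDiff ℝ ∞ gL) (h : ℝ)
    {w : ℝ → Euc d × Euc d} {S : Set ℝ} {s : ℝ}
    (hw : HasDerivWithinAt w (modifiedField r gL gS h s (w s)) S s) :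
    HasDerivWithinAt (fun s => (modifiedPosition r gL h s (w s), (w s).2))
      (scaledField r gL gS h (modifiedPosition r gL h s (w s), (w s).2)) S s := by
  have hx : HasDerivWithinAt (fun s => (w s).1) _ S s := hw.fst
  have hξ : HasDerivWithinAt (fun s => (w s).2) _ S s := hw.snd
  have h1 := ((hx.add ((hasDerivWithinAt_id s S).smul hξ)).add
    (hasDerivWithinAt_modifierCorrection hr hgL h hξ)).prodMk hξ
  refine h1.congr_deriv ?_
  rw [scaledField_eq]
  ext1
  · simp [modifiedField, modifierDensity, totalForce, smul_sub, smul_add, smul_smul]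
    abel
  · rfl

/-- Scaling of time and momentum. -/
theorem hasDerivAt_scaled {g : Euc d → Euc d} {γ : ℝ → Euc d × Euc d}
    (hγ : ∀ t, HasDerivAt γ (hamiltonField r g (γ t)) t) {ρ h : ℝ} (hh : h ^ 2 = (ρ⁻¹) ^ 2)
    (s : ℝ) : HasDerivAt (fun s => ((γ (ρ⁻¹ * s)).1, ρ⁻¹ • (γ (ρ⁻¹ * s)).2))
      (hamiltonField r (fun x => h ^ 2 • g x) ((γ (ρ⁻¹ * s)).1, ρ⁻¹ • (γ (ρ⁻¹ * s)).2)) s := by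
  have h1 := (hγ (ρ⁻¹ * s)).scomp s ((hasDerivAt_id s).const_mul ρ⁻¹)
  have hx : HasDerivAt (fun s => (γ (ρ⁻¹ * s)).1) _ s := h1.fst
  have hξ : HasDerivAt (fun s => (γ (ρ⁻¹ * s)).2) _ s := h1.snd
  refine (hx.prodMk (hξ.const_smul ρ⁻¹)).congr_deriv ?_
  ext1
  · simp [hamiltonField]
  · simp [hamiltonField, kineticForce, smul_smul, hh, pow_two]

end Transform

/-! ### Uniqueness for autonomous smooth fields. -/

section Uniqueness

/-- A smooth field is Lipschitz on the compact union of the two curves, which is all that Gronwall's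
argument needs. -/
theorem eqOn_of_hasDerivWithinAt {E : Type} [NormedAddCommGroup E] [NormedSpace ℝ E]
    [FiniteDimensional ℝ E] {v : E → E} (hv : ContDiff ℝ ∞ v) {f g : ℝ → E} {T : ℝ}
    (hf : ∀ t ∈ Icc 0 T, HasDerivWithinAt f (v (f t)) (Icc 0 T) t)
    (hg : ∀ t ∈ Icc 0 T, HasDerivWithinAt g (v (g t)) (Icc 0 T) t) (h0 : f 0 = g 0) :
    EqOn f g (Icc 0 T) := by
  have hfc : ContinuousOn f (Icc 0 T) := fun t ht => (hf t ht).continuousWithinAt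
  have hgc : ContinuousOn g (Icc 0 T) := fun t ht => (hg t ht).continuousWithinAt
  set K := f '' Icc 0 T ∪ g '' Icc 0 T
  have hK : IsCompact K := (isCompact_Icc.image_of_continuousOn hfc).union
    (isCompact_Icc.image_of_continuousOn hgc)
  have hL : LocallyLipschitz v := (hv.of_le (by simp)).locallyLipschitz
  obtain ⟨C, hC⟩ := LocallyLipschitzOn.exists_lipschitzOnWith_of_compact hK hL.locallyLipschitzOn
  have hIci : ∀ {f : ℝ → E}, (∀ t ∈ Icc 0 T, HasDerivWithinAt f (v (f t)) (Icc 0 T) t) →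
      ∀ t ∈ Ico 0 T, HasDerivWithinAt f (v (f t)) (Ici t) t := fun hf t ht =>
    (hf t (Ico_subset_Icc_self ht)).mono_of_mem_nhdsWithin
      (mem_of_superset (Icc_mem_nhdsGE ht.2) (Icc_subset_Icc_left ht.1))
  exact ODE_solution_unique_of_mem_Icc_right (v := fun _ => v) (s := fun _ => K)
    (fun t _ => hC) hfc (hIci hf) (fun t ht => Or.inl (mem_image_of_mem f (Ico_subset_Icc_self ht)))
    hgc (hIci hg) (fun t ht => Or.inr (mem_image_of_mem g (Ico_subset_Icc_self ht))) h0

theorem eqOn_of_hasDerivAt {E : Type} [NormedAddCommGroup E] [NormedSpace ℝ E]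
    [FiniteDimensional ℝ E] {v : E → E} (hv : ContDiff ℝ ∞ v) {f g : ℝ → E} {T : ℝ}
    (hf : ∀ t ∈ Ioo (-T) T, HasDerivAt f (v (f t)) t)
    (hg : ∀ t ∈ Ioo (-T) T, HasDerivAt g (v (g t)) t) (h0 : f 0 = g 0) : EqOn f g (Ioo (-T) T) := by
  have key : ∀ {v : E → E}, ContDiff ℝ ∞ v → ∀ {f g : ℝ → E},
      (∀ t ∈ Ioo (-T) T, HasDerivAt f (v (f t)) t) →
      (∀ t ∈ Ioo (-T) T, HasDerivAt g (v (g t)) t) → f 0 = g 0 → ∀ t, 0 ≤ t → t < T → f t = g t :=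
    fun hv f g hf hg h0 t ht hT => eqOn_of_hasDerivWithinAt (T := t) hv
      (fun s hs => (hf s ⟨by linarith [hs.1], hs.2.trans_lt hT⟩).hasDerivWithinAt)
      (fun s hs => (hg s ⟨by linarith [hs.1], hs.2.trans_lt hT⟩).hasDerivWithinAt) h0 ⟨ht, le_rfl⟩
  intro t ht
  rcases le_total 0 t with h | h
  · exact key hv hf hg h0 t h ht.2
  -- Negative times are positive times for the reversed field.
  · have hn : ∀ {f : ℝ → E}, (∀ t ∈ Ioo (-T) T, HasDerivAt f (v (f t)) t) →
        ∀ t ∈ Ioo (-T) T, HasDerivAt (fun s => f (-s)) (-v (f (-t))) t := fun hf t ht => by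
      simpa [Function.comp_def] using
        (hf (-t) ⟨by linarith [ht.2], by linarith [ht.1]⟩).scomp t (hasDerivAt_neg t)
    have := key (v := fun x => -v x) hv.neg (hn hf) (hn hg) (by simpa using h0) (-t) (by linarith)
      (by linarith [ht.1])
    simpa using this

theorem eq_of_hasDerivAt {E : Type} [NormedAddCommGroup E] [NormedSpace ℝ E]
    [FiniteDimensional ℝ E] {v : E → E} (hv : ContDiff ℝ ∞ v) {f g : ℝ → E}
    (hf : ∀ t, HasDerivAt f (v (f t)) t) (hg : ∀ t, HasDerivAt g (v (g t)) t) (h0 : f 0 = g 0) :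
    f = g := funext fun t =>
  eqOn_of_hasDerivAt (T := |t| + 1) hv (fun s _ => hf s) (fun s _ => hg s) h0
    (abs_lt.1 (lt_add_one |t|))

end Uniqueness

/-! ### Global existence from a priori bounds. -/

section GlobalExistence

variable {E : Type} [NormedAddCommGroup E] [NormedSpace ℝ E] [FiniteDimensional ℝ E]

/-- Solutions of a compactly supported smooth vector field exist on bounded intervals. -/
theorem exists_solution_of_hasCompactSupport {v : E → E} (hv : ContDiff ℝ ∞ v)
    (hc : HasCompactSupport v) (z : E) {T : ℝ} (hT : 0 ≤ T) :
    ∃ γ : ℝ → E, γ 0 = z ∧ ∀ t ∈ Icc (-T) T, HasDerivWithinAt γ (v (γ t)) (Icc (-T) T) t := by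
  obtain ⟨K, hK⟩ := hv.lipschitzWith_of_hasCompactSupport hc (by simp)
  obtain ⟨C, hC⟩ := hc.exists_bound_of_continuous hv.continuous
  have hC0 : 0 ≤ C := (norm_nonneg _).trans (hC 0)
  have hP : IsPicardLindelof (fun _ => v) (⟨0, by constructor <;> linarith⟩ : Icc (-T) T) z
      (⟨C, hC0⟩ * ⟨T, hT⟩) 0 ⟨C, hC0⟩ K := by
    refine IsPicardLindelof.of_time_independent (fun x _ => hC x) hK.lipschitzOnWith ?_
    simp only [sub_zero, zero_sub, neg_neg, max_self, NNReal.coe_zero]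
    exact le_rfl
  exact hP.exists_eq_forall_mem_Icc_hasDerivWithinAt₀

/-- A smooth vector field whose truncations satisfy an a priori bound has global solutions. -/
theorem exists_global_solution {v : E → E} (hv : ContDiff ℝ ∞ v) (z : E)
    (hb : ∀ T : ℝ, 0 ≤ T → ∃ R : ℝ, ∀ (χ : E → ℝ), (∀ x, |χ x| ≤ 1) → ∀ γ : ℝ → E, γ 0 = z →
      (∀ t ∈ Icc 0 T, HasDerivWithinAt γ (χ (γ t) • v (γ t)) (Icc 0 T) t) →
      ∀ t ∈ Icc 0 T, ‖γ t‖ ≤ R) :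
    ∃ γ : ℝ → E, γ 0 = z ∧ ∀ t, HasDerivAt γ (v (γ t)) t := by
  have hloc : ∀ T : ℝ, ∃ γ : ℝ → E, 0 ≤ T → γ 0 = z ∧ ∀ t ∈ Ioo (-T) T, HasDerivAt γ (v (γ t)) t := by
    intro T
    by_cases hT : 0 ≤ T
    swap
    · exact ⟨0, fun h => absurd h hT⟩
    obtain ⟨R, hR⟩ := hb T hT
    obtain ⟨χ, hχ, hχc, -, hχ1, hχI⟩ := exists_contDiff_cutoff (isCompact_closedBall (0 : E) R)
      isOpen_univ (subset_univ _)
    obtain ⟨γ, hγ0, hγ⟩ := exists_solution_of_hasCompactSupport (v := fun x => χ x • v x)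
      (hχ.smul hv) (hχc.smul_right) z hT
    have hpos : ∀ t ∈ Icc 0 T, ‖γ t‖ ≤ R :=
      hR χ (fun x => abs_le.2 ⟨by linarith [(hχI x).1], (hχI x).2⟩) γ hγ0 fun t ht =>
        (hγ t ⟨by linarith [ht.1], ht.2⟩).mono (Icc_subset_Icc_left (by linarith))
    -- Backward motion is forward motion with the cutoff -χ; the a priori bound is assumed for
    -- multipliers of either sign for this reason.
    have hneg : ∀ t ∈ Icc 0 T, ‖γ (-t)‖ ≤ R := by
      refine hR (fun x => -χ x) (fun x => ?_) (fun t => γ (-t)) (by simpa using hγ0) fun t ht => ?_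
      · rw [abs_neg]; exact abs_le.2 ⟨by linarith [(hχI x).1], (hχI x).2⟩
      · have h1 := (hγ (-t) ⟨by linarith [ht.2], by linarith [ht.1]⟩).scomp t
          ((hasDerivAt_neg t).hasDerivWithinAt (s := Icc 0 T)) (fun s hs => by
            constructor <;> simp only [mem_Icc] at hs ⊢ <;> linarith)
        simpa [Function.comp_def] using h1
    refine ⟨γ, fun _ => ⟨hγ0, fun t ht => ?_⟩⟩
    have hmem : γ t ∈ Metric.closedBall (0 : E) R := by
      rw [mem_closedBall_zero_iff]
      rcases le_total 0 t with h | h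
      · exact hpos t ⟨h, ht.2.le⟩
      · simpa using hneg (-t) ⟨by linarith, by linarith [ht.1]⟩
    have h1 : χ (γ t) = 1 := (eventually_nhdsSet_iff_forall.1 hχ1 _ hmem).self_of_nhds
    have h2 := (hγ t (Ioo_subset_Icc_self ht)).hasDerivAt (Icc_mem_nhds ht.1 ht.2)
    rwa [h1, one_smul] at h2
  choose Γ hΓ using hloc
  -- The solutions on growing intervals agree by uniqueness, so near t the glued curve coincides
  -- with the solution on the interval of half-length |t| + 2.
  refine ⟨fun t => Γ (|t| + 1) t, ?_, fun t => ?_⟩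
  · exact (hΓ _ (by positivity)).1
  · have hT : (0 : ℝ) ≤ |t| + 2 := by positivity
    have h1 := (hΓ (|t| + 2) hT).2 t (abs_lt.1 (by linarith))
    have h2 : ∀ s : ℝ, |s| < |t| + 1 → Γ (|s| + 1) s = Γ (|t| + 2) s := fun s hs =>
      eqOn_of_hasDerivAt hv (hΓ (|s| + 1) (by positivity)).2
        (fun u hu => (hΓ (|t| + 2) hT).2 u ⟨by linarith [hu.1], by linarith [hu.2]⟩)
        ((hΓ _ (by positivity)).1.trans (hΓ _ hT).1.symm) (abs_lt.1 (lt_add_one |s|))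
    have h3 : (fun s => Γ (|s| + 1) s) =ᶠ[𝓝 t] Γ (|t| + 2) := by
      filter_upwards [continuous_abs.continuousAt.eventually_lt continuousAt_const
        (lt_add_one |t|)] with s hs using h2 s hs
    have h4 := h1.congr_of_eventuallyEq h3
    rwa [← h2 t (lt_add_one |t|)] at h4

end GlobalExistence

/-! ### Energy conservation and global trajectories. -/

section Energy

variable {d : ℕ} {r : Euc d → Euc d →L[ℝ] Euc d} {V : Euc d → ℝ}

/-- The Hamilton field is tangent to the level sets of the energy, and so is any scalar multiple of
it. Hence the energy is also conserved by the truncated fields. -/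
theorem energy_eq_of_hasDerivWithinAt (hr : ContDiff ℝ ∞ r)
    (hsymm : ∀ x ξ η, inner ℝ ξ (r x η) = inner ℝ η (r x ξ)) (hV : ContDiff ℝ ∞ V) {T : ℝ}
    {c : ℝ → ℝ} {γ : ℝ → Euc d × Euc d}
    (hγ : ∀ t ∈ Icc 0 T, HasDerivWithinAt γ (c t • hamiltonField r (∇ V) (γ t)) (Icc 0 T) t) :
    ∀ t ∈ Icc 0 T, energyForm r (γ t).1 (γ t).2 + V (γ t).1 =
      energyForm r (γ 0).1 (γ 0).2 + V (γ 0).1 := by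
  have hD : ∀ t ∈ Icc 0 T, HasDerivWithinAt
      (fun t => energyForm r (γ t).1 (γ t).2 + V (γ t).1) 0 (Icc 0 T) t := by
    intro t ht
    have h1 := HasFDerivAt.comp_hasDerivWithinAt
      (l := fun p : Euc d × Euc d => energyForm r p.1 p.2) t
      (hasFDerivAt_energyForm hr hsymm (γ t).1 (γ t).2) (hγ t ht)
    have hx : HasDerivWithinAt (fun s => (γ s).1) _ (Icc 0 T) t := (hγ t ht).fst
    have h2 := (hasFDerivAt_of_contDiff hV (γ t).1).comp_hasDerivWithinAt t hx
    refine (h1.add h2).congr_deriv ?_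
    simp [hamiltonField, inner_smul_right, inner_add_right, inner_neg_right,
      real_inner_comm]
    ring
  refine constant_of_has_deriv_right_zero (fun t ht => (hD t ht).continuousWithinAt) fun t ht => ?_
  exact (hD t (Ico_subset_Icc_self ht)).mono_of_mem_nhdsWithin
    (mem_of_superset (Icc_mem_nhdsGE ht.2) (Icc_subset_Icc_left ht.1))

/-- Conserved energy, ellipticity and an at most quadratic lower bound on V give |ξ| ≤ A(1 + |x|).
Then |x'| is at most affine in |x|, and Gronwall's inequality bounds x and with it ξ. -/
theorem exists_global_trajectory (hr : ContDiff ℝ ∞ r)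
    (hsymm : ∀ x ξ η, inner ℝ ξ (r x η) = inner ℝ η (r x ξ)) (hV : ContDiff ℝ ∞ V)
    {C₀ : ℝ} (hC₀ : ∀ x, ‖r x‖ ≤ C₀) {c : ℝ} (hc : 0 < c)
    (hell : ∀ x ξ, c * ‖ξ‖ ^ 2 ≤ ‖ξ‖ ^ 2 + inner ℝ ξ (r x ξ))
    {C₁ : ℝ} (hC₁ : ∀ x, -V x ≤ C₁ * (1 + ‖x‖) ^ 2) (z : Euc d × Euc d) :
    ∃ γ : ℝ → Euc d × Euc d, γ 0 = z ∧ ∀ t, HasDerivAt γ (hamiltonField r (∇ V) (γ t)) t := by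
  refine exists_global_solution (contDiff_hamiltonField hr (contDiff_gradient hV)) z fun T hT => ?_
  have hC₀' : 0 ≤ C₀ := (norm_nonneg _).trans (hC₀ 0)
  set E₀ := energyForm r z.1 z.2 + V z.1
  set A := Real.sqrt (2 * (|E₀| + |C₁|) / c)
  have hA : 0 ≤ A := Real.sqrt_nonneg _
  set K := (1 + C₀) * A
  have hK : 0 ≤ K := by positivity
  set B := gronwallBound ‖z.1‖ K K T
  refine ⟨max B (A * (1 + B)), fun χ hχ γ hγ0 hγ => ?_⟩
  have hen := energy_eq_of_hasDerivWithinAt hr hsymm hV (c := fun t => χ (γ t)) hγ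
  have hξ : ∀ t ∈ Icc 0 T, ‖(γ t).2‖ ≤ A * (1 + ‖(γ t).1‖) := by
    intro t ht
    have h1 := hen t ht
    rw [hγ0] at h1
    have h2 := hell (γ t).1 (γ t).2
    have h3 : c * ‖(γ t).2‖ ^ 2 ≤ 2 * (|E₀| + |C₁|) * (1 + ‖(γ t).1‖) ^ 2 := by
      have h4 : 1 / 2 * (c * ‖(γ t).2‖ ^ 2) ≤ energyForm r (γ t).1 (γ t).2 := by
        unfold energyForm; linarith
      have h5 := hC₁ (γ t).1
      have h6 : C₁ * (1 + ‖(γ t).1‖) ^ 2 ≤ |C₁| * (1 + ‖(γ t).1‖) ^ 2 := by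
        gcongr; exact le_abs_self _
      have h7 : |E₀| ≤ |E₀| * (1 + ‖(γ t).1‖) ^ 2 :=
        le_mul_of_one_le_right (abs_nonneg _) (one_le_pow₀ (by linarith [norm_nonneg (γ t).1]))
      have h8 : E₀ ≤ |E₀| := le_abs_self _
      have h9 : energyForm r (γ t).1 (γ t).2 + V (γ t).1 = E₀ := h1
      nlinarith
    refine abs_le_of_sq_le_sq' ?_ (by positivity) |>.2
    rw [mul_pow, Real.sq_sqrt (by positivity), div_mul_eq_mul_div, le_div_iff₀ hc]
    linarith
  have hx : ∀ t ∈ Icc 0 T, ‖(γ t).1‖ ≤ B := by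
    intro t ht
    have hfst : ∀ s ∈ Icc 0 T, HasDerivWithinAt (fun s => (γ s).1)
        (χ (γ s) • hamiltonField r (∇ V) (γ s)).1 (Icc 0 T) s := fun s hs => (hγ s hs).fst
    have h1 := norm_le_gronwallBound_of_norm_deriv_right_le (δ := ‖z.1‖) (K := K) (ε := K)
      (fun s hs => (hfst s hs).continuousWithinAt)
      (fun s hs => (hfst s (Ico_subset_Icc_self hs)).mono_of_mem_nhdsWithin
        (mem_of_superset (Icc_mem_nhdsGE hs.2) (Icc_subset_Icc_left hs.1)))
      (by rw [hγ0]) (fun s hs => ?_) t ht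
    · refine h1.trans ?_
      rw [sub_zero]
      exact gronwallBound_mono (norm_nonneg _) hK hK ht.2
    · have h2 := hξ s (Ico_subset_Icc_self hs)
      calc ‖(χ (γ s) • hamiltonField r (∇ V) (γ s)).1‖
          = |χ (γ s)| * ‖(γ s).2 + r (γ s).1 (γ s).2‖ := by
            rw [Prod.smul_fst, norm_smul]; rfl
        _ ≤ 1 * (‖(γ s).2‖ + C₀ * ‖(γ s).2‖) := by
            gcongr
            · exact hχ _
            · exact (norm_add_le _ _).trans (add_le_add_right
                (ContinuousLinearMap.le_of_opNorm_le _ (hC₀ _) _) _)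
        _ = (1 + C₀) * ‖(γ s).2‖ := by ring
        _ ≤ (1 + C₀) * (A * (1 + ‖(γ s).1‖)) := by gcongr
        _ = K * ‖(γ s).1‖ + K := by ring
  intro t ht
  refine max_le_max (hx t ht) ((hξ t ht).trans ?_)
  gcongr
  exact hx t ht

end Energy

theorem IsSymbol.exists_norm_le_rpow {d : ℕ} {G : Type} [NormedAddCommGroup G] [NormedSpace ℝ G]
    {m : ℝ} {f : Euc d → G} (h : IsSymbol m f) :
    ∃ C : ℝ, 0 ≤ C ∧ ∀ x, ‖f x‖ ≤ C * japaneseBracket x ^ m := by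
  obtain ⟨C, hC, hb⟩ := h.bound 0
  exact ⟨C, hC, fun x => by simpa using hb x⟩

theorem exists_tendsto_of_norm_deriv_le {E : Type} [NormedAddCommGroup E] [NormedSpace ℝ E]
    [CompleteSpace E] {f f' : ℝ → E} (hf : ∀ s, 0 < s → HasDerivAt f (f' s) s)
    (hc : ContinuousOn f' (Ioi 0)) {C a : ℝ} (ha : 1 < a)
    (hb : ∀ s, 0 < s → ‖f' s‖ ≤ C * (1 + s) ^ (-a)) : ∃ L, Tendsto f atTop (𝓝 L) := by
  refine ⟨_, MeasureTheory.tendsto_limUnder_of_hasDerivAt_of_integrableOn_Ioi (a := 0)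
    (f' := f') (fun s hs => hf s hs) ?_⟩
  have h1 : MeasureTheory.IntegrableOn (fun s : ℝ => C * (s + 1) ^ (-a)) (Ioi 0) :=
    (integrableOn_add_rpow_Ioi_of_lt (by linarith) (by norm_num)).const_mul C
  refine h1.mono' (hc.aestronglyMeasurable measurableSet_Ioi) ?_
  refine (MeasureTheory.ae_restrict_iff' measurableSet_Ioi).2 (Eventually.of_forall fun s hs => ?_)
  rw [add_comm s]
  exact hb s hs

/-- Comparison with the primitive of the bound; μ < 1 makes it grow like (1 + s)^{1-μ}, which also
absorbs the initial value. -/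
theorem norm_le_of_norm_deriv_le_rpow {E : Type} [NormedAddCommGroup E] [NormedSpace ℝ E]
    {f f' : ℝ → E} (hf : ∀ s, HasDerivAt f (f' s) s) {C μ : ℝ} (hC : 0 ≤ C) (hμ1 : μ < 1)
    (hb : ∀ s, 0 ≤ s → ‖f' s‖ ≤ C * (1 + s) ^ (-μ)) {s : ℝ} (hs : 0 ≤ s) :
    ‖f s‖ ≤ (‖f 0‖ + C / (1 - μ)) * (1 + s) ^ (1 - μ) := by
  have hB : ∀ u : ℝ, 0 ≤ u → HasDerivAt (fun u => ‖f 0‖ + C / (1 - μ) * (1 + u) ^ (1 - μ))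
      (C * (1 + u) ^ (-μ)) u := by
    intro u hu
    have h1 := ((hasDerivAt_id u).const_add 1).rpow_const (p := 1 - μ)
      (Or.inl (by simp only [id_eq]; linarith))
    refine ((h1.const_mul (C / (1 - μ))).const_add ‖f 0‖).congr_deriv ?_
    have h2 : 1 - μ ≠ 0 := by linarith
    have h3 : 1 - μ - 1 = -μ := by ring
    simp only [id_eq, h3]
    field_simp
  have h1 := image_norm_le_of_norm_deriv_right_le_deriv_boundary' (f := f) (f' := f') (a := 0) (b := s)
    (fun u _ => (hf u).continuousAt.continuousWithinAt) (fun u _ => (hf u).hasDerivWithinAt)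
    (B := fun u => ‖f 0‖ + C / (1 - μ) * (1 + u) ^ (1 - μ)) (B' := fun u => C * (1 + u) ^ (-μ))
    (by simp; exact div_nonneg hC (by linarith))
    (fun u hu => (hB u hu.1).continuousAt.continuousWithinAt)
    (fun u hu => (hB u hu.1).hasDerivWithinAt) (fun u hu => hb u hu.1) ⟨hs, le_rfl⟩
  refine h1.trans ?_
  rw [add_mul]
  gcongr
  exact le_mul_of_one_le_right (norm_nonneg _) (Real.one_le_rpow (by linarith) (by linarith))

/-! ### Escape and scattering limits of kinetic trajectories. -/

section Nontrapping

variable {d : ℕ} {r : Euc d → Euc d →L[ℝ] Euc d} {gL gS : Euc d → Euc d} {μ : ℝ}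
  {z : ℝ → Euc d × Euc d}

theorem scaledField_zero (p : Euc d × Euc d) :
    scaledField r gL gS 0 p = (p.2 + r p.1 p.2, -kineticForce r p.1 p.2) := by
  simp [scaledField, hamiltonField]

/-- The kinetic energy is conserved and comparable to |ξ|², by ellipticity from below and
boundedness of r from above. Here E is twice the kinetic energy. -/
theorem exists_momentum_bounds (hr : IsSymbol (-μ) r) (hμ : 0 < μ)
    (hsymm : ∀ x ξ η, inner ℝ ξ (r x η) = inner ℝ η (r x ξ)) {c : ℝ} (hc : 0 < c)
    (hell : ∀ x ξ, c * ‖ξ‖ ^ 2 ≤ ‖ξ‖ ^ 2 + inner ℝ ξ (r x ξ))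
    (hz : ∀ s, HasDerivAt z (scaledField r gL gS 0 (z s)) s) (hz0 : (z 0).2 ≠ 0) :
    ∃ c₁ C₁ E : ℝ, 0 < c₁ ∧ 0 < C₁ ∧ 0 < E ∧ ∀ s, 0 ≤ s → c₁ ≤ ‖(z s).2‖ ∧ ‖(z s).2‖ ≤ C₁ ∧
      inner ℝ ((z s).2 + r (z s).1 (z s).2) (z s).2 = E := by
  obtain ⟨C₀, hC₀, hb⟩ := hr.exists_norm_le_rpow
  have hb' : ∀ x, ‖r x‖ ≤ C₀ := fun x => (hb x).trans (mul_le_of_le_one_right hC₀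
    (Real.rpow_le_one_of_one_le_of_nonpos (one_le_japaneseBracket x) (by linarith)))
  set E := ‖(z 0).2‖ ^ 2 + inner ℝ (z 0).2 (r (z 0).1 (z 0).2) with hE
  have hE0 : 0 < E := lt_of_lt_of_le (by have := norm_pos_iff.2 hz0; positivity) (hell _ _)
  have hcons : ∀ s, 0 ≤ s → ‖(z s).2‖ ^ 2 + inner ℝ (z s).2 (r (z s).1 (z s).2) = E := by
    intro s hs
    have h1 := energy_eq_of_hasDerivWithinAt (V := fun _ => (0 : ℝ)) (T := s) (c := fun _ => 1)
      (γ := z) hr.smooth hsymm contDiff_const (fun t _ => by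
        refine (hz t).hasDerivWithinAt.congr_deriv ?_
        have : ∇ (fun _ : Euc d => (0 : ℝ)) = fun _ => 0 := funext fun x => by
          rw [gradient_eq_dualVec]; simp
        rw [this, one_smul, scaledField_zero]
        simp [hamiltonField]) s ⟨hs, le_rfl⟩
    simp only [energyForm, add_zero] at h1
    linarith
  refine ⟨Real.sqrt (E / (1 + C₀)), Real.sqrt (E / c), E, by positivity, by positivity, hE0,
    fun s hs => ⟨?_, ?_, ?_⟩⟩
  · rw [Real.sqrt_le_left (norm_nonneg _), div_le_iff₀ (by positivity), ← hcons s hs]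
    have h1 : inner ℝ (z s).2 (r (z s).1 (z s).2) ≤ ‖(z s).2‖ * (C₀ * ‖(z s).2‖) :=
      (real_inner_le_norm _ _).trans (mul_le_mul_of_nonneg_left
        (ContinuousLinearMap.le_of_opNorm_le _ (hb' _) _) (norm_nonneg _))
    nlinarith
  · refine Real.le_sqrt_of_sq_le ?_
    rw [le_div_iff₀ hc, ← hcons s hs, mul_comm]
    exact hell _ _
  · rw [inner_add_left, real_inner_self_eq_norm_sq, real_inner_comm]
    exact hcons s hs

theorem IsSymbol.exists_norm_kineticForce_le (hr : IsSymbol (-μ) r) :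
    ∃ C : ℝ, 0 ≤ C ∧ ∀ x ξ, ‖kineticForce r x ξ‖ ≤ C * japaneseBracket x ^ (-μ - 1) * ‖ξ‖ ^ 2 := by
  obtain ⟨C, hC, hb⟩ := hr.derivative.exists_norm_le_rpow
  refine ⟨‖halfTranspose d‖ * C, by positivity, fun x ξ => (norm_kineticForce_le r x ξ).trans ?_⟩
  rw [mul_assoc ‖halfTranspose d‖ C]
  gcongr
  exact hb x

/-- The escape function g = x·ξ has derivative E + O(⟨x⟩^{-μ}). Nontrapping makes the error less
than E/2 eventually, so g grows linearly, while g ≤ C₁⟨x⟩. -/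
theorem exists_position_lower (hr : IsSymbol (-μ) r) (hμ : 0 < μ) {C₁ E : ℝ} (hC₁ : 0 < C₁)
    (hE : 0 < E) (hb : ∀ s, 0 ≤ s → ‖(z s).2‖ ≤ C₁ ∧
      inner ℝ ((z s).2 + r (z s).1 (z s).2) (z s).2 = E)
    (hz : ∀ s, HasDerivAt z (scaledField r gL gS 0 (z s)) s)
    (htrap : Tendsto (fun s => ‖(z s).1‖) atTop atTop) :
    ∃ c₂ : ℝ, 0 < c₂ ∧ ∀ s, 0 ≤ s → c₂ * (1 + s) ≤ japaneseBracket (z s).1 := by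
  obtain ⟨C, hC, hF⟩ := hr.exists_norm_kineticForce_le
  have hlim : Tendsto (fun s => C * C₁ ^ 2 * japaneseBracket (z s).1 ^ (-μ)) atTop
      (𝓝 (C * C₁ ^ 2 * 0)) :=
    (((tendsto_rpow_neg_atTop hμ).comp (tendsto_atTop_mono
      (fun s => norm_le_japaneseBracket (z s).1) htrap))).const_mul _
  rw [mul_zero] at hlim
  obtain ⟨s₀, hs₀⟩ := ((hlim.eventually (gt_mem_nhds (by positivity : 0 < E / 2))).and
    (eventually_ge_atTop 0)).exists_forall_of_atTop
  have hs₀0 : 0 ≤ s₀ := (hs₀ s₀ le_rfl).2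
  set g : ℝ → ℝ := fun s => inner ℝ (z s).1 (z s).2 with hg
  have hgD : ∀ s, HasDerivAt g (inner ℝ (z s).1 (-kineticForce r (z s).1 (z s).2) +
      inner ℝ ((z s).2 + r (z s).1 (z s).2) (z s).2) s := by
    intro s
    have h := hz s
    rw [scaledField_zero] at h
    have h1 : HasDerivAt (fun s => (z s).1) _ s := h.fst
    have h2 : HasDerivAt (fun s => (z s).2) _ s := h.snd
    exact h1.inner ℝ h2
  have hgD' : ∀ s, s₀ ≤ s → E / 2 ≤ inner ℝ (z s).1 (-kineticForce r (z s).1 (z s).2) +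
      inner ℝ ((z s).2 + r (z s).1 (z s).2) (z s).2 := by
    intro s hs
    rw [(hb s (hs₀0.trans hs)).2]
    have hJ := japaneseBracket_pos (z s).1
    have h1 : |inner ℝ (z s).1 (-kineticForce r (z s).1 (z s).2)| ≤
        C * C₁ ^ 2 * japaneseBracket (z s).1 ^ (-μ) := by
      refine (abs_real_inner_le_norm _ _).trans ?_
      rw [norm_neg]
      calc ‖(z s).1‖ * ‖kineticForce r (z s).1 (z s).2‖
          ≤ japaneseBracket (z s).1 * (C * japaneseBracket (z s).1 ^ (-μ - 1) * C₁ ^ 2) := by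
            gcongr
            · exact norm_le_japaneseBracket _
            · refine (hF _ _).trans ?_
              gcongr
              exact (hb s (hs₀0.trans hs)).1
        _ = C * C₁ ^ 2 * (japaneseBracket (z s).1 * japaneseBracket (z s).1 ^ (-μ - 1)) := by ring
        _ = _ := by
            congr 1
            rw [← Real.rpow_one_add' hJ.le (by linarith)]
            congr 1; ring
    have h2 := (hs₀ s hs).1
    linarith [(abs_le.1 h1).1]
  have hgrow : ∀ s, s₀ ≤ s → g s₀ + E / 2 * (s - s₀) ≤ g s := by
    intro s hs
    have hmono : MonotoneOn (fun s => g s - E / 2 * s) (Ici s₀) := by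
      have hD : ∀ s, HasDerivAt (fun s => g s - E / 2 * s) _ s := fun s =>
        (hgD s).sub ((hasDerivAt_id s).const_mul (E / 2))
      refine monotoneOn_of_deriv_nonneg (convex_Ici _)
        (fun s _ => (hD s).continuousAt.continuousWithinAt)
        (fun s _ => (hD s).differentiableAt.differentiableWithinAt) fun s hs => ?_
      rw [(hD s).deriv]
      rw [interior_Ici] at hs
      have := hgD' s hs.le
      linarith
    have := hmono self_mem_Ici hs hs
    simp only at this
    linarith
  set D := |g s₀| + E / 2 * s₀ with hD
  have hD0 : 0 ≤ D := by positivity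
  have hlow : ∀ s, s₀ ≤ s → E / 2 * s - D ≤ C₁ * japaneseBracket (z s).1 := by
    intro s hs
    have h1 := hgrow s hs
    have h2 : g s ≤ C₁ * japaneseBracket (z s).1 := by
      refine (real_inner_le_norm _ _).trans ?_
      rw [mul_comm]
      gcongr
      · exact (hb s (hs₀0.trans hs)).1
      · exact norm_le_japaneseBracket _
    have := neg_abs_le (g s₀)
    linarith
  -- Beyond B the lower bound Es/2 - D dominates E(1 + s)/8; before B the bracket is at least 1.
  set B := s₀ + 4 * D / E + 2 with hB
  have hB0 : 0 < B := by positivity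
  refine ⟨min (1 / (1 + B)) (E / (8 * C₁)), by positivity, fun s hs => ?_⟩
  rcases le_total s B with h | h
  · refine le_trans ?_ (one_le_japaneseBracket _)
    calc min (1 / (1 + B)) (E / (8 * C₁)) * (1 + s) ≤ 1 / (1 + B) * (1 + B) := by
          gcongr; exact min_le_left _ _
      _ = 1 := by field_simp
  · have h3 : 0 ≤ 4 * D / E := by positivity
    have h1 := hlow s (by linarith)
    have h2 : 4 * D / E * E = 4 * D := by field_simp
    have h4 : E / 8 * (1 + s) ≤ E / 2 * s - D := by nlinarith
    calc min (1 / (1 + B)) (E / (8 * C₁)) * (1 + s) ≤ E / (8 * C₁) * (1 + s) := by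
          gcongr; exact min_le_right _ _
      _ = (E / 8 * (1 + s)) / C₁ := by field_simp
      _ ≤ (C₁ * japaneseBracket (z s).1) / C₁ :=
          div_le_div_of_nonneg_right (h4.trans h1) hC₁.le
      _ = _ := by field_simp

/-- Along nontrapped kinetic trajectories the modified coordinates stay in a fixed region and
converge. -/
theorem exists_scattering_limit (hr : IsSymbol (-μ) r) (hgL : IsSymbol (1 - μ) gL)
    (hgS : IsSymbol (1 - 2 * μ) gS) (hμ : 1 / 2 < μ) (hμ1 : μ < 1)
    (hsymm : ∀ x ξ η, inner ℝ ξ (r x η) = inner ℝ η (r x ξ)) {c : ℝ} (hc : 0 < c)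
    (hell : ∀ x ξ, c * ‖ξ‖ ^ 2 ≤ ‖ξ‖ ^ 2 + inner ℝ ξ (r x ξ))
    (hz : ∀ s, HasDerivAt z (scaledField r gL gS 0 (z s)) s) (hz0 : (z 0).2 ≠ 0)
    (htrap : Tendsto (fun s => ‖(z s).1‖) atTop atTop) :
    ∃ c R : ℝ, 0 < c ∧ 0 ≤ R ∧
      (∀ s, 0 ≤ s → (modifiedCoordinates r gL 0 s (z s)).2 ∈ momentumShell d c R ∧
        ‖(modifiedCoordinates r gL 0 s (z s)).1‖ ≤ R * (1 + s) ^ (1 - μ)) ∧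
      ∃ w : Euc d × Euc d, w.2 ∈ momentumShell d c R ∧
        Tendsto (fun s => modifiedCoordinates r gL 0 s (z s)) atTop (𝓝 w) := by
  have hμ0 : 0 < μ := by linarith
  obtain ⟨c₁, C₁, E, hc₁, hC₁, hE, hb⟩ := exists_momentum_bounds hr hμ0 hsymm hc hell hz hz0
  obtain ⟨c₂, hc₂, hy⟩ := exists_position_lower hr hμ0 hC₁ hE (fun s hs => (hb s hs).2) hz htrap
  obtain ⟨C, hC, hF⟩ := hr.exists_norm_kineticForce_le
  obtain ⟨C', hC', hrb⟩ := hr.exists_norm_le_rpow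
  have hpow : ∀ m : ℝ, m ≤ 0 → ∀ s, 0 ≤ s →
      japaneseBracket (z s).1 ^ m ≤ c₂ ^ m * (1 + s) ^ m := fun m hm s hs => by
    rw [← Real.mul_rpow hc₂.le (by linarith)]
    exact Real.rpow_le_rpow_of_nonpos (by positivity) (hy s hs) hm
  -- A first, crude estimate: x - sξ has derivative O((1 + s)^{-μ}) by linear escape, hence grows at
  -- most like (1 + s)^{1-μ}. This places the trajectory in the region where the integrable bounds
  -- hold.
  have hfree : ∀ s, HasDerivAt (fun s => (z s).1 - s • (z s).2)
      (r (z s).1 (z s).2 + s • kineticForce r (z s).1 (z s).2) s := by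
    intro s
    have h := hz s
    rw [scaledField_zero] at h
    have h1 : HasDerivAt (fun s => (z s).1) _ s := h.fst
    have h2 : HasDerivAt (fun s => (z s).2) _ s := h.snd
    refine (h1.sub ((hasDerivAt_id s).smul h2)).congr_deriv ?_
    simp
    abel
  set K := C' * c₂ ^ (-μ) * C₁ + C * c₂ ^ (-μ - 1) * C₁ ^ 2
  have hK : 0 ≤ K := by positivity
  have hfreeb : ∀ s, 0 ≤ s → ‖r (z s).1 (z s).2 + s • kineticForce r (z s).1 (z s).2‖ ≤
      K * (1 + s) ^ (-μ) := by
    intro s hs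
    have h1 : ‖r (z s).1 (z s).2‖ ≤ C' * (c₂ ^ (-μ) * (1 + s) ^ (-μ)) * C₁ := by
      refine (ContinuousLinearMap.le_opNorm _ _).trans ?_
      gcongr
      · exact (hrb _).trans (by gcongr; exact hpow _ (by linarith) s hs)
      · exact (hb s hs).2.1
    have h2 : ‖s • kineticForce r (z s).1 (z s).2‖ ≤
        (1 + s) * (C * (c₂ ^ (-μ - 1) * (1 + s) ^ (-μ - 1)) * C₁ ^ 2) := by
      rw [norm_smul, Real.norm_of_nonneg hs]
      gcongr
      · linarith
      · refine (hF _ _).trans ?_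
        gcongr
        · exact hpow _ (by linarith) s hs
        · exact (hb s hs).2.1
    have h3 : (1 + s) * (1 + s) ^ (-μ - 1) = (1 + s) ^ (-μ) := by
      rw [← Real.rpow_one_add' (by linarith) (by linarith)]
      congr 1; ring
    calc _ ≤ _ := norm_add_le_of_le h1 h2
      _ = C' * c₂ ^ (-μ) * C₁ * (1 + s) ^ (-μ) +
          C * c₂ ^ (-μ - 1) * C₁ ^ 2 * ((1 + s) * (1 + s) ^ (-μ - 1)) := by ring
      _ = K * (1 + s) ^ (-μ) := by rw [h3]; ring
  have hshell : ∀ R, C₁ ≤ R → ∀ s, 0 ≤ s → (z s).2 ∈ momentumShell d c₁ R := fun R hR s hs =>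
    ⟨(hb s hs).1, (hb s hs).2.1.trans hR⟩
  -- With h = 0 every time is admissible already for T = 0.
  obtain ⟨A, hA, hAb⟩ := (derivBound_modifierCorrection (T := 0) hr hgL hc₁ hC₁.le hμ0 hμ1).bound 0
    (by simp)
  set R := C₁ + (‖(z 0).1 - (0 : ℝ) • (z 0).2‖ + K / (1 - μ)) + A
  have h1μ : 0 < 1 - μ := by linarith
  have hRC : C₁ ≤ R := by
    have : 0 ≤ ‖(z 0).1 - (0 : ℝ) • (z 0).2‖ + K / (1 - μ) := by positivity
    linarith
  have hregion : ∀ s, 0 ≤ s → (modifiedCoordinates r gL 0 s (z s)).2 ∈ momentumShell d c₁ R ∧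
        ‖(modifiedCoordinates r gL 0 s (z s)).1‖ ≤ R * (1 + s) ^ (1 - μ) := by
    intro s hs
    refine ⟨hshell R hRC s hs, ?_⟩
    have h1 := norm_le_of_norm_deriv_le_rpow hfree hK hμ1 hfreeb hs
    have h2 := hAb ⟨(0, s), le_rfl, hs, by simp⟩ (z s).2 (hshell C₁ le_rfl s hs)
    rw [norm_iteratedFDeriv_zero] at h2
    calc _ ≤ _ := norm_sub_le_of_le h1 h2
      _ = (R - C₁) * (1 + s) ^ (1 - μ) := by simp only [R, timeScale]; ring
      _ ≤ R * (1 + s) ^ (1 - μ) := by gcongr; linarith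
  have hR : 0 ≤ R := hC₁.le.trans hRC
  refine ⟨c₁, R, hc₁, hR, hregion, ?_⟩
  have hD : ∀ s, HasDerivAt (fun s => modifiedCoordinates r gL 0 s (z s))
      (modifiedField r gL gS 0 s (modifiedCoordinates r gL 0 s (z s))) s := fun s =>
    hasDerivWithinAt_univ.1
      (hasDerivWithinAt_modifiedCoordinates hr.smooth hgL.smooth 0 (hz s).hasDerivWithinAt)
  obtain ⟨B, hB, hBb⟩ := (derivBound_modifiedField (T := 0) hr hgL hgS hc₁ hR hμ0 hμ1).bound 0
    (by simp)
  -- In modified coordinates the velocity decays with exponent -2μ < -1, so the motion converges.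
  obtain ⟨w, hw⟩ := exists_tendsto_of_norm_deriv_le (fun s _ => hD s) (C := B) (a := 2 * μ)
    (by
      have hcont : Continuous fun s => modifiedCoordinates r gL 0 s (z s) :=
        continuous_iff_continuousAt.2 fun s => (hD s).continuousAt
      exact ((contDiff_modifiedField hr.smooth hgL.smooth hgS.smooth).continuous.comp
        ((continuous_const.prodMk continuous_id).prodMk hcont)).continuousOn)
    (by linarith) (fun s hs => by
      have := hBb ⟨(0, s), le_rfl, hs.le, by simp⟩ _ (hregion s hs.le)
      rw [norm_iteratedFDeriv_zero] at this
      simpa [timeScale] using this)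
  refine ⟨w, ?_, hw⟩
  have hlim : Tendsto (fun s => ‖(z s).2‖) atTop (𝓝 ‖w.2‖) :=
    ((continuous_snd.tendsto w).comp hw).norm
  exact ⟨ge_of_tendsto hlim ((eventually_ge_atTop 0).mono fun s hs => (hb s hs).1),
    le_of_tendsto hlim ((eventually_ge_atTop 0).mono fun s hs => (hb s hs).2.1.trans hRC)⟩

end Nontrapping

/-! ### Compactification of time. -/

section Clock

/-- The time `s` given by `1 + s = (1 - τ)^{-N}`. -/
def clock (N : ℕ) (τ : ℝ) : ℝ := ((1 - τ)⁻¹) ^ N - 1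

/-- The speed of the clock. -/
def clockSpeed (N : ℕ) (τ : ℝ) : ℝ := N * ((1 - τ)⁻¹) ^ (N + 1)

/-- The inverse of the clock. -/
def clockInv (N : ℕ) (s : ℝ) : ℝ := 1 - (1 + s) ^ (-(N : ℝ)⁻¹)

variable {N : ℕ}

theorem clock_zero : clock N 0 = 0 := by simp [clock]

/-- By the convention 0⁻¹ = 0. The compactified field thereby gets the value 0 at τ = 1, which is
also its limit there. -/
theorem clockSpeed_one : clockSpeed N 1 = 0 := by simp [clockSpeed]

theorem one_add_clock (τ : ℝ) : 1 + clock N τ = ((1 - τ)⁻¹) ^ N := by simp [clock]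

theorem clock_nonneg {τ : ℝ} (h0 : 0 ≤ τ) (h1 : τ < 1) : 0 ≤ clock N τ := by
  have h2 : 1 ≤ (1 - τ)⁻¹ := (one_le_inv₀ (by linarith)).2 (by linarith)
  have := one_le_pow₀ h2 (n := N)
  unfold clock; linarith

theorem hasDerivAt_clock {τ : ℝ} (h : τ < 1) : HasDerivAt (clock N) (clockSpeed N τ) τ := by
  have h1 : HasDerivAt (fun τ : ℝ => 1 - τ) (-1) τ := by simpa using (hasDerivAt_id τ).const_sub 1
  have h0 : 1 - τ ≠ 0 := by linarith
  refine (((h1.inv h0).pow N).sub_const 1).congr_deriv ?_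
  rcases N with _ | n
  · simp [clockSpeed]
  · simp only [Pi.inv_apply, Nat.add_sub_cancel, neg_neg, clockSpeed, one_div]
    rw [pow_succ ((1 - τ)⁻¹) (n + 1), pow_succ ((1 - τ)⁻¹) n]
    field_simp

theorem continuousAt_clock {τ : ℝ} (h : τ < 1) : ContinuousAt (clock N) τ :=
  (hasDerivAt_clock h).continuousAt

theorem continuousAt_clockSpeed {τ : ℝ} (h : τ < 1) : ContinuousAt (clockSpeed N) τ := by
  unfold clockSpeed
  exact continuousAt_const.mul (((continuousAt_const.sub continuousAt_id).inv₀
    (sub_pos.2 h).ne').pow _)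

theorem tendsto_clock (hN : N ≠ 0) : Tendsto (clock N) (𝓝[<] 1) atTop := by
  have h1 : Tendsto (fun τ : ℝ => 1 - τ) (𝓝[<] 1) (𝓝[>] 0) := by
    refine tendsto_nhdsWithin_iff.2 ⟨?_, ?_⟩
    · have : Tendsto (fun τ : ℝ => 1 - τ) (𝓝 1) (𝓝 (1 - 1)) := tendsto_const_nhds.sub tendsto_id
      rw [sub_self] at this
      exact this.mono_left nhdsWithin_le_nhds
    · filter_upwards [self_mem_nhdsWithin] with τ hτ
      exact sub_pos.2 (mem_Iio.1 hτ)
  exact tendsto_atTop_add_const_right _ (-1) ((tendsto_pow_atTop hN).comp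
    (tendsto_inv_nhdsGT_zero.comp h1))

/-- The exponent 2μN - N - 1 is positive exactly when N(2μ - 1) > 1; then the change of time still
leaves a field tending to 0 at τ = 1. -/
theorem clockSpeed_mul_rpow {τ μ : ℝ} (h : τ < 1) :
    clockSpeed N τ * (1 + clock N τ) ^ (-2 * μ) = N * (1 - τ) ^ (2 * μ * N - N - 1) := by
  have h0 : 0 < 1 - τ := by linarith
  have h2 : ((1 - τ)⁻¹) ^ (N + 1) = (1 - τ) ^ (-((N : ℝ) + 1)) := by
    rw [Real.rpow_neg h0.le, inv_pow]
    congr 1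
    rw [← Real.rpow_natCast]; push_cast; rfl
  have h3 : (((1 - τ)⁻¹) ^ N) ^ (-2 * μ) = (1 - τ) ^ (2 * μ * N) := by
    rw [← Real.rpow_natCast, ← Real.rpow_mul (by positivity), Real.inv_rpow h0.le,
      ← Real.rpow_neg h0.le]
    congr 1; ring
  rw [one_add_clock, clockSpeed, h2, h3, mul_assoc, ← Real.rpow_add h0]
  congr 2; ring

theorem one_sub_clockInv (s : ℝ) : 1 - clockInv N s = (1 + s) ^ (-(N : ℝ)⁻¹) := by
  simp [clockInv]

theorem clockInv_lt_one {s : ℝ} (hs : 0 ≤ s) : clockInv N s < 1 := by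
  have : 0 < (1 + s) ^ (-(N : ℝ)⁻¹) := Real.rpow_pos_of_pos (by linarith) _
  unfold clockInv; linarith

theorem clockInv_nonneg {s : ℝ} (hs : 0 ≤ s) : 0 ≤ clockInv N s := by
  have : (1 + s) ^ (-(N : ℝ)⁻¹) ≤ 1 := Real.rpow_le_one_of_one_le_of_nonpos (by linarith)
    (neg_nonpos.2 (by positivity))
  unfold clockInv; linarith

theorem clock_clockInv (hN : N ≠ 0) {s : ℝ} (hs : 0 ≤ s) : clock N (clockInv N s) = s := by
  have h0 : 0 < 1 + s := by linarith
  have hN' : (N : ℝ) ≠ 0 := by exact_mod_cast hN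
  rw [clock, one_sub_clockInv, ← Real.rpow_neg h0.le, ← Real.rpow_natCast, ← Real.rpow_mul h0.le,
    neg_neg, inv_mul_cancel₀ hN', Real.rpow_one]
  ring

theorem clockInv_zero : clockInv N 0 = 0 := by simp [clockInv]

theorem hasDerivAt_clockInv (hN : N ≠ 0) {s : ℝ} (hs : 0 ≤ s) :
    HasDerivAt (clockInv N) ((clockSpeed N (clockInv N s))⁻¹) s := by
  have h0 : 0 < 1 + s := by linarith
  have hN' : (N : ℝ) ≠ 0 := by exact_mod_cast hN
  have h1 := (((hasDerivAt_id s).const_add 1).rpow_const (p := -(N : ℝ)⁻¹)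
    (Or.inl (by simp only [id_eq]; linarith))).const_sub 1
  refine h1.congr_deriv ?_
  have h2 : ((1 - clockInv N s)⁻¹) ^ (N + 1) = (1 + s) ^ (1 + (N : ℝ)⁻¹) := by
    rw [one_sub_clockInv, ← Real.rpow_neg h0.le, ← Real.rpow_natCast, ← Real.rpow_mul h0.le,
      neg_neg]
    congr 1
    push_cast
    field_simp
  rw [clockSpeed, h2, mul_inv, ← Real.rpow_neg h0.le]
  simp only [id_eq]
  rw [show -(N : ℝ)⁻¹ - 1 = -(1 + (N : ℝ)⁻¹) by ring]
  ring

theorem clockSpeed_clockInv_ne_zero (hN : N ≠ 0) {s : ℝ} (hs : 0 ≤ s) :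
    clockSpeed N (clockInv N s) ≠ 0 := by
  have h1 := clockInv_lt_one (N := N) hs
  have h2 : 0 < (1 - clockInv N s)⁻¹ := inv_pos.2 (by linarith)
  have hN' : (N : ℝ) ≠ 0 := by exact_mod_cast hN
  exact mul_ne_zero hN' (pow_pos h2 _).ne'

theorem tendsto_clockInv (hN : N ≠ 0) : Tendsto (clockInv N) atTop (𝓝 1) := by
  have h1 : Tendsto (fun s : ℝ => (1 + s) ^ (-(N : ℝ)⁻¹)) atTop (𝓝 0) :=
    (tendsto_rpow_neg_atTop (by positivity)).comp (tendsto_atTop_add_const_left _ 1 tendsto_id)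
  unfold clockInv
  simpa using h1.const_sub 1

end Clock

/-! ### Regularity of the compactified field up to the final time. -/

section CompactField

variable {d : ℕ} (r : Euc d → Euc d →L[ℝ] Euc d) (gL gS : Euc d → Euc d)

/-- The semiclassical parameter, truncated to the range `h (1 + s) ≤ T`. -/
def truncatedParameter (T : ℝ) (N : ℕ) (h τ : ℝ) : ℝ := min h (T * (1 - τ) ^ N)

/-- The modified vector field in compactified time. -/
def compactField (T : ℝ) (N : ℕ) (h τ : ℝ) (w : Euc d × Euc d) : Euc d × Euc d :=
  clockSpeed N τ • modifiedField r gL gS (truncatedParameter T N h τ) (clock N τ) w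

variable {r gL gS} {μ T : ℝ} {N : ℕ}

/-- For τ < 1 one has T(1 - τ)^N = T/(1 + s), so the truncation is inactive in the range of
interest. -/
theorem truncatedParameter_eq {h τ : ℝ} (hτ : τ < 1) (hT : h * (1 + clock N τ) ≤ T) :
    truncatedParameter T N h τ = h := by
  refine min_eq_left ?_
  rw [one_add_clock, inv_pow, ← div_eq_mul_inv, div_le_iff₀ (pow_pos (by linarith) _)] at hT
  exact hT

theorem truncatedParameter_mem (hT : 0 ≤ T) {h τ : ℝ} (hh : 0 ≤ h) (h0 : 0 ≤ τ) (h1 : τ < 1) :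
    0 ≤ truncatedParameter T N h τ ∧ 0 ≤ clock N τ ∧
      truncatedParameter T N h τ * (1 + clock N τ) ≤ T := by
  have h2 : 0 < 1 - τ := by linarith
  refine ⟨le_min hh (by positivity), clock_nonneg h0 h1, ?_⟩
  rw [one_add_clock, inv_pow, ← div_eq_mul_inv, div_le_iff₀ (pow_pos h2 _)]
  exact min_le_right _ _

theorem derivBound_const_of_hasCompactSupport {ι W G : Type} [NormedAddCommGroup W]
    [NormedSpace ℝ W] [NormedAddCommGroup G] [NormedSpace ℝ G] {f : W → G} (hf : ContDiff ℝ ∞ f)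
    (hc : HasCompactSupport f) (U : ι → Set W) :
    DerivBound ⊤ (fun _ : ι => (1 : ℝ)) U fun _ => f :=
  ⟨fun _ => hf, fun n _ => by
    obtain ⟨C, hC⟩ := (hc.iteratedFDeriv (𝕜 := ℝ) n).exists_bound_of_continuous
      (hf.continuous_iteratedFDeriv (mod_cast le_top))
    exact ⟨C, (norm_nonneg _).trans (hC 0), fun _ w _ => by simpa using hC w⟩⟩

/-- A compact set in the phase space keeps ξ away from 0, so it lies in the region of the uniform
bounds for every (h, s). -/
theorem exists_tsupport_subset_modifiedRegion (hμ1 : μ < 1) {χ : Euc d × Euc d → ℝ}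
    (hc : HasCompactSupport χ) (hΩ : tsupport χ ⊆ phaseSpace d) :
    ∃ c R : ℝ, 0 < c ∧ 0 ≤ R ∧ ∀ i : TimeRange T, tsupport χ ⊆ modifiedRegion d μ c R i := by
  obtain ⟨c, hc0, hcb⟩ := exists_pos_lower_bound (f := fun w : Euc d × Euc d => ‖w.2‖) hc
    continuous_snd.norm.continuousOn fun w hw => norm_pos_iff.2 (hΩ hw)
  obtain ⟨R, hR⟩ := hc.exists_bound_of_continuousOn (f := fun w : Euc d × Euc d => w)
    continuousOn_id
  refine ⟨c, max R 0, hc0, le_max_right _ _, fun i w hw => ⟨⟨hcb w hw, ?_⟩, ?_⟩⟩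
  · exact (norm_snd_le w).trans ((hR w hw).trans (le_max_left _ _))
  · refine (norm_fst_le w).trans ((hR w hw).trans ((le_max_left R 0).trans ?_))
    exact le_mul_of_one_le_right (le_max_right _ _)
      (Real.one_le_rpow (one_le_timeScale i) (by linarith))

/-- Two kinds of parameter points occur: those where the coefficients are continuous, and those
where the prefactor vanishes and all derivatives tend to 0 uniformly in w. The second kind serves
for τ = 1, where the clock is singular. -/
theorem isSmoothFamily_of_bound {P W G : Type} [TopologicalSpace P] [NormedAddCommGroup W]
    [NormedSpace ℝ W] [FiniteDimensional ℝ W] [NormedAddCommGroup G] [NormedSpace ℝ G]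
    {Φ : ℝ × ℝ → W → G} (hΦ : ContDiff ℝ ∞ (Function.uncurry Φ)) {v : P → ℝ} {b : P → ℝ × ℝ}
    (h : ∀ p₀, (ContinuousAt v p₀ ∧ ContinuousAt b p₀) ∨ (v p₀ = 0 ∧ ∀ k : ℕ, ∃ β : P → ℝ,
      Tendsto β (𝓝 p₀) (𝓝 0) ∧ ∀ p w, ‖v p • iteratedFDeriv ℝ k (Φ (b p)) w‖ ≤ β p)) :
    IsSmoothFamily fun p w => v p • Φ (b p) w := by
  have hΦb : ∀ b, ContDiff ℝ ∞ (Φ b) := fun b => hΦ.comp (contDiff_const.prodMk contDiff_id)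
  refine ⟨fun p => contDiff_const.smul (hΦb _), fun k => ?_⟩
  have hiter : ∀ q : P × W, iteratedFDeriv ℝ k (fun w => v q.1 • Φ (b q.1) w) q.2 =
      v q.1 • iteratedFDeriv ℝ k (Φ (b q.1)) q.2 := fun q =>
    iteratedFDeriv_const_smul_apply' ((hΦb _).contDiffAt.of_le (mod_cast le_top))
  simp only [hiter]
  refine continuous_iff_continuousAt.2 fun ⟨p₀, w₀⟩ => ?_
  rcases h p₀ with ⟨hv, hb⟩ | ⟨h0, hβ⟩
  · have hv' : ContinuousAt (fun q : P × W => v q.1) (p₀, w₀) :=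
      ContinuousAt.comp (g := v) (f := Prod.fst) hv continuousAt_fst
    have hb' : ContinuousAt (fun q : P × W => b q.1) (p₀, w₀) :=
      ContinuousAt.comp (g := b) (f := Prod.fst) hb continuousAt_fst
    have hk : ContinuousAt (fun q : (ℝ × ℝ) × W => iteratedFDeriv ℝ k (Φ q.1) q.2) (b p₀, w₀) :=
      (continuous_uncurry_iteratedFDeriv k hΦ).continuousAt
    exact hv'.smul (ContinuousAt.comp
      (g := fun q : (ℝ × ℝ) × W => iteratedFDeriv ℝ k (Φ q.1) q.2)
      (f := fun q : P × W => (b q.1, q.2)) hk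
      (hb'.prodMk continuousAt_snd))
  · obtain ⟨β, hβ0, hβb⟩ := hβ k
    unfold ContinuousAt
    simp only [h0, zero_smul]
    exact squeeze_zero_norm (fun q => hβb q.1 q.2)
      (hβ0.comp (continuous_fst.tendsto ((p₀, w₀) : P × W)))

theorem clockSpeed_nonneg {τ : ℝ} (h : τ ≤ 1) : 0 ≤ clockSpeed N τ :=
  mul_nonneg (Nat.cast_nonneg _) (pow_nonneg (inv_nonneg.2 (sub_nonneg.2 h)) _)

theorem exists_norm_iteratedFDeriv_compactField_le (hr : IsSymbol (-μ) r)
    (hgL : IsSymbol (1 - μ) gL) (hgS : IsSymbol (1 - 2 * μ) gS) (hμ : 1 / 2 < μ) (hμ1 : μ < 1)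
    (hT : 0 ≤ T) (hN : 1 < N * (2 * μ - 1)) {χ : Euc d × Euc d → ℝ} (hχ : ContDiff ℝ ∞ χ)
    (hc : HasCompactSupport χ) (hΩ : tsupport χ ⊆ phaseSpace d) (k : ℕ) :
    ∃ C : ℝ, ∀ h τ : ℝ, 0 ≤ h → 0 ≤ τ → τ ≤ 1 → ∀ w, ‖clockSpeed N τ • iteratedFDeriv ℝ k
      (fun w => χ w • modifiedField r gL gS (truncatedParameter T N h τ) (clock N τ) w) w‖ ≤
        C * (1 - τ) ^ (2 * μ * N - N - 1) := by
  obtain ⟨c, R, hc0, hR, hreg⟩ := exists_tsupport_subset_modifiedRegion (T := T) hμ1 hc hΩ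
  obtain ⟨C, hC, hCb⟩ := ((derivBound_const_of_hasCompactSupport hχ hc _).bilinear
    (derivBound_modifiedField (T := T) hr hgL hgS hc0 hR (by linarith) hμ1)
    (fun _ => zero_le_one) (ContinuousLinearMap.lsmul ℝ ℝ)).bound k le_top
  have hδ : 0 < 2 * μ * N - N - 1 := by linarith
  refine ⟨C * N, fun h τ hh h0 h1 w => ?_⟩
  by_cases hw : w ∈ tsupport χ
  · rcases lt_or_eq_of_le h1 with h2 | rfl
    · have h3 := hCb ⟨(truncatedParameter T N h τ, clock N τ), truncatedParameter_mem hT hh h0 h2⟩ w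
        (hreg _ hw)
      rw [norm_smul, Real.norm_of_nonneg (clockSpeed_nonneg h1)]
      refine (mul_le_mul_of_nonneg_left h3 (clockSpeed_nonneg h1)).trans (le_of_eq ?_)
      have h4 := clockSpeed_mul_rpow (N := N) (μ := μ) h2
      simp only [timeScale]
      linear_combination C * h4
    · rw [clockSpeed_one, zero_smul, norm_zero, sub_self, Real.zero_rpow hδ.ne', mul_zero]
  -- Outside the support of the cutoff there is nothing to estimate.
  · have h2 : iteratedFDeriv ℝ k (fun w =>
        χ w • modifiedField r gL gS (truncatedParameter T N h τ) (clock N τ) w) w = 0 := by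
      by_contra hne
      exact hw (closure_mono (Function.support_smul_subset_left _ _)
        (support_iteratedFDeriv_subset (𝕜 := ℝ) k hne))
    rw [h2, smul_zero, norm_zero]
    have : 0 ≤ 1 - τ := by linarith
    positivity

-- For τ < 1 everything is composed of continuous functions of (h, τ); the truncation is merely
-- continuous, which suffices since derivatives are taken in w only. At τ = 1 the bound by a
-- positive power of 1 - τ applies.
open unitInterval in
theorem isSmoothFamily_compactField (hr : IsSymbol (-μ) r) (hgL : IsSymbol (1 - μ) gL)
    (hgS : IsSymbol (1 - 2 * μ) gS) (hμ : 1 / 2 < μ) (hμ1 : μ < 1) (hT : 0 ≤ T)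
    (hN : 1 < N * (2 * μ - 1)) {χ : Euc d × Euc d → ℝ} (hχ : ContDiff ℝ ∞ χ)
    (hc : HasCompactSupport χ) (hΩ : tsupport χ ⊆ phaseSpace d) :
    IsSmoothFamily fun (p : I × I) w => χ w • compactField r gL gS T N p.1 p.2 w := by
  have hΦ : ContDiff ℝ ∞ (Function.uncurry fun (b : ℝ × ℝ) w =>
      χ w • modifiedField r gL gS b.1 b.2 w) :=
    (hχ.comp contDiff_snd).smul (contDiff_modifiedField hr.smooth hgL.smooth hgS.smooth)
  have hF : (fun (p : I × I) w => χ w • compactField r gL gS T N p.1 p.2 w) = fun p w =>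
      clockSpeed N p.2 • (fun (b : ℝ × ℝ) w => χ w • modifiedField r gL gS b.1 b.2 w)
        (truncatedParameter T N p.1 p.2, clock N p.2) w := by
    funext p w
    exact smul_comm _ _ _
  rw [hF]
  refine isSmoothFamily_of_bound (P := I × I) (v := fun p => clockSpeed N p.2)
    (b := fun p => (truncatedParameter T N p.1 p.2, clock N p.2)) hΦ fun p₀ => ?_
  rcases lt_or_eq_of_le p₀.2.2.2 with h1 | h1
  · left
    have hτ : ContinuousAt (fun p : I × I => (p.2 : ℝ)) p₀ :=
      (continuous_subtype_val.comp continuous_snd).continuousAt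
    have hh : ContinuousAt (fun p : I × I => (p.1 : ℝ)) p₀ :=
      (continuous_subtype_val.comp continuous_fst).continuousAt
    refine ⟨ContinuousAt.comp (g := clockSpeed N) (continuousAt_clockSpeed h1) hτ,
      ContinuousAt.prodMk (hh.min (continuousAt_const.mul ((continuousAt_const.sub hτ).pow N)))
        (ContinuousAt.comp (g := clock N) (continuousAt_clock h1) hτ)⟩
  · right
    have h3 : (p₀.2 : ℝ) = 1 := h1
    refine ⟨by simp only [h3, clockSpeed_one], fun k => ?_⟩
    obtain ⟨C, hC⟩ := exists_norm_iteratedFDeriv_compactField_le hr hgL hgS hμ hμ1 hT hN hχ hc hΩ k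
    have hδ : 0 < 2 * μ * N - N - 1 := by linarith
    refine ⟨fun p => C * (1 - (p.2 : ℝ)) ^ (2 * μ * N - N - 1), ?_,
      fun p w => hC p.1 p.2 p.1.2.1 p.2.2.1 p.2.2.2 w⟩
    have hcont : Continuous fun p : I × I => C * (1 - (p.2 : ℝ)) ^ (2 * μ * N - N - 1) :=
      continuous_const.mul ((continuous_const.sub (continuous_subtype_val.comp
        continuous_snd)).rpow_const fun _ => Or.inr hδ.le)
    have h4 := hcont.tendsto p₀
    simp only [h3, sub_self, Real.zero_rpow hδ.ne', mul_zero] at h4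
    exact h4

end CompactField

/-! ### Trajectories as solutions in compactified time. -/

section TimeChange

variable {d : ℕ} {r : Euc d → Euc d →L[ℝ] Euc d} {gL gS : Euc d → Euc d} {μ T : ℝ} {N : ℕ}

/-- The solutions of the compactified equation describe the trajectories. -/
theorem solution_clockInv_eq (hr : ContDiff ℝ ∞ r) (hgL : ContDiff ℝ ∞ gL) (hgS : ContDiff ℝ ∞ gS)
    (hN : N ≠ 0) {h S : ℝ} (hh : 0 ≤ h) (hS : 0 ≤ S) (hT : h * (1 + S) ≤ T)
    {u : ℝ → Euc d × Euc d}
    (hu : ∀ τ ∈ Icc (0 : ℝ) 1, HasDerivWithinAt u (compactField r gL gS T N h τ (u τ)) (Icc 0 1) τ)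
    {z : ℝ → Euc d × Euc d} (hz : ∀ s, HasDerivAt z (scaledField r gL gS h (z s)) s)
    (h0 : u 0 = z 0) : u (clockInv N S) = modifiedCoordinates r gL h S (z S) := by
  have hw : ∀ s ∈ Icc 0 S, HasDerivWithinAt (fun s => u (clockInv N s))
      (modifiedField r gL gS h s (u (clockInv N s))) (Icc 0 S) s := by
    intro s hs
    have hmem : ∀ s ∈ Icc 0 S, clockInv N s ∈ Icc (0 : ℝ) 1 := fun s hs =>
      ⟨clockInv_nonneg hs.1, (clockInv_lt_one hs.1).le⟩
    have h1 := (hu _ (hmem s hs)).scomp s (hasDerivAt_clockInv hN hs.1).hasDerivWithinAt hmem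
    refine h1.congr_deriv ?_
    rw [compactField, clock_clockInv hN hs.1, truncatedParameter_eq (clockInv_lt_one hs.1)
      (by rw [clock_clockInv hN hs.1]
          exact (mul_le_mul_of_nonneg_left (by linarith [hs.2]) hh).trans hT),
      inv_smul_smul₀ (clockSpeed_clockInv_ne_zero hN hs.1)]
  have hx : ∀ s ∈ Icc 0 S, HasDerivWithinAt
      (fun s => (modifiedPosition r gL h s (u (clockInv N s)), (u (clockInv N s)).2)) _ (Icc 0 S) s :=
    fun s hs => hasDerivWithinAt_modifiedPosition hr hgL h (hw s hs)
  have hF : ContDiff ℝ ∞ (scaledField r gL gS h) :=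
    contDiff_hamiltonField hr ((hgL.add hgS).const_smul (h ^ 2))
  -- Uniqueness is applied in the original variables, where the field is autonomous.
  have heq := eqOn_of_hasDerivWithinAt hF hx (fun s _ => (hz s).hasDerivWithinAt) (by
    rw [clockInv_zero, h0, modifiedPosition, modifierCorrection_zero]
    simp)
  have h2 := heq (right_mem_Icc.2 hS)
  rw [← h2]
  exact (modifiedCoordinates_modifiedPosition h S _).symm

/-- Convergent motion in modified coordinates solves the equation in compactified time. -/
theorem exists_compact_solution (hr : IsSymbol (-μ) r) (hgL : IsSymbol (1 - μ) gL)
    (hgS : IsSymbol (1 - 2 * μ) gS) (hμ : 1 / 2 < μ) (hμ1 : μ < 1) (hT : 0 ≤ T)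
    (hN : 1 < N * (2 * μ - 1)) (hN0 : N ≠ 0) {c R : ℝ} (hc : 0 < c) (hR : 0 ≤ R)
    {w : ℝ → Euc d × Euc d} (hw : ∀ s, HasDerivAt w (modifiedField r gL gS 0 s (w s)) s)
    (hreg : ∀ s, 0 ≤ s → (w s).2 ∈ momentumShell d c R ∧ ‖(w s).1‖ ≤ R * (1 + s) ^ (1 - μ))
    {wl : Euc d × Euc d} (hlim : Tendsto w atTop (𝓝 wl)) (hwl : wl.2 ∈ momentumShell d c R) :
    ∃ u : ℝ → Euc d × Euc d, u 0 = w 0 ∧ u 1 = wl ∧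
      ∀ τ ∈ Icc (0 : ℝ) 1, u τ ∈ phaseSpace d ∧
        HasDerivWithinAt u (compactField r gL gS T N 0 τ (u τ)) (Icc 0 1) τ := by
  set u : ℝ → Euc d × Euc d := fun τ => if τ < 1 then w (clock N τ) else wl with hu
  have hu1 : u 1 = wl := by simp [hu]
  have hlt : ∀ τ : ℝ, τ < 1 → u τ = w (clock N τ) := fun τ h => by simp [hu, h]
  have hshell : ∀ ξ ∈ momentumShell d c R, ξ ≠ 0 := fun ξ hξ h0 => by
    have := hξ.1
    rw [h0, norm_zero] at this
    linarith
  have htr : ∀ τ : ℝ, τ < 1 → truncatedParameter T N 0 τ = 0 := fun τ h =>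
    truncatedParameter_eq h (by rw [zero_mul]; exact hT)
  have hD : ∀ τ : ℝ, τ < 1 → HasDerivAt u (compactField r gL gS T N 0 τ (u τ)) τ := by
    intro τ h
    have h1 := (hw (clock N τ)).scomp τ (hasDerivAt_clock h)
    rw [compactField, htr τ h, hlt τ h]
    refine h1.congr_of_eventuallyEq ?_
    filter_upwards [Iio_mem_nhds h] with σ hσ using hlt σ hσ
  refine ⟨u, by rw [hlt 0 one_pos, clock_zero], hu1, fun τ hτ => ?_⟩
  rcases lt_or_eq_of_le hτ.2 with h | rfl
  · refine ⟨?_, (hD τ h).hasDerivWithinAt⟩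
    rw [hlt τ h]
    exact hshell _ (hreg _ (clock_nonneg hτ.1 h)).1
  · refine ⟨by rw [hu1]; exact hshell _ hwl, ?_⟩
    have hδ : 0 < 2 * μ * N - N - 1 := by linarith
    obtain ⟨B, hB, hBb⟩ := (derivBound_modifiedField (T := 0) hr hgL hgS hc hR (by linarith)
      hμ1).bound 0 (by simp)
    refine HasDerivWithinAt.mono (t := Iic 1) ?_ Icc_subset_Iic_self
    -- At τ = 1 the curve is continuous and its derivative tends to 0, so it has the left derivative
    -- 0, the value of the field there.
    refine hasDerivWithinAt_Iic_of_tendsto_deriv (s := Ioo 0 1)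
      (fun σ hσ => (hD σ hσ.2).differentiableAt.differentiableWithinAt) ?_
      (Ioo_mem_nhdsLT one_pos) ?_
    · unfold ContinuousWithinAt
      rw [hu1, nhdsWithin_Ioo_eq_nhdsLT one_pos]
      refine (hlim.comp (tendsto_clock hN0)).congr' ?_
      filter_upwards [self_mem_nhdsWithin] with σ hσ using (hlt σ hσ).symm
    · rw [compactField, clockSpeed_one, zero_smul]
      have hcont : Tendsto (fun σ : ℝ => B * N * (1 - σ) ^ (2 * μ * N - N - 1)) (𝓝[<] 1) (𝓝 0) := by
        have h1 : Continuous fun σ : ℝ => B * N * (1 - σ) ^ (2 * μ * N - N - 1) :=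
          continuous_const.mul ((continuous_const.sub continuous_id).rpow_const
            fun _ => Or.inr hδ.le)
        have h2 := h1.tendsto 1
        simp only [sub_self, Real.zero_rpow hδ.ne', mul_zero] at h2
        exact h2.mono_left nhdsWithin_le_nhds
      refine squeeze_zero_norm' ?_ hcont
      filter_upwards [Ioo_mem_nhdsLT one_pos] with σ hσ
      rw [(hD σ hσ.2).deriv, compactField, htr σ hσ.2, hlt σ hσ.2, norm_smul,
        Real.norm_of_nonneg (clockSpeed_nonneg hσ.2.le)]
      have h1 := hBb ⟨(0, clock N σ), le_rfl, clock_nonneg hσ.1.le hσ.2, by simp⟩ _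
        (hreg _ (clock_nonneg hσ.1.le hσ.2))
      rw [norm_iteratedFDeriv_zero] at h1
      refine (mul_le_mul_of_nonneg_left h1 (clockSpeed_nonneg hσ.2.le)).trans (le_of_eq ?_)
      have h4 := clockSpeed_mul_rpow (N := N) (μ := μ) hσ.2
      simp only [timeScale]
      linear_combination B * h4

open unitInterval in
/-- Solutions of the compactified equation are determined by their final values. -/
theorem compact_solution_unique (hr : IsSymbol (-μ) r) (hgL : IsSymbol (1 - μ) gL)
    (hgS : IsSymbol (1 - 2 * μ) gS) (hμ : 1 / 2 < μ) (hμ1 : μ < 1) (hT : 0 ≤ T)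
    (hN : 1 < N * (2 * μ - 1)) (h : I) {u v : ℝ → Euc d × Euc d}
    (hu : ∀ τ ∈ Icc (0 : ℝ) 1, u τ ∈ phaseSpace d ∧
      HasDerivWithinAt u (compactField r gL gS T N h τ (u τ)) (Icc 0 1) τ)
    (hv : ∀ τ ∈ Icc (0 : ℝ) 1, v τ ∈ phaseSpace d ∧
      HasDerivWithinAt v (compactField r gL gS T N h τ (v τ)) (Icc 0 1) τ)
    (h1 : u 1 = v 1) : u 0 = v 0 := by
  have hucont : ContinuousOn u (Icc 0 1) := fun τ hτ => (hu τ hτ).2.continuousWithinAt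
  have hvcont : ContinuousOn v (Icc 0 1) := fun τ hτ => (hv τ hτ).2.continuousWithinAt
  have hΩ : IsOpen (phaseSpace d) := isOpen_ne.preimage continuous_snd
  -- Cut off near both curves, endpoints included. The truncated field is Lipschitz uniformly up to
  -- τ = 1, so uniqueness also runs backwards from there.
  obtain ⟨χ, hχ, hχc, hχΩ, hχ1, -⟩ := exists_contDiff_cutoff
    ((isCompact_Icc.image_of_continuousOn hucont).union
      (isCompact_Icc.image_of_continuousOn hvcont)) hΩ (by
        rintro _ (⟨τ, hτ, rfl⟩ | ⟨τ, hτ, rfl⟩)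
        · exact (hu τ hτ).1
        · exact (hv τ hτ).1)
  obtain ⟨L, hL⟩ := (isSmoothFamily_compactField hr hgL hgS hμ hμ1 hT hN hχ hχc
    hχΩ).exists_lipschitzWith (K := tsupport χ) hχc fun p w hw => by
      simp only [image_eq_zero_of_notMem_tsupport hw, zero_smul]
  have hχ1' := eventually_nhdsSet_iff_forall.1 hχ1
  have hIic : ∀ {u : ℝ → Euc d × Euc d}, (∀ τ ∈ Icc (0 : ℝ) 1, χ (u τ) = 1) →
      (∀ τ ∈ Icc (0 : ℝ) 1, HasDerivWithinAt u (compactField r gL gS T N h τ (u τ)) (Icc 0 1) τ) →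
      ∀ τ ∈ Ioc (0 : ℝ) 1, HasDerivWithinAt u
        (χ (u τ) • compactField r gL gS T N h (projIcc 0 1 zero_le_one τ : I) (u τ)) (Iic τ) τ := by
    intro u hχu hu τ hτ
    have hτ' := Ioc_subset_Icc_self hτ
    rw [hχu τ hτ', one_smul, projIcc_of_mem _ hτ']
    exact (hu τ hτ').mono_of_mem_nhdsWithin
      (mem_of_superset (Icc_mem_nhdsLE hτ.1) (Icc_subset_Icc_right hτ.2))
  exact ODE_solution_unique_of_mem_Icc_left (s := fun _ => univ)
    (v := fun τ w => χ w • compactField r gL gS T N h (projIcc 0 1 zero_le_one τ : I) w)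
    (fun τ _ => (hL (h, projIcc 0 1 zero_le_one τ)).lipschitzOnWith) hucont
    (hIic (fun τ hτ => (hχ1' _ (Or.inl (mem_image_of_mem u hτ))).self_of_nhds) fun τ hτ => (hu τ hτ).2)
    (fun _ _ => mem_univ _) hvcont
    (hIic (fun τ hτ => (hχ1' _ (Or.inr (mem_image_of_mem v hτ))).self_of_nhds) fun τ hτ => (hv τ hτ).2)
    (fun _ _ => mem_univ _) h1 ⟨le_rfl, zero_le_one⟩

end TimeChange

/-! ### Smoothness of time T maps. -/

section FlowSmoothness

variable {E : Type} [NormedAddCommGroup E] [NormedSpace ℝ E] [FiniteDimensional ℝ E]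

open unitInterval in
/-- The time `T` map of a smooth complete vector field is smooth. -/
theorem contDiff_flow {v : E → E} (hv : ContDiff ℝ ∞ v) {φ : ℝ → E → E} (hφ0 : ∀ z, φ 0 z = z)
    (hφ : ∀ z t, HasDerivAt (fun t => φ t z) (v (φ t z)) t) (T : ℝ) : ContDiff ℝ ∞ (φ T) := by
  have hTv : ContDiff ℝ ∞ fun z => T • v z := contDiff_const.smul hv
  have hscaled : ∀ z τ, HasDerivAt (fun τ => φ (τ * T) z) (T • v (φ (τ * T) z)) τ := fun z τ => by
    simpa [Function.comp_def] using (hφ z (τ * T)).scomp τ ((hasDerivAt_id τ).mul_const T)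
  refine contDiff_iff_contDiffAt.2 fun z₀ => ?_
  -- No parameter is needed, and the time T is scaled to 1.
  obtain ⟨U, hU, hUev⟩ := exists_contDiff_local_solution (Λ := Unit) (E := E) isOpen_univ
    (F := fun _ w => T • v w) (fun χ hχ _ _ => ⟨fun _ => hχ.smul hTv, fun k =>
      ((hχ.smul hTv).continuous_iteratedFDeriv (mod_cast le_top)).comp continuous_snd⟩) ()
    (fun τ => φ (τ * T) z₀) (fun _ _ => mem_univ _) (fun τ _ => (hscaled z₀ τ).hasDerivWithinAt)
  have hfam := IsSmoothFamily.of_contDiff hU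
  have hev : ∀ᶠ z in 𝓝 z₀, φ T z = U z ((), projIcc 0 1 zero_le_one 1) := by
    have h1 : Tendsto (fun z : E => ((), z)) (𝓝 z₀) (𝓝 ((), φ (0 * T) z₀)) := by
      rw [zero_mul, hφ0]
      exact (continuous_const.prodMk continuous_id).tendsto z₀
    filter_upwards [h1.eventually hUev] with z hz
    have h2 := eqOn_of_hasDerivWithinAt hTv (fun τ hτ => (hz.2 τ hτ).2)
      (fun τ _ => (hscaled z τ).hasDerivWithinAt) (by simpa [hφ0] using hz.1)
      (right_mem_Icc.2 (zero_le_one (α := ℝ)))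
    simpa [extendTime] using h2.symm
  exact (hfam.smooth _).contDiffAt.congr_of_eventuallyEq hev

end FlowSmoothness

theorem IsSmoothFamily.clm_comp {P E G G' : Type} [TopologicalSpace P] [NormedAddCommGroup E]
    [NormedSpace ℝ E] [NormedAddCommGroup G] [NormedSpace ℝ G] [NormedAddCommGroup G']
    [NormedSpace ℝ G'] {F : P → E → G} (hF : IsSmoothFamily F) (L : G →L[ℝ] G') :
    IsSmoothFamily fun p z => L (F p z) :=
  ⟨fun p => L.contDiff.comp (hF.smooth p), fun k => by
    have h1 : ∀ q : P × E, iteratedFDeriv ℝ k (fun z => L (F q.1 z)) q.2 =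
        ContinuousLinearMap.compContinuousMultilinearMapL ℝ (fun _ : Fin k => E) G G' L
          (iteratedFDeriv ℝ k (F q.1) q.2) := fun q =>
      L.iteratedFDeriv_comp_left (hF.smooth q.1).contDiffAt (mod_cast le_top)
    simp only [h1]
    exact (ContinuousLinearMap.continuous _).comp (hF.continuous_iteratedFDeriv k)⟩

/-! ### The limit map and smooth convergence for the scaled flows. -/

section Core

variable {d : ℕ} {r : Euc d → Euc d →L[ℝ] Euc d} {gL gS : Euc d → Euc d} {μ : ℝ}

/-- The assumptions on the metric `1 + r` and on the long and short range forces. -/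
structure IsScatteringClass (r : Euc d → Euc d →L[ℝ] Euc d) (gL gS : Euc d → Euc d) (μ : ℝ) :
    Prop where
  metric : IsSymbol (-μ) r
  long : IsSymbol (1 - μ) gL
  short : IsSymbol (1 - 2 * μ) gS
  half_lt : 1 / 2 < μ
  lt_one : μ < 1
  symm : ∀ x ξ η, inner ℝ ξ (r x η) = inner ℝ η (r x ξ)
  elliptic : ∃ c : ℝ, 0 < c ∧ ∀ x ξ, c * ‖ξ‖ ^ 2 ≤ ‖ξ‖ ^ 2 + inner ℝ ξ (r x ξ)

/-- A family of trajectories of the scaled fields, with nontrapped kinetic trajectories. -/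
structure IsNontrappedFlow (r : Euc d → Euc d →L[ℝ] Euc d) (gL gS : Euc d → Euc d)
    (Z : ℝ → Euc d × Euc d → ℝ → Euc d × Euc d) : Prop where
  initial : ∀ h p, Z h p 0 = p
  deriv : ∀ h p s, HasDerivAt (Z h p) (scaledField r gL gS h (Z h p s)) s
  nontrapped : ∀ p ∈ phaseSpace d, Tendsto (fun s => ‖(Z 0 p s).1‖) atTop atTop

variable {Z : ℝ → Euc d × Euc d → ℝ → Euc d × Euc d}

theorem modifiedCoordinates_zero (h : ℝ) (z : Euc d × Euc d) :
    modifiedCoordinates r gL h 0 z = z := by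
  simp [modifiedCoordinates, modifierCorrection_zero]

theorem IsScatteringClass.exists_clock_exponent (hD : IsScatteringClass r gL gS μ) :
    ∃ N : ℕ, N ≠ 0 ∧ 1 < N * (2 * μ - 1) := by
  have h1 : 0 < 2 * μ - 1 := by linarith [hD.half_lt]
  obtain ⟨N, hN⟩ := exists_nat_gt (1 / (2 * μ - 1))
  rw [div_lt_iff₀ h1] at hN
  refine ⟨N, fun h0 => ?_, hN⟩
  rw [h0, Nat.cast_zero, zero_mul] at hN
  linarith

theorem IsNontrappedFlow.exists_compact_trajectory (hD : IsScatteringClass r gL gS μ)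
    (hZ : IsNontrappedFlow r gL gS Z) {T : ℝ} (hT : 0 ≤ T) {N : ℕ} (hN0 : N ≠ 0)
    (hN : 1 < N * (2 * μ - 1)) {p : Euc d × Euc d} (hp : p ∈ phaseSpace d) :
    ∃ (u : ℝ → Euc d × Euc d), u 0 = p ∧
      Tendsto (fun s => modifiedCoordinates r gL 0 s (Z 0 p s)) atTop (𝓝 (u 1)) ∧
      ∀ τ ∈ Icc (0 : ℝ) 1, u τ ∈ phaseSpace d ∧
        HasDerivWithinAt u (compactField r gL gS T N 0 τ (u τ)) (Icc 0 1) τ := by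
  obtain ⟨c, hc, hell⟩ := hD.elliptic
  obtain ⟨c₁, R, hc₁, hR, hreg, w, hw, hlim⟩ := exists_scattering_limit hD.metric hD.long hD.short
    hD.half_lt hD.lt_one hD.symm hc hell (hZ.deriv 0 p) (by rw [hZ.initial]; exact hp)
    (hZ.nontrapped p hp)
  obtain ⟨u, hu0, hu1, hu⟩ := exists_compact_solution hD.metric hD.long hD.short hD.half_lt hD.lt_one
    hT hN hN0 hc₁ hR (fun s => hasDerivWithinAt_univ.1
      (hasDerivWithinAt_modifiedCoordinates hD.metric.smooth hD.long.smooth 0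
        (hZ.deriv 0 p s).hasDerivWithinAt)) hreg hlim hw
  refine ⟨u, ?_, by rwa [hu1], hu⟩
  rw [hu0, modifiedCoordinates_zero, hZ.initial]

/-- The limits of the modified coordinates along the kinetic trajectories exist, determine the
trajectories, and depend smoothly on the initial data. -/
theorem IsNontrappedFlow.exists_limit (hD : IsScatteringClass r gL gS μ)
    (hZ : IsNontrappedFlow r gL gS Z) :
    ∃ W : Euc d × Euc d → Euc d × Euc d, (∀ p ∈ phaseSpace d, W p ∈ phaseSpace d ∧
      Tendsto (fun s => modifiedCoordinates r gL 0 s (Z 0 p s)) atTop (𝓝 (W p))) ∧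
      InjOn W (phaseSpace d) := by
  obtain ⟨N, hN0, hN⟩ := hD.exists_clock_exponent
  have hex : ∀ p : Euc d × Euc d, ∃ u : ℝ → Euc d × Euc d, p ∈ phaseSpace d → u 0 = p ∧
      Tendsto (fun s => modifiedCoordinates r gL 0 s (Z 0 p s)) atTop (𝓝 (u 1)) ∧
      ∀ τ ∈ Icc (0 : ℝ) 1, u τ ∈ phaseSpace d ∧
        HasDerivWithinAt u (compactField r gL gS 0 N 0 τ (u τ)) (Icc 0 1) τ := fun p => by
    by_cases hp : p ∈ phaseSpace d
    -- Only h = 0 enters, so T = 0 is enough.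
    · obtain ⟨u, hu⟩ := hZ.exists_compact_trajectory hD le_rfl hN0 hN hp
      exact ⟨u, fun _ => hu⟩
    · exact ⟨0, fun h => absurd h hp⟩
  choose u hu using hex
  refine ⟨fun p => u p 1, fun p hp => ⟨((hu p hp).2.2 1 ⟨zero_le_one, le_rfl⟩).1, (hu p hp).2.1⟩,
    fun p hp q hq hpq => ?_⟩
  rw [← (hu p hp).1, ← (hu q hq).1]
  exact compact_solution_unique hD.metric hD.long hD.short hD.half_lt hD.lt_one le_rfl hN
    (0 : unitInterval) (hu p hp).2.2 (hu q hq).2.2 hpq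

open unitInterval in
/-- Near each point of the phase space the modified coordinates along the scaled flows, and their
limit, are the values of a smooth map into the continuous functions of compactified parameters. -/
theorem IsNontrappedFlow.exists_local_family (hD : IsScatteringClass r gL gS μ)
    (hZ : IsNontrappedFlow r gL gS Z) {T : ℝ} (hT : 0 ≤ T) {N : ℕ} (hN0 : N ≠ 0)
    (hN : 1 < N * (2 * μ - 1)) {W : Euc d × Euc d → Euc d × Euc d}
    (hW : ∀ p ∈ phaseSpace d,
      Tendsto (fun s => modifiedCoordinates r gL 0 s (Z 0 p s)) atTop (𝓝 (W p)))
    {p₀ : Euc d × Euc d} (hp₀ : p₀ ∈ phaseSpace d) :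
    ∃ U : Euc d × Euc d → C(I × I, Euc d × Euc d), ContDiff ℝ ∞ U ∧
      (∀ᶠ p in 𝓝 p₀, W p = U p (0, 1)) ∧
      ∀ᶠ q : I × (Euc d × Euc d) in 𝓝 (0, p₀), ∀ S : ℝ, 0 ≤ S → (q.1 : ℝ) * (1 + S) ≤ T →
        modifiedCoordinates r gL q.1 S (Z q.1 q.2 S) =
          U q.2 (q.1, projIcc 0 1 zero_le_one (clockInv N S)) := by
  obtain ⟨u₀, hu₀0, -, hu₀⟩ := hZ.exists_compact_trajectory hD hT hN0 hN hp₀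
  have hΩ : IsOpen (phaseSpace d) := isOpen_ne.preimage continuous_snd
  obtain ⟨U, hU, hev⟩ := exists_contDiff_local_solution (Λ := I) hΩ
    (F := fun p w => compactField r gL gS T N p.1 p.2 w)
    (fun χ hχ hχc hχΩ => isSmoothFamily_compactField hD.metric hD.long hD.short hD.half_lt hD.lt_one
      hT hN hχ hχc hχΩ) 0 u₀ (fun τ hτ => (hu₀ τ hτ).1) (fun τ hτ => by
      simp only [projIcc_of_mem _ hτ]
      exact (hu₀ τ hτ).2)
  rw [hu₀0] at hev
  have hsol : ∀ᶠ q : I × (Euc d × Euc d) in 𝓝 (0, p₀), ∀ S : ℝ, 0 ≤ S → (q.1 : ℝ) * (1 + S) ≤ T →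
        modifiedCoordinates r gL q.1 S (Z q.1 q.2 S) =
          U q.2 (q.1, projIcc 0 1 zero_le_one (clockInv N S)) := by
    filter_upwards [hev] with q hq S hS hST
    refine (solution_clockInv_eq (u := extendTime (U q.2) q.1) hD.metric.smooth hD.long.smooth
      hD.short.smooth hN0 q.1.2.1 hS hST (fun τ hτ => ?_) (hZ.deriv q.1 q.2) ?_).symm
    · have h1 := (hq.2 τ hτ).2
      simp only [projIcc_of_mem _ hτ] at h1
      exact h1
    · rw [hq.1, hZ.initial]
  refine ⟨U, hU, ?_, hsol⟩
  have h1 : Tendsto (fun p : Euc d × Euc d => ((0 : I), p)) (𝓝 p₀) (𝓝 (0, p₀)) :=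
    (continuous_const.prodMk continuous_id).tendsto p₀
  filter_upwards [h1.eventually hsol, hΩ.mem_nhds hp₀] with p hp hpΩ
  -- At h = 0 the constraint h(1 + S) ≤ T holds for all S, so S → ∞, that is τ → 1, identifies W p
  -- with the value at (0, 1).
  have h2 : Tendsto (fun S => U p (0, projIcc 0 1 zero_le_one (clockInv N S))) atTop
      (𝓝 (U p (0, projIcc 0 1 zero_le_one 1))) :=
    ((continuous_extendTime_right (U p) 0).tendsto 1).comp (tendsto_clockInv hN0)
  have h3 := tendsto_nhds_unique (hW p hpΩ) (h2.congr' (by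
    filter_upwards [eventually_ge_atTop 0] with S hS
    exact (hp S hS (by simpa using hT)).symm))
  rw [h3, projIcc_right]
  rfl

open unitInterval in
/-- Smooth convergence of the modified coordinates along the scaled flows. -/
theorem IsNontrappedFlow.tendstoSmoothlyOn (hD : IsScatteringClass r gL gS μ)
    (hZ : IsNontrappedFlow r gL gS Z) {W : Euc d × Euc d → Euc d × Euc d}
    (hW : ∀ p ∈ phaseSpace d,
      Tendsto (fun s => modifiedCoordinates r gL 0 s (Z 0 p s)) atTop (𝓝 (W p)))
    (L : Euc d × Euc d →L[ℝ] Euc d) (e : Euc d × Euc d →L[ℝ] Euc d × Euc d)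
    (he : MapsTo e (phaseSpace d) (phaseSpace d)) {t : ℝ} (ht : 0 < t)
    {F : ℝ → Euc d × Euc d → Euc d} (hF : ∀ lam, 1 ≤ lam → ContDiff ℝ ∞ (F lam))
    (hFeq : ∀ lam, 1 ≤ lam → ∀ z, F lam z =
      L (modifiedCoordinates r gL lam⁻¹ (lam * t) (Z lam⁻¹ (e z) (lam * t)))) :
    TendstoSmoothlyOn F (fun z => L (W (e z))) (phaseSpace d) := by
  obtain ⟨N, hN0, hN⟩ := hD.exists_clock_exponent
  -- The compactified parameters (h, τ) for h = 1/λ and s = λt; they tend to (0, 1).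
  set k : ℝ → I × I := fun lam => (projIcc 0 1 zero_le_one lam⁻¹,
    projIcc 0 1 zero_le_one (clockInv N (lam * t)))
  have hk1 : Tendsto (fun lam : ℝ => (projIcc 0 1 zero_le_one lam⁻¹ : I)) atTop (𝓝 0) := by
    have h := (continuous_projIcc (h := zero_le_one (α := ℝ))).tendsto 0
    rw [projIcc_left] at h
    exact h.comp tendsto_inv_atTop_zero
  have hk : Tendsto k atTop (𝓝 (0, 1)) := by
    refine hk1.prodMk_nhds ?_
    have h := (continuous_projIcc (h := zero_le_one (α := ℝ))).tendsto 1
    rw [projIcc_right] at h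
    exact h.comp ((tendsto_clockInv hN0).comp (tendsto_id.atTop_mul_const ht))
  refine tendstoSmoothlyOn_of_isSmoothFamily ((eventually_ge_atTop 1).mono fun lam hlam =>
    (hF lam hlam).contDiffOn) hk fun z₀ hz₀ => ?_
  -- For λ ≥ 1 one has h(1 + s) = 1/λ + t ≤ 1 + t.
  obtain ⟨U, hU, hUW, hUZ⟩ := hZ.exists_local_family hD (T := 1 + t) (by linarith) hN0 hN hW (he hz₀)
  refine ⟨fun p z => L (U (e z) p), (IsSmoothFamily.of_contDiff (hU.comp e.contDiff)).clm_comp L,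
    ?_, ?_⟩
  · filter_upwards [(e.continuous.tendsto z₀).eventually hUW] with z hz
    rw [hz]
  · have h1 : Tendsto (fun q : ℝ × (Euc d × Euc d) => ((projIcc 0 1 zero_le_one q.1⁻¹ : I), e q.2))
        (atTop ×ˢ 𝓝 z₀) (𝓝 (0, e z₀)) :=
      (hk1.comp tendsto_fst).prodMk_nhds ((e.continuous.tendsto z₀).comp tendsto_snd)
    filter_upwards [h1.eventually hUZ, tendsto_fst.eventually (eventually_ge_atTop 1)] with q hq hq1
    have hq0 : 0 < q.1 := by linarith
    have hcoe : ((projIcc 0 1 zero_le_one q.1⁻¹ : I) : ℝ) = q.1⁻¹ := by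
      rw [projIcc_of_mem _ ⟨inv_nonneg.2 hq0.le, inv_le_one_of_one_le₀ hq1⟩]
    have h2 := hq (q.1 * t) (by positivity) (by
      rw [hcoe, mul_add, mul_one, inv_mul_cancel_left₀ hq0.ne']
      exact add_le_add_left (inv_le_one_of_one_le₀ hq1) t)
    rw [hcoe] at h2
    rw [hFeq q.1 hq1, h2]

end Core

/-! ### Existence of the flows and their scaling. -/

section Flows

variable {d : ℕ} {a : Euc d → Matrix (Fin d) (Fin d) ℝ}

theorem isTrajectory_hamiltonFlow {H : Euc d → Euc d → ℝ} {z : Euc d × Euc d}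
    (h : ∃ γ, IsTrajectory H z γ) : IsTrajectory H z fun t => hamiltonFlow H t z := by
  have e : (fun t => hamiltonFlow H t z) = h.choose := funext fun t => by
    unfold hamiltonFlow
    rw [dif_pos h]
  rw [e]
  exact h.choose_spec

theorem HasSymbolBounds.exists_neg_le {m : ℝ} (hm : m ≤ 2) {V : Euc d → ℝ}
    (hV : HasSymbolBounds m V) : ∃ C : ℝ, 0 ≤ C ∧ ∀ x, -V x ≤ C * (1 + ‖x‖) ^ 2 := by
  obtain ⟨C, hC, hb⟩ := hV.isSymbol.exists_norm_le_rpow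
  refine ⟨C, hC, fun x => (neg_le_abs _).trans ((hb x).trans ?_)⟩
  gcongr
  calc japaneseBracket x ^ m ≤ japaneseBracket x ^ (2 : ℝ) :=
        Real.rpow_le_rpow_of_exponent_le (one_le_japaneseBracket x) hm
    _ = japaneseBracket x ^ 2 := Real.rpow_two _
    _ ≤ _ := by
        have := japaneseBracket_pos x
        gcongr
        exact japaneseBracket_le x

theorem gradient_zero : ∇ (fun _ : Euc d => (0 : ℝ)) = fun _ => 0 := funext fun x => by
  rw [gradient_eq_dualVec]; simp

theorem gradient_const_mul_add {V W : Euc d → ℝ} (hV : ContDiff ℝ ∞ V) (hW : ContDiff ℝ ∞ W)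
    (c : ℝ) : ∇ (fun x => c * (V x + W x)) = fun x => c • (∇ V x + ∇ W x) := funext fun x => by
  refine hasGradientAt_of_hasFDerivAt ((((hasFDerivAt_of_contDiff hV x).add
    (hasFDerivAt_of_contDiff hW x)).const_mul c).congr_fderiv ?_)
  simp

theorem exists_hamilton_trajectory {μ : ℝ} (hμ : 0 < μ) (ha : ∀ x, (a x).PosDef)
    (hr : IsSymbol (-μ) (metricDeviation a)) {V : Euc d → ℝ} (hV : ContDiff ℝ ∞ V) {C : ℝ}
    (hC : ∀ x, -V x ≤ C * (1 + ‖x‖) ^ 2) (z : Euc d × Euc d) :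
    ∃ γ : ℝ → Euc d × Euc d, γ 0 = z ∧
      ∀ t, HasDerivAt γ (hamiltonField (metricDeviation a) (∇ V) (γ t)) t := by
  obtain ⟨c, hc, hell⟩ := exists_ellipticity hμ hr ha
  obtain ⟨C₀, hC₀, hb⟩ := hr.exists_norm_le_rpow
  exact exists_global_trajectory hr.smooth (metricDeviation_symm ha) hV
    (fun x => (hb x).trans (mul_le_of_le_one_right hC₀
      (Real.rpow_le_one_of_one_le_of_nonpos (one_le_japaneseBracket x) (by linarith)))) hc hell hC z

theorem exists_isNontrappedFlow {μ : ℝ} (hμ : 0 < μ) (ha : ∀ x, (a x).PosDef)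
    (hr : IsSymbol (-μ) (metricDeviation a)) {VL VS : Euc d → ℝ} (hVL : ContDiff ℝ ∞ VL)
    (hVS : ContDiff ℝ ∞ VS) {C : ℝ} (hC : ∀ x, -(VL x + VS x) ≤ C * (1 + ‖x‖) ^ 2)
    (hB : IsNontrapping a) : ∃ Z, IsNontrappedFlow (metricDeviation a) (∇ VL) (∇ VS) Z := by
  have hex : ∀ (h : ℝ) (p : Euc d × Euc d), ∃ γ : ℝ → Euc d × Euc d, γ 0 = p ∧
      ∀ t, HasDerivAt γ (scaledField (metricDeviation a) (∇ VL) (∇ VS) h (γ t)) t := fun h p => by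
    obtain ⟨γ, h0, hγ⟩ := exists_hamilton_trajectory hμ ha hr
      (V := fun x => h ^ 2 * (VL x + VS x)) (contDiff_const.mul (hVL.add hVS)) (C := h ^ 2 * C)
      (fun x => by
        have := mul_le_mul_of_nonneg_left (hC x) (sq_nonneg h)
        linarith) p
    refine ⟨γ, h0, fun t => ?_⟩
    have h1 := hγ t
    rw [gradient_const_mul_add hVL hVS] at h1
    exact h1
  choose Z hZ0 hZ using hex
  refine ⟨Z, hZ0, hZ, fun p hp => (hB p (Z 0 p) hp ?_).1⟩
  rw [kineticEnergy_eq_hamiltonian, isTrajectory_hamiltonian_iff ha hr.smooth contDiff_const]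
  refine ⟨hZ0 0 p, fun t => (hZ 0 p t).congr_deriv ?_⟩
  rw [gradient_zero, scaledField_zero]
  simp [hamiltonField]

variable {r : Euc d → Euc d →L[ℝ] Euc d} {gL gS g : Euc d → Euc d}
  {Z : ℝ → Euc d × Euc d → ℝ → Euc d × Euc d}

/-- Scaling time and momentum by ρ gives a solution of the scaled equation, and solutions are
unique. Two parameters h, h' are kept so that the kinetic flow, where g = 0, can be matched with h'
= 0 although ρ = ±1 forces h² = 1. -/
theorem IsNontrappedFlow.eq_scaled (hZ : IsNontrappedFlow r gL gS Z) (hr : ContDiff ℝ ∞ r)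
    (hgL : ContDiff ℝ ∞ gL) (hgS : ContDiff ℝ ∞ gS) {γ : ℝ → Euc d × Euc d}
    (hγ : ∀ t, HasDerivAt γ (hamiltonField r g (γ t)) t) {ρ h h' : ℝ} (hρ : ρ ≠ 0)
    (hh : h ^ 2 = (ρ⁻¹) ^ 2) (hg : ∀ x, h' ^ 2 • (gL x + gS x) = h ^ 2 • g x) (t : ℝ) :
    γ t = ((Z h' ((γ 0).1, ρ⁻¹ • (γ 0).2) (ρ * t)).1,
      ρ • (Z h' ((γ 0).1, ρ⁻¹ • (γ 0).2) (ρ * t)).2) := by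
  have hF : ContDiff ℝ ∞ (scaledField r gL gS h') :=
    contDiff_hamiltonField hr ((hgL.add hgS).const_smul (h' ^ 2))
  have hs : ∀ s, HasDerivAt (fun s => ((γ (ρ⁻¹ * s)).1, ρ⁻¹ • (γ (ρ⁻¹ * s)).2))
      (scaledField r gL gS h' ((γ (ρ⁻¹ * s)).1, ρ⁻¹ • (γ (ρ⁻¹ * s)).2)) s := fun s => by
    rw [scaledField, funext hg]
    exact hasDerivAt_scaled hγ hh s
  have h1 := congrFun (eq_of_hasDerivAt hF (hZ.deriv h' ((γ 0).1, ρ⁻¹ • (γ 0).2)) hs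
    (by rw [hZ.initial, mul_zero])) (ρ * t)
  rw [h1]
  simp only [inv_mul_cancel_left₀ hρ, smul_inv_smul₀ hρ]

end Flows

/-! ### Both flows and both time directions in modified coordinates. -/

section Main

variable {d : ℕ} {a : Euc d → Matrix (Fin d) (Fin d) ℝ} {V VL VS : Euc d → ℝ}
  {Z : ℝ → Euc d × Euc d → ℝ → Euc d × Euc d}

theorem isTrajectory_kineticEnergy_iff (ha : ∀ x, (a x).PosDef)
    (hr : ContDiff ℝ ∞ (metricDeviation a)) {z : Euc d × Euc d} {γ : ℝ → Euc d × Euc d} :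
    IsTrajectory (kineticEnergy a) z γ ↔
      γ 0 = z ∧ ∀ t, HasDerivAt γ (hamiltonField (metricDeviation a) (fun _ => 0) (γ t)) t := by
  rw [kineticEnergy_eq_hamiltonian, isTrajectory_hamiltonian_iff ha hr contDiff_const, gradient_zero]

/-- Multiplication of the momentum by `c`. -/
def momentumScaling (d : ℕ) (c : ℝ) : Euc d × Euc d →L[ℝ] Euc d × Euc d :=
  (ContinuousLinearMap.id ℝ (Euc d)).prodMap (c • ContinuousLinearMap.id ℝ (Euc d))

@[simp] theorem momentumScaling_apply (c : ℝ) (z : Euc d × Euc d) :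
    momentumScaling d c z = (z.1, c • z.2) := rfl

/-- The kinetic flow in modified coordinates. -/
theorem kinetic_modifiedCoordinates (ha : ∀ x, (a x).PosDef)
    (hr : ContDiff ℝ ∞ (metricDeviation a)) (hVL : ContDiff ℝ ∞ VL) (hVS : ContDiff ℝ ∞ VS)
    (hZ : IsNontrappedFlow (metricDeviation a) (∇ VL) (∇ VS) Z)
    (hflow : ∀ z, IsTrajectory (kineticEnergy a) z fun t => hamiltonFlow (kineticEnergy a) t z)
    {ε : ℝ} (hε : ε * ε = 1) (z : Euc d × Euc d) (s : ℝ) :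
    ((hamiltonFlow (kineticEnergy a) (ε * s) z).1 - ∇ (dollardModifier (kineticEnergy a) (ε * s))
        (hamiltonFlow (kineticEnergy a) (ε * s) z).2,
      (hamiltonFlow (kineticEnergy a) (ε * s) z).2) = momentumScaling d ε
      (modifiedCoordinates (metricDeviation a) (∇ VL) 0 s (Z 0 (momentumScaling d ε z) s)) := by
  have hε0 : ε ≠ 0 := left_ne_zero_of_mul_eq_one hε
  have hinv : ε⁻¹ = ε := inv_eq_of_mul_eq_one_right hε
  obtain ⟨h0, hγ⟩ := (isTrajectory_kineticEnergy_iff ha hr).1 (hflow z)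
  have h1 := hZ.eq_scaled hr (contDiff_gradient hVL) (contDiff_gradient hVS) hγ (h := 1) (h' := 0)
    hε0 (by rw [hinv, pow_two, hε.symm, pow_two]; nlinarith) (fun x => by simp) (ε * s)
  simp only [h0, hinv] at h1
  rw [← mul_assoc, hε, one_mul] at h1
  rw [h1, kineticEnergy_eq_hamiltonian, gradient_dollardModifier_smul ha hr contDiff_const
    (h := 1) (by rw [pow_two, hε]; norm_num), gradient_zero, ← mul_assoc, hε, one_mul]
  -- Without a potential term the value of h is irrelevant.
  have h2 : modifierCorrection (metricDeviation a) (fun _ => 0) 1 =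
      modifierCorrection (metricDeviation a) (∇ VL) 0 := by
    funext s ξ
    simp [modifierCorrection, modifierDensity]
  rw [h2]
  simp only [momentumScaling_apply, modifiedCoordinates, sub_add_eq_sub_sub]

/-- The flow at high momentum in modified coordinates. -/
theorem flow_modifiedCoordinates (ha : ∀ x, (a x).PosDef)
    (hr : ContDiff ℝ ∞ (metricDeviation a)) (hVL : ContDiff ℝ ∞ VL) (hVS : ContDiff ℝ ∞ VS)
    (hV : ∀ x, V x = VL x + VS x) (hZ : IsNontrappedFlow (metricDeviation a) (∇ VL) (∇ VS) Z)
    (hflow : ∀ z, IsTrajectory (hamiltonian a V) z fun t => hamiltonFlow (hamiltonian a V) t z)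
    {ε : ℝ} (hε : ε * ε = 1) {lam : ℝ} (hlam : 0 < lam) (t : ℝ) (z : Euc d × Euc d) :
    ((hamiltonFlow (hamiltonian a V) t (z.1, lam • z.2)).1 -
        ∇ (dollardModifier (hamiltonian a VL) t)
          (hamiltonFlow (hamiltonian a V) t (z.1, lam • z.2)).2,
      lam⁻¹ • (hamiltonFlow (hamiltonian a V) t (z.1, lam • z.2)).2) = momentumScaling d ε
      (modifiedCoordinates (metricDeviation a) (∇ VL) lam⁻¹ (lam * (ε * t))
        (Z lam⁻¹ (momentumScaling d ε z) (lam * (ε * t)))) := by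
  have hε0 : ε ≠ 0 := left_ne_zero_of_mul_eq_one hε
  have hε2 : ε ^ 2 = 1 := by rw [pow_two, hε]
  have hinv : ε⁻¹ = ε := inv_eq_of_mul_eq_one_right hε
  have hρ : ε * lam ≠ 0 := mul_ne_zero hε0 hlam.ne'
  have hVeq : V = fun x => 1 * (VL x + VS x) := funext fun x => by rw [hV, one_mul]
  have hVsm : ContDiff ℝ ∞ V := by rw [hVeq]; exact contDiff_const.mul (hVL.add hVS)
  have hgrad : ∇ V = fun x => ∇ VL x + ∇ VS x := by
    rw [hVeq, gradient_const_mul_add hVL hVS]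
    simp
  obtain ⟨h0, hγ⟩ := (isTrajectory_hamiltonian_iff ha hr hVsm).1 (hflow (z.1, lam • z.2))
  -- The scaling factor is ρ = ελ: for ε = -1 it reverses time and momentum together.
  have h1 := hZ.eq_scaled hr (contDiff_gradient hVL) (contDiff_gradient hVS) hγ (h := lam⁻¹)
    (h' := lam⁻¹) hρ (by rw [mul_inv, mul_pow, hinv, hε2, one_mul]) (fun x => by rw [hgrad]) t
  have h2 : (ε * lam)⁻¹ • lam • z.2 = ε • z.2 := by
    rw [smul_smul, mul_inv, hinv, mul_assoc, inv_mul_cancel₀ hlam.ne', mul_one]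
  simp only [h0, h2] at h1
  have h3 : ε * lam * t = lam * (ε * t) := by ring
  rw [h3] at h1
  rw [h1, gradient_dollardModifier_smul ha hr hVL (h := lam⁻¹)
    (by rw [mul_pow, hε2, one_mul, ← mul_pow, mul_inv_cancel₀ hlam.ne', one_pow]), h3, smul_smul]
  have h4 : lam⁻¹ * (ε * lam) = ε := by field_simp
  rw [h4]
  simp only [momentumScaling_apply, modifiedCoordinates, sub_add_eq_sub_sub]

theorem contDiff_hamiltonFlow (ha : ∀ x, (a x).PosDef)
    (hr : ContDiff ℝ ∞ (metricDeviation a)) (hV : ContDiff ℝ ∞ V)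
    (hflow : ∀ z, IsTrajectory (hamiltonian a V) z fun t => hamiltonFlow (hamiltonian a V) t z)
    (t : ℝ) : ContDiff ℝ ∞ (hamiltonFlow (hamiltonian a V) t) := by
  have h := fun z => (isTrajectory_hamiltonian_iff ha hr hV).1 (hflow z)
  exact contDiff_flow (contDiff_hamiltonField hr (contDiff_gradient hV)) (fun z => (h z).1)
    (fun z => (h z).2) t

theorem contDiff_gradient_dollardModifier (ha : ∀ x, (a x).PosDef)
    (hr : ContDiff ℝ ∞ (metricDeviation a)) (hV : ContDiff ℝ ∞ V) (t : ℝ) :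
    ContDiff ℝ ∞ (∇ (dollardModifier (hamiltonian a V) t)) := by
  rw [funext (gradient_dollardModifier ha hr hV t)]
  exact (contDiff_id.const_smul t).add (contDiff_modifierCorrection hr (contDiff_gradient hV)
    contDiff_const contDiff_const contDiff_id)

end Main

/-- One exponent κ replaces μ and ν. The bound κ ≤ ν/2 gives the short range force order 1 - ν ≤ 1 -
2κ, the cap 3/4 ensures κ < 1, and κ > 1/2 survives because μ > 1/2 and ν > 1. -/
theorem isScatteringClass_of_bounds {d : ℕ} {a : Euc d → Matrix (Fin d) (Fin d) ℝ}
    {V VL VS : Euc d → ℝ} {μ ν : ℝ} (hμ : 1 / 2 < μ) (hν : 1 < ν) (hA : IsLongRange a V μ)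
    (hVL : HasSymbolBounds (2 - μ) VL) (hVS : HasSymbolBounds (2 - ν) VS) :
    ∃ κ : ℝ, IsScatteringClass (metricDeviation a) (∇ VL) (∇ VS) κ := by
  set κ := min (min μ (3 / 4)) (ν / 2)
  have h1 : κ ≤ μ := (min_le_left _ _).trans (min_le_left _ _)
  have h2 : κ ≤ ν / 2 := min_le_right _ _
  have h3 : κ ≤ 3 / 4 := (min_le_left _ _).trans (min_le_right _ _)
  have h4 : 1 / 2 < κ := lt_min (lt_min hμ (by norm_num)) (by linarith)
  have hr := (isSymbol_metricDeviation hA.metric).mono (neg_le_neg h1)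
  exact ⟨κ, hr, hVL.isSymbol.gradient.mono (by linarith), hVS.isSymbol.gradient.mono (by linarith),
    h4, by linarith, metricDeviation_symm hA.posDef,
    exists_ellipticity (by linarith) hr hA.posDef⟩

end

/-! ### The theorem. -/

theorem theorem6 (d : ℕ) (hd : 1 ≤ d)
    (a : Euc d → Matrix (Fin d) (Fin d) ℝ) (V VL VS : Euc d → ℝ) (μ ν : ℝ)
    (hμ : 1 / 2 < μ) (hν : 1 < ν)
    (hA : IsLongRange a V μ)
    (hV : ∀ x, V x = VL x + VS x)
    (hVL : HasSymbolBounds (2 - μ) VL) (hVS : HasSymbolBounds (2 - ν) VS)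
    (hB : IsNontrapping a) :
    (∀ z : Euc d × Euc d,
      IsTrajectory (kineticEnergy a) z (fun t => hamiltonFlow (kineticEnergy a) t z) ∧
      IsTrajectory (hamiltonian a V) z (fun t => hamiltonFlow (hamiltonian a V) t z)) ∧
    ∀ ε : ℝ, (ε = 1 ∨ ε = -1) →
      ∃ xlim ξlim : Euc d × Euc d → Euc d,
        (∀ z ∈ phaseSpace d,
          IsScatteringData a ε z (xlim z, ξlim z) ∧ ξlim z ≠ 0 ∧
          z = waveMap a ε (xlim z, ξlim z)) ∧
        ∀ t : ℝ, 0 < ε * t →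
          TendstoSmoothlyOn
            (fun lam z =>
              (hamiltonFlow (hamiltonian a V) t (z.1, lam • z.2)).1 -
                ∇ (dollardModifier (hamiltonian a VL) t)
                  (hamiltonFlow (hamiltonian a V) t (z.1, lam • z.2)).2)
            xlim (phaseSpace d) ∧
          TendstoSmoothlyOn
            (fun lam z => lam⁻¹ • (hamiltonFlow (hamiltonian a V) t (z.1, lam • z.2)).2)
            ξlim (phaseSpace d) := by
  have ha := hA.posDef
  obtain ⟨κ, hD⟩ := isScatteringClass_of_bounds hμ hν hA hVL hVS
  have hκ : 0 < κ := by linarith [hD.half_lt]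
  have hr := hD.metric.smooth
  obtain ⟨C, hC, hCb⟩ := hA.potential.exists_neg_le (by linarith)
  have hk : ∀ z, IsTrajectory (kineticEnergy a) z fun t => hamiltonFlow (kineticEnergy a) t z :=
    fun z => isTrajectory_hamiltonFlow <| by
      obtain ⟨γ, hγ⟩ := exists_hamilton_trajectory hκ ha hD.metric (V := fun _ => 0) contDiff_const
        (C := 0) (fun x => by simp) z
      rw [gradient_zero] at hγ
      exact ⟨γ, (isTrajectory_kineticEnergy_iff ha hr).2 hγ⟩
  have hf : ∀ z, IsTrajectory (hamiltonian a V) z fun t => hamiltonFlow (hamiltonian a V) t z :=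
    fun z => isTrajectory_hamiltonFlow <| by
      obtain ⟨γ, hγ⟩ := exists_hamilton_trajectory hκ ha hD.metric hA.potential.smooth hCb z
      exact ⟨γ, (isTrajectory_hamiltonian_iff ha hr hA.potential.smooth).2 hγ⟩
  obtain ⟨Z, hZ⟩ := exists_isNontrappedFlow hκ ha hD.metric hVL.smooth hVS.smooth
    (fun x => by rw [← hV]; exact hCb x) hB
  obtain ⟨W, hW, hinj⟩ := hZ.exists_limit hD
  refine ⟨fun z => ⟨hk z, hf z⟩, fun ε hε => ?_⟩
  have hεε : ε * ε = 1 := by rcases hε with rfl | rfl <;> norm_num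
  have hε0 : ε ≠ 0 := left_ne_zero_of_mul_eq_one hεε
  have he : ∀ z, z ∈ phaseSpace d → momentumScaling d ε z ∈ phaseSpace d :=
    fun z hz => smul_ne_zero hε0 hz
  have hlim : ∀ z ∈ phaseSpace d, Tendsto (fun s => momentumScaling d ε
      (modifiedCoordinates (metricDeviation a) (∇ VL) 0 s (Z 0 (momentumScaling d ε z) s))) atTop
      (𝓝 (momentumScaling d ε (W (momentumScaling d ε z)))) := fun z hz =>
    ((momentumScaling d ε).continuous.tendsto _).comp (hW _ (he z hz)).2
  have hscat : ∀ z ∈ phaseSpace d,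
      IsScatteringData a ε z (momentumScaling d ε (W (momentumScaling d ε z))) := by
    intro z hz
    have h1 := hlim z hz
    simp only [← kinetic_modifiedCoordinates ha hr hVL.smooth hVS.smooth hZ hk hεε] at h1
    exact ⟨h1.fst_nhds, h1.snd_nhds⟩
  have hscat_inj : ∀ z ∈ phaseSpace d, ∀ z' ∈ phaseSpace d,
      IsScatteringData a ε z' (momentumScaling d ε (W (momentumScaling d ε z))) → z = z' := by
    intro z hz z' hz' h
    have hcancel : Function.Injective (momentumScaling d ε) := fun p q hpq => by
      rw [momentumScaling_apply, momentumScaling_apply, Prod.mk.injEq] at hpq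
      exact Prod.ext hpq.1 (smul_right_injective _ hε0 hpq.2)
    refine hcancel (hinj (he z hz) (he z' hz') (hcancel ?_))
    exact Prod.ext (tendsto_nhds_unique h.1 (hscat z' hz').1)
      (tendsto_nhds_unique h.2 (hscat z' hz').2)
  refine ⟨fun z => (momentumScaling d ε (W (momentumScaling d ε z))).1,
    fun z => (momentumScaling d ε (W (momentumScaling d ε z))).2, fun z hz => ⟨hscat z hz,
      he _ (hW _ (he z hz)).1, ?_⟩, fun t ht => ?_⟩
  -- The wave map picks some preimage; injectivity of the scattering data shows that it is z.
  · have hex : ∃ z' ∈ phaseSpace d,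
        IsScatteringData a ε z' (momentumScaling d ε (W (momentumScaling d ε z))) :=
      ⟨z, hz, hscat z hz⟩
    have h1 : waveMap a ε (momentumScaling d ε (W (momentumScaling d ε z))) = hex.choose := by
      unfold waveMap
      rw [dif_pos hex]
    exact (hscat_inj z hz _ hex.choose_spec.1 hex.choose_spec.2).trans h1.symm
  · have hsmooth : ∀ lam : ℝ, ContDiff ℝ ∞ fun z : Euc d × Euc d =>
        hamiltonFlow (hamiltonian a V) t (z.1, lam • z.2) := fun lam =>
      (contDiff_hamiltonFlow ha hr hA.potential.smooth hf t).comp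
        (contDiff_fst.prodMk (contDiff_snd.const_smul lam))
    have hcoord := fun (lam : ℝ) (hlam : 1 ≤ lam) => flow_modifiedCoordinates ha hr hVL.smooth
      hVS.smooth hV hZ hf hεε (zero_lt_one.trans_le hlam) t
    have hWlim := fun p hp => (hW p hp).2
    constructor
    · refine hZ.tendstoSmoothlyOn hD hWlim
        ((ContinuousLinearMap.fst ℝ (Euc d) (Euc d)).comp (momentumScaling d ε))
        (momentumScaling d ε) he ht (fun lam _ => ?_) fun lam hlam z =>
          congrArg Prod.fst (hcoord lam hlam z)
      exact (contDiff_fst.comp (hsmooth lam)).sub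
        ((contDiff_gradient_dollardModifier ha hr hVL.smooth t).comp
          (contDiff_snd.comp (hsmooth lam)))
    · refine hZ.tendstoSmoothlyOn hD hWlim
        ((ContinuousLinearMap.snd ℝ (Euc d) (Euc d)).comp (momentumScaling d ε))
        (momentumScaling d ε) he ht (fun lam _ => ?_) fun lam hlam z =>
          congrArg Prod.snd (hcoord lam hlam z)
      exact (contDiff_snd.comp (hsmooth lam)).const_smul lam⁻¹
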